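/- Let $\mathbb T=\mathbb R/\mathbb Z$, $T>0$, $p\in[1,2)$, $s>1/2$. Let $f:\mathbb R\to\mathbb R$ be bounded and Lipschitz and let $u_0\in L_2(\mathbb T)$. Functions and distributions on $\mathbb T$ are real-valued. For $\sigma\in\mathbb R$ let $H_\sigma(\mathbb T)$ be the Sobolev space with $\|g\|_{H_\sigma}^2=\sum_{n\in\mathbb Z}(1+4\pi^2n^2)^\sigma|\hat g(n)|^2$; in particular $H_{-1}(\mathbb T)$ carries the norm dual to $\varphi\mapsto(\|\varphi\|_{L_2}^2+\|\partial_x\varphi\|_{L_2}^2)^{1/2}$. Let $\mathcal X=C([0,T];H_{-1}(\mathbb T))\cap L_p([0,T]\times\mathbb T)$, with the coarsest topology finer than the uniform topology of $C([0,T];H_{-1}(\mathbb T))$ and the strong topology of $L_p([0,T]\times\mathbb T)$. Let $(-\partial_{xx})^{r}$ be the Fourier multiplier $(2\pi|n|)^{2r}$, let $\dot H_s(\mathbb T)$ be the homogeneous Sobolev space (modulo constants) with norm $\|h\|_{\dot H_s}=\|(-\partial_{xx})^{s/2}h\|_{L_2(\mathbb T)}$, and let $\mathcal H=L_2([0,T];\dot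 H_s(\mathbb T))$. For a distribution $g$ on $(0,T)\times\mathbb T$ set $\|g\|_{\mathcal H^*}=\|h\|_{\mathcal H}$ if $g=(-\partial_{xx})^s h$ for some (necessarily unique) $h\in\mathcal H$, and $\|g\|_{\mathcal H^*}=+\infty$ otherwise. For $\varepsilon>0$ define $I_\varepsilon:\mathcal X\to[0,+\infty]$ by $$I_\varepsilon(u)=\frac{\varepsilon^{-1}}2\Big\|\partial_t u+\partial_x f(u)+\frac\varepsilon2(-\partial_{xx})^s u\Big\|_{\mathcal H^*}^2$$ if $u\in\mathcal H\cap C([0,T];L_2(\mathbb T))$ and $u(0)=u_0$, and $I_\varepsilon(u)=+\infty$ otherwise. (Here $u\in\mathcal H$ means that the class of $u$ modulo constants in $x$ belongs to $\mathcal H$; the mean of $u$ need not vanish.) Then, for every $\varepsilon>0$, $I_\varepsilon$ is lower semicontinuous on $\mathcal X$ and coercive on $\mathcal X$: for every $M\in[0,\infty)$ there is a compact set $K_M\subset\mathcal X$ with $\{u\in\mathcal X:\ I_\varepsilon(u)\le M\}\subset K_M$. -/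

import Mathlib

open MeasureTheory Set
open scoped ENNReal NNReal ComplexConjugate

noncomputable section

namespace FracCost

/-- The inhomogeneous Sobolev space `H_σ(𝕋)` of real-valued distributions on `𝕋 = ℝ/ℤ`, for any
real order `σ`. A distribution `g` with Fourier coefficients `ĝ(n)` is stored as the
square-summable sequence `n ↦ (1 + 4π²n²)^(σ/2) ĝ(n)`, so that the norm is
`‖g‖² = ∑ (1 + 4π²n²)^σ |ĝ(n)|²`; for `σ = -1` this is exactly the norm dual to
`‖φ‖² = ‖φ‖²_{L₂} + ‖∂ₓφ‖²_{L₂}`. The condition says that `g` is real. -/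
def Sobolev (_σ : ℝ) : Submodule ℝ (lp (fun _ : ℤ => ℂ) 2) where
  carrier := {a | ∀ n : ℤ, a (-n) = conj (a n)}
  add_mem' := by
    intro a b ha hb n
    simp [ha n, hb n]
  zero_mem' := by
    intro n
    simp
  smul_mem' := by
    intro c a ha n
    simp [ha n]

/-- The Fourier coefficient `ĝ(n)` of `g ∈ H_σ(𝕋)`. -/
def sobolevCoeff {σ : ℝ} (g : Sobolev σ) (n : ℤ) : ℂ :=
  (((1 + (2 * Real.pi * n) ^ 2) ^ (-σ / 2) : ℝ) : ℂ) * (g : lp (fun _ : ℤ => ℂ) 2) n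

/-- The homogeneous Sobolev space `Ḣ_s(𝕋)` of real-valued distributions modulo constants.
The class of `h` is stored as the square-summable sequence of Fourier coefficients of
`(-∂ₓₓ)^{s/2} h`, i.e. `n ↦ (2π|n|)^s ĥ(n)`, which vanishes at `n = 0`, so that the norm is
`‖h‖ = ‖(-∂ₓₓ)^{s/2} h‖_{L₂}`. -/
def HomSobolev (_s : ℝ) : Submodule ℝ (lp (fun _ : ℤ => ℂ) 2) where
  carrier := {a | a 0 = 0 ∧ ∀ n : ℤ, a (-n) = conj (a n)}
  add_mem' := by
    rintro a b ⟨ha0, ha⟩ ⟨hb0, hb⟩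
    exact ⟨by simp [ha0, hb0], fun n => by simp [ha n, hb n]⟩
  zero_mem' := ⟨by simp, fun n => by simp⟩
  smul_mem' := by
    rintro c a ⟨ha0, ha⟩
    exact ⟨by simp [ha0], fun n => by simp [ha n]⟩

/-- The Fourier coefficient `ĥ(n)` of the mean-zero representative of `h ∈ Ḣ_s(𝕋)`. -/
def homCoeff {s : ℝ} (h : HomSobolev s) (n : ℤ) : ℂ :=
  (((2 * Real.pi * |(n : ℝ)|) ^ (-s) : ℝ) : ℂ) * (h : lp (fun _ : ℤ => ℂ) 2) n

/-- The `n`-th Fourier coefficient of a real function on `𝕋`. -/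
def realCoeff (w : UnitAddCircle → ℝ) (n : ℤ) : ℂ :=
  fourierCoeff (fun y => ((w y : ℝ) : ℂ)) n

/-- The pairing `⟨(-∂ₓₓ)^s g, φ⟩ = ∑ (2π|n|)^{2s} ĝ(n) conj(φ̂(n))` of two real distributions
with Fourier coefficients `a = ĝ`, `b = φ̂` (the sum is real because `g`, `φ` are). -/
def fracPairing (s : ℝ) (a b : ℤ → ℂ) : ℝ :=
  ∑' n : ℤ, (2 * Real.pi * |(n : ℝ)|) ^ (2 * s) * (a n * conj (b n)).re

/-- Lebesgue measure on `[0,T]`. -/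
def timeMeasure (T : ℝ) : Measure (Icc (0 : ℝ) T) :=
  Measure.comap Subtype.val volume

instance timeMeasure_isFinite (T : ℝ) : IsFiniteMeasure (timeMeasure T) := by
  constructor
  rw [timeMeasure, comap_subtype_coe_apply measurableSet_Icc]
  exact (measure_mono (Set.image_subset_iff.mpr fun x _ => x.2)).trans_lt measure_Icc_lt_top

/-- Lebesgue measure on `[0,T] × 𝕋`. -/
def spaceTimeMeasure (T : ℝ) : Measure (Icc (0 : ℝ) T × UnitAddCircle) :=
  (timeMeasure T).prod volume

instance spaceTimeMeasure_isFinite (T : ℝ) : IsFiniteMeasure (spaceTimeMeasure T) := by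
  unfold spaceTimeMeasure
  infer_instance

/-- The space `𝒳 = C([0,T]; H_{-1}(𝕋)) ∩ L_p([0,T] × 𝕋)`: a continuous curve `u(·)` in `H_{-1}`
together with a function `w ∈ L_p`, such that for a.e. `t` the distribution `u(t)` is the function
`w(t, ·)`. As a subtype of the product it carries the join of the two metric topologies. -/
abbrev StateSpace (T : ℝ) (p : ℝ≥0∞) :=
  {u : C(Icc (0 : ℝ) T, Sobolev (-1)) × Lp ℝ p (spaceTimeMeasure T) //
    ∀ᵐ t ∂timeMeasure T, ∀ n : ℤ, sobolevCoeff (u.1 t) n = realCoeff (fun y => u.2 (t, y)) n}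

/-- The space `𝓗 = L₂([0,T]; Ḣ_s(𝕋))`. -/
abbrev EnergySpace (T s : ℝ) :=
  Lp (HomSobolev s) 2 (timeMeasure T)

/-- `C^∞` functions on `(0,T) × 𝕋` with compact support (extended by zero in time). -/
structure IsTest (T : ℝ) (φ : ℝ × UnitAddCircle → ℝ) : Prop where
  smooth : ContDiff ℝ ((⊤ : ℕ∞) : WithTop ℕ∞)
    (fun z : ℝ × ℝ => φ (z.1, (z.2 : UnitAddCircle)))
  support : ∃ a b : ℝ, 0 < a ∧ b < T ∧ ∀ t, t ∉ Icc a b → ∀ x, φ (t, x) = 0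

/-- `∂_t φ`. -/
def dt (φ : ℝ × UnitAddCircle → ℝ) (t : ℝ) (x : UnitAddCircle) : ℝ :=
  deriv (fun r : ℝ => φ (r, x)) t

/-- `∂_x φ`. -/
def dx (φ : ℝ × UnitAddCircle → ℝ) (t : ℝ) (x : UnitAddCircle) : ℝ :=
  deriv (fun r : ℝ => φ (t, x + (r : UnitAddCircle))) 0

/-- The distribution `∂_t u + ∂_x f(u) + (ε/2) (-∂ₓₓ)^s u` on `(0,T) × 𝕋`, as a functional of the
test function `φ`. -/
def transportResidual (T ε s : ℝ) (p : ℝ≥0∞) (f : ℝ → ℝ) (u : StateSpace T p)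
    (φ : ℝ × UnitAddCircle → ℝ) : ℝ :=
  - (∫ z : Icc (0 : ℝ) T × UnitAddCircle, u.1.2 z * dt φ z.1 z.2 ∂spaceTimeMeasure T)
  - (∫ z : Icc (0 : ℝ) T × UnitAddCircle, f (u.1.2 z) * dx φ z.1 z.2 ∂spaceTimeMeasure T)
  + (ε / 2) * ∫ t : Icc (0 : ℝ) T,
      fracPairing s (sobolevCoeff (u.1.1 t)) (realCoeff fun y => φ ((t : ℝ), y)) ∂timeMeasure T

/-- `‖g‖²_{𝓗*}` for a distribution `g` on `(0,T) × 𝕋`, `𝓗* = L₂([0,T]; Ḣ_{-s}(𝕋))`: it is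
`∫₀ᵀ ‖(-∂ₓₓ)^{s/2} h(t)‖²_{L₂} dt` if `g = (-∂ₓₓ)^s h` with `h ∈ 𝓗` (such an `h` is unique), and
`+∞` (the infimum of the empty set) if there is no such `h`. -/
def dualNormSq (T s : ℝ) (g : (ℝ × UnitAddCircle → ℝ) → ℝ) : ℝ≥0∞ :=
  ⨅ (h : EnergySpace T s)
    (_ : ∀ φ : ℝ × UnitAddCircle → ℝ, IsTest T φ →
      g φ = ∫ t : Icc (0 : ℝ) T,
        fracPairing s (homCoeff (h t)) (realCoeff fun y => φ ((t : ℝ), y)) ∂timeMeasure T),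
    ENNReal.ofReal (‖h‖ ^ 2)

/-- `u ∈ 𝓗`. The zero mode is not constrained, `Ḣ_s` being a space modulo constants. -/
def MemEnergy (T s : ℝ) (p : ℝ≥0∞) (u : StateSpace T p) : Prop :=
  ∃ k : EnergySpace T s, ∀ᵐ t ∂timeMeasure T, ∀ n : ℤ, n ≠ 0 →
    sobolevCoeff (u.1.1 t) n = homCoeff (k t) n

/-- `u ∈ C([0,T]; L₂(𝕋))` and `u(0) = u₀`. -/
def MemL2Curve (T : ℝ) (p : ℝ≥0∞) (u₀ : Lp ℝ 2 (volume : Measure UnitAddCircle))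
    (u : StateSpace T p) : Prop :=
  ∃ v : C(Icc (0 : ℝ) T, Lp ℝ 2 (volume : Measure UnitAddCircle)),
    (∀ t : Icc (0 : ℝ) T, ∀ n : ℤ, sobolevCoeff (u.1.1 t) n = realCoeff (v t) n) ∧
    ∀ t : Icc (0 : ℝ) T, (t : ℝ) = 0 → v t = u₀

open Classical in
/-- The control cost functional `I_ε : 𝒳 → [0, +∞]`. -/
def costFunctional (T ε s : ℝ) (p : ℝ≥0∞) (f : ℝ → ℝ)
    (u₀ : Lp ℝ 2 (volume : Measure UnitAddCircle)) (u : StateSpace T p) : ℝ≥0∞ :=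
  if MemEnergy T s p u ∧ MemL2Curve T p u₀ u then
    ENNReal.ofReal (ε⁻¹ / 2) * dualNormSq T s (transportResidual T ε s p f u)
  else ⊤

end FracCost

end

/-!
# Lower semicontinuity and coercivity of the control cost

A state `u` has finite cost when it has finite energy `∫₀ᵀ ‖u(t)‖²_{Ḣ_s} dt`, is a continuous curve
in `L₂` starting from `u₀`, and solves `∂ₜu + ∂ₓf(u) + (ε/2)(-∂ₓₓ)^s u = (-∂ₓₓ)^s h` for a control
`h ∈ L₂(Ḣ_s)`; the cost is `‖h‖²/(2ε)`. Everything is done on the Fourier modes `aₙ(t)` of `u`.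

*Modes.* Testing the equation with `ψ(t) Re(c e^{-2πinx})` and applying the du Bois-Reymond lemma
shows that `aₙ` is the primitive of an explicit integrable function
(`IsControl.modeCoeff_eq`), and hence gives the balance of `e^{-Bt}|aₙ(t)|²`
(`exp_mul_norm_sq_eq`).

*Energy estimate.* The flux contributes `2π|n| |F̂ₙ||aₙ|` to the balance of the `n`-th mode, where
`F = f(u)`. No chain rule is used: by the Gagliardo form of the `H_{1/2}` seminorm a Lipschitz map
acts boundedly on `H_{1/2}`, that is `∑ |n| |F̂ₙ|² ≤ C Lip(f)² ∑ |n| |aₙ|²`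
(`tsum_abs_mul_realCoeff_comp_le`), and since `2s > 1` the dissipation
`(ε/2) ∑ (2π|n|)^{2s} |aₙ|²` absorbs `∑ |n| |aₙ|²` up to a multiple of `∑ |aₙ|²`, which the weight
`e^{-Bt}` takes care of. So the norms of `u` in `C([0,T]; L₂)` and in `L₂(Ḣ_s)` are bounded in
terms of `‖u₀‖` and `‖h‖` (`exists_apriori_bound`). Summing suprema in time of the single modes
instead gives `∑ sup_t |aₙ(t)|² < ∞` (`IsControl.exists_summable_bound`), so a controlled state of
finite energy is automatically a continuous curve in `L₂` (`IsControl.memL2Curve`).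

*Closedness of sublevel sets* (`isClosed_sublevel`). Along a convergent sequence of states, nearly
optimal controls are bounded and converge weakly along an ultrafilter. The residual tested against a
fixed function is continuous in the state, because `f` is Lipschitz and convergence in `L_p` is
strong; the weak limit is therefore a control of the limit state, and its norm is no larger. The
energy is lower semicontinuous by Fatou's lemma, and continuity in `L₂` of the limit was noted above.

*Compactness of sublevel sets* (`isCompact_sublevel`). The equation makes each single mode
equicontinuous, so by the Arzelà–Ascoli theorem and a diagonal argument a subsequence has all its
modes uniformly convergent. The bound in `C([0,T]; L₂)` makes the high modes uniformly small in
`C([0,T]; H_{-1})`, the bound in `L₂(Ḣ_s)` makes them uniformly small in `L₂([0,T] × 𝕋)`, hence in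
`L_p` as `p ≤ 2` (`exists_dist_sq_le`). The subsequence is then Cauchy, and the state space is
complete (`isClosed_setOf_compatible`).
-/

open Filter Topology

noncomputable section

namespace FracCost

/-! ### Primitives and weak derivatives on `[0,T]` -/

theorem integral_timeMeasure {E : Type*} [NormedAddCommGroup E] [NormedSpace ℝ E] {T : ℝ}
    (hT : 0 ≤ T) (g : Icc (0 : ℝ) T → E) :
    ∫ t, g t ∂timeMeasure T = ∫ r in (0 : ℝ)..T, IccExtend hT g r := by
  rw [intervalIntegral.integral_of_le hT, ← integral_Icc_eq_integral_Ioc,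
    ← integral_subtype_comap measurableSet_Icc]
  simp [timeMeasure]

theorem setIntegral_timeMeasure {E : Type*} [NormedAddCommGroup E] [NormedSpace ℝ E] {T : ℝ}
    (hT : 0 ≤ T) (g : Icc (0 : ℝ) T → E) (t : Icc (0 : ℝ) T) :
    ∫ r in Iic t, g r ∂timeMeasure T = ∫ r in (0 : ℝ)..t, IccExtend hT g r := by
  rw [← integral_indicator measurableSet_Iic, integral_timeMeasure hT,
    intervalIntegral.integral_of_le hT, intervalIntegral.integral_of_le t.2.1,
    ← integral_indicator measurableSet_Ioc, ← integral_indicator measurableSet_Ioc]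
  congr 1
  ext r
  by_cases h : r ∈ Ioc 0 T
  · rw [indicator_of_mem h, IccExtend_of_mem hT _ ⟨h.1.le, h.2⟩]
    by_cases h' : r ≤ t
    · rw [indicator_of_mem (show r ∈ Ioc (0 : ℝ) t from ⟨h.1, h'⟩), indicator_of_mem,
        IccExtend_of_mem hT _ ⟨h.1.le, h.2⟩]
      exact h'
    · have n1 : (⟨r, h.1.le, h.2⟩ : Icc (0 : ℝ) T) ∉ Iic t := fun h2 => h' h2
      have n2 : r ∉ Ioc (0 : ℝ) t := fun h2 => h' h2.2
      rw [indicator_of_notMem n1, indicator_of_notMem n2]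
  · rw [indicator_of_notMem h, indicator_of_notMem]
    exact fun h2 => h ⟨h2.1, h2.2.trans t.2.2⟩

theorem intervalIntegrable_of_timeMeasure {E : Type*} [NormedAddCommGroup E] {T : ℝ}
    (hT : 0 ≤ T) {g : Icc (0 : ℝ) T → E} (hg : Integrable g (timeMeasure T)) :
    IntervalIntegrable (IccExtend hT g) volume 0 T := by
  rw [intervalIntegrable_iff_integrableOn_Icc_of_le hT,
    integrableOn_iff_comap_subtypeVal measurableSet_Icc]
  have : IccExtend hT g ∘ (Subtype.val : Icc (0 : ℝ) T → ℝ) = g := by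
    ext t; simp
  rw [this]
  exact hg

/-- The product of two primitives of integrable functions is a primitive. The integrands are only
integrable, so this is the product rule for absolutely continuous functions. -/
theorem mul_eq_integral_of_primitive {T : ℝ} (hT : 0 ≤ T) {x y f g : Icc (0 : ℝ) T → ℝ}
    (hf : Integrable f (timeMeasure T)) (hg : Integrable g (timeMeasure T))
    (hx : ∀ t, x t = x ⟨0, left_mem_Icc.2 hT⟩ + ∫ r in Iic t, f r ∂timeMeasure T)
    (hy : ∀ t, y t = y ⟨0, left_mem_Icc.2 hT⟩ + ∫ r in Iic t, g r ∂timeMeasure T)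
    (t : Icc (0 : ℝ) T) :
    x t * y t = x ⟨0, left_mem_Icc.2 hT⟩ * y ⟨0, left_mem_Icc.2 hT⟩
      + ∫ r in Iic t, (f r * y r + x r * g r) ∂timeMeasure T := by
  set z : Icc (0 : ℝ) T := ⟨0, left_mem_Icc.2 hT⟩
  have hf' := intervalIntegrable_of_timeMeasure hT hf
  have hg' := intervalIntegrable_of_timeMeasure hT hg
  have sub : uIcc (0 : ℝ) t ⊆ uIcc 0 T := by
    rw [uIcc_of_le hT, uIcc_of_le t.2.1]; exact Icc_subset_Icc_right t.2.2
  have hc : ∀ c : ℝ, AbsolutelyContinuousOnInterval (fun _ : ℝ => c) 0 T := fun c =>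
    (contDiff_const (c := c) (n := 1) (𝕜 := ℝ) (E := ℝ)).contDiffOn.absolutelyContinuousOnInterval
  have hX : AbsolutelyContinuousOnInterval
      (fun r => x z + ∫ v in (0 : ℝ)..r, IccExtend hT f v) 0 T :=
    (hc _).add (hf'.absolutelyContinuousOnInterval_intervalIntegral left_mem_uIcc)
  have hY : AbsolutelyContinuousOnInterval
      (fun r => y z + ∫ v in (0 : ℝ)..r, IccExtend hT g v) 0 T :=
    (hc _).add (hg'.absolutelyContinuousOnInterval_intervalIntegral left_mem_uIcc)
  have key := (hX.mono sub).integral_deriv_mul_eq_sub (hY.mono sub)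
  simp only [intervalIntegral.integral_same, add_zero] at key
  rw [← setIntegral_timeMeasure hT, ← setIntegral_timeMeasure hT, ← hx t, ← hy t] at key
  rw [setIntegral_timeMeasure hT, ← sub_eq_iff_eq_add', ← key]
  apply intervalIntegral.integral_congr_ae
  filter_upwards [hf'.ae_hasDerivAt_integral, hg'.ae_hasDerivAt_integral] with r h1 h2 hr
  have hr' : r ∈ uIcc 0 T := sub (uIoc_subset_uIcc hr)
  have d1 := ((h1 hr') 0 left_mem_uIcc).const_add (x z)
  have d2 := ((h2 hr') 0 left_mem_uIcc).const_add (y z)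
  rw [d1.deriv, d2.deriv]
  have hrI : r ∈ Icc 0 T := by rwa [uIcc_of_le hT] at hr'
  have e1 := hx ⟨r, hrI⟩
  have e2 := hy ⟨r, hrI⟩
  rw [setIntegral_timeMeasure hT] at e1 e2
  simp only at e1 e2
  rw [← e1, ← e2, IccExtend_of_mem hT _ hrI, IccExtend_of_mem hT _ hrI, IccExtend_of_mem hT _ hrI]

/-- Smooth functions on `ℝ` with compact support in `(0,T)`. -/
def IsTimeTest (T : ℝ) (ψ : ℝ → ℝ) : Prop :=
  ContDiff ℝ ((⊤ : ℕ∞) : WithTop ℕ∞) ψ ∧ ∃ a b : ℝ, 0 < a ∧ b < T ∧ ∀ t, t ∉ Icc a b → ψ t = 0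

theorem exists_Icc_of_tsupport_subset {T : ℝ} (hT : 0 < T) {χ : ℝ → ℝ} (hc : HasCompactSupport χ)
    (hs : tsupport χ ⊆ Ioo 0 T) :
    ∃ a b : ℝ, 0 < a ∧ a ≤ b ∧ b < T ∧ ∀ t, t ∉ Icc a b → χ t = 0 := by
  rcases (tsupport χ).eq_empty_or_nonempty with he | hne
  · refine ⟨T / 2, T / 2, by positivity, le_rfl, by linarith, fun t _ => ?_⟩
    exact image_eq_zero_of_notMem_tsupport (by simp [he])
  · have hk : IsCompact (tsupport χ) := hc
    obtain ⟨a, ha, ha'⟩ := hk.exists_isLeast hne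
    obtain ⟨b, hb, hb'⟩ := hk.exists_isGreatest hne
    refine ⟨a, b, (hs ha).1, ha' hb, (hs hb).2, fun t ht => ?_⟩
    by_contra h
    have := subset_tsupport χ (Function.mem_support.2 h)
    exact ht ⟨ha' this, hb' this⟩

/-- A smooth function with vanishing integral and support in `[a,b] ⊂ (0,T)` is the derivative of
a test function. -/
theorem isTimeTest_primitive {T a b : ℝ} (ha : 0 < a) (hb : b < T) {θ : ℝ → ℝ}
    (hθ : ContDiff ℝ ((⊤ : ℕ∞) : WithTop ℕ∞) θ) (h0 : ∀ t, t ∉ Icc a b → θ t = 0)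
    (hi : ∫ r in (0 : ℝ)..T, θ r = 0) :
    IsTimeTest T (fun t => ∫ r in (0 : ℝ)..t, θ r) ∧
      ∀ t, HasDerivAt (fun t => ∫ r in (0 : ℝ)..t, θ r) (θ t) t := by
  have hd : ∀ t, HasDerivAt (fun t => ∫ r in (0 : ℝ)..t, θ r) (θ t) t := fun t =>
    intervalIntegral.integral_hasDerivAt_right (hθ.continuous.intervalIntegrable _ _)
      hθ.continuous.stronglyMeasurable.stronglyMeasurableAtFilter hθ.continuous.continuousAt
  refine ⟨⟨?_, a, b, ha, hb, fun t ht => ?_⟩, hd⟩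
  · rw [contDiff_infty_iff_deriv]
    refine ⟨fun t => (hd t).differentiableAt, ?_⟩
    have : deriv (fun t => ∫ r in (0 : ℝ)..t, θ r) = θ := funext fun t => (hd t).deriv
    rw [this]; exact hθ
  · have zl : ∀ t < a, ∫ r in (0 : ℝ)..t, θ r = 0 := fun t ht => by
      rw [intervalIntegral.integral_congr_ae (g := fun _ => 0)]
      · simp
      · refine Eventually.of_forall fun r hr => h0 r fun h => ?_
        rcases le_total 0 t with h' | h'
        · rw [uIoc_of_le h'] at hr; linarith [hr.2, h.1]
        · rw [uIoc_of_ge h'] at hr; linarith [hr.2, h.1]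
    by_cases h : t < a
    · exact zl t h
    · have hbt : b < t := by
        by_contra h'
        exact ht ⟨not_lt.1 h, not_lt.1 h'⟩
      change ∫ r in (0 : ℝ)..t, θ r = 0
      rw [← sub_zero (∫ r in (0 : ℝ)..t, θ r)]
      nth_rewrite 2 [← hi]
      rw [intervalIntegral.integral_interval_sub_left
        (hθ.continuous.intervalIntegrable _ _) (hθ.continuous.intervalIntegrable _ _),
        intervalIntegral.integral_congr_ae (g := fun _ => 0)]
      · simp
      · refine Eventually.of_forall fun r hr => h0 r fun h => ?_
        have := (uIoc_subset_uIcc hr)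
        rw [mem_uIcc] at this
        rcases this with h' | h' <;> linarith [h'.1, h.2]

/-- A continuous function annihilating the derivatives of all test functions is constant
(du Bois-Reymond). -/
theorem eqOn_const_of_forall_integral_mul_deriv_eq_zero {T : ℝ} (hT : 0 < T) {c : ℝ → ℝ}
    (hc : Continuous c)
    (h : ∀ ψ, IsTimeTest T ψ → ∫ r in (0 : ℝ)..T, c r * deriv ψ r = 0) :
    ∃ k, ∀ t ∈ Icc 0 T, c t = k := by
  -- a fixed bump of mass one, to which multiples of the test functions are compared
  let η : ContDiffBump (T / 2) := ⟨T / 8, T / 4, by positivity, by linarith⟩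
  have hηs : tsupport (η.normed volume) ⊆ Ioo 0 T := by
    rw [η.tsupport_normed_eq, Real.closedBall_eq_Icc]
    intro x hx
    have h1 : T / 2 - T / 4 ≤ x := hx.1
    have h2 : x ≤ T / 2 + T / 4 := hx.2
    constructor <;> linarith
  have restr : ∀ χ : ℝ → ℝ, (∀ t, t ∉ Ioc 0 T → χ t = 0) → ∫ r in (0 : ℝ)..T, χ r = ∫ r, χ r := by
    intro χ h
    rw [intervalIntegral.integral_of_le hT.le, setIntegral_eq_integral_of_forall_compl_eq_zero h]
  obtain ⟨a1, b1, ha1, hab1, hb1, hz1⟩ :=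
    exists_Icc_of_tsupport_subset hT η.hasCompactSupport_normed hηs
  have hη1 : ∫ r in (0 : ℝ)..T, η.normed volume r = 1 := by
    rw [restr, η.integral_normed]
    exact fun t ht => hz1 t fun h => ht ⟨ha1.trans_le h.1, h.2.trans hb1.le⟩
  set e : ℝ → ℝ := η.normed volume
  have hec : ContDiff ℝ ((⊤ : ℕ∞) : WithTop ℕ∞) e := η.contDiff_normed
  refine ⟨∫ r in (0 : ℝ)..T, c r * e r, ?_⟩
  set k := ∫ r in (0 : ℝ)..T, c r * e r
  have ae : ∀ᵐ r, r ∈ Ioo 0 T → c r - k = 0 := by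
    have hck : Continuous fun r => c r - k := by fun_prop
    refine isOpen_Ioo.ae_eq_zero_of_integral_contDiff_smul_eq_zero
      (hck.locallyIntegrable.locallyIntegrableOn _) ?_
    intro χ hχ hχc hχs
    obtain ⟨a2, b2, ha2, hab2, hb2, hz2⟩ := exists_Icc_of_tsupport_subset hT hχc hχs
    set I := ∫ r in (0 : ℝ)..T, χ r
    have ii : ∀ {g : ℝ → ℝ}, Continuous g → IntervalIntegrable g volume 0 T :=
      fun hg => hg.intervalIntegrable _ _
    have hχ' := hχ.continuous
    have he' := hec.continuous
    have i1 := ii hχ'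
    have i2 : IntervalIntegrable (fun r => I * e r) volume 0 T := ii (by fun_prop)
    have i3 : IntervalIntegrable (fun r => c r * (χ r - I * e r)) volume 0 T := ii (by fun_prop)
    have i4 : IntervalIntegrable (fun r => I * (c r * e r)) volume 0 T := ii (by fun_prop)
    have i5 : IntervalIntegrable (fun r => k * χ r) volume 0 T := ii (by fun_prop)
    have hθ : ContDiff ℝ ((⊤ : ℕ∞) : WithTop ℕ∞) (fun r => χ r - I * e r) :=
      hχ.sub (contDiff_const.mul hec)
    -- `χ - (∫ χ) e` has vanishing integral, so it is the derivative of a test function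
    obtain ⟨t1, t2⟩ := isTimeTest_primitive (T := T) (a := min a1 a2) (b := max b1 b2)
      (lt_min ha1 ha2)
      (max_lt hb1 hb2) hθ
      (fun t ht => by
        rw [hz1 t fun h => ht ⟨(min_le_left _ _).trans h.1, h.2.trans (le_max_left _ _)⟩,
          hz2 t fun h => ht ⟨(min_le_right _ _).trans h.1, h.2.trans (le_max_right _ _)⟩]
        simp)
      (by rw [intervalIntegral.integral_sub i1 i2, intervalIntegral.integral_const_mul, hη1]
          simp [I])
    have := h _ t1
    simp_rw [fun r => (t2 r).deriv] at this
    rw [← restr]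
    · calc ∫ r in (0 : ℝ)..T, χ r • (c r - k)
          = ∫ r in (0 : ℝ)..T, (c r * (χ r - I * e r) + (I * (c r * e r) - k * χ r)) := by
            congr 1; ext r; simp only [smul_eq_mul]; ring
        _ = 0 := by
          rw [intervalIntegral.integral_add i3 (i4.sub i5), this,
            intervalIntegral.integral_sub i4 i5, intervalIntegral.integral_const_mul,
            intervalIntegral.integral_const_mul]
          simp only [I, k]; ring
    · intro t ht
      rw [hz2 t fun h => ht ⟨ha2.trans_le h.1, h.2.trans hb2.le⟩]; simp
  refine Measure.eqOn_Icc_of_ae_eq (X := ℝ) (g := fun _ => k) volume hT.ne ?_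
    hc.continuousOn continuousOn_const
  rw [restrict_Ioo_eq_restrict_Icc.symm]
  refine (ae_restrict_iff' measurableSet_Ioo).2 ?_
  filter_upwards [ae] with r hr h
  exact sub_eq_zero.1 (hr h)

/-- A continuous curve whose weak derivative is an integrable function is a primitive of it. -/
theorem eq_integral_of_weak_derivative {T : ℝ} (hT : 0 < T) {x : Icc (0 : ℝ) T → ℝ}
    (hx : Continuous x) {g : Icc (0 : ℝ) T → ℝ} (hg : Integrable g (timeMeasure T))
    (h : ∀ ψ, IsTimeTest T ψ →
      ∫ t, x t * deriv ψ t ∂timeMeasure T = - ∫ t, g t * ψ t ∂timeMeasure T)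
    (t : Icc (0 : ℝ) T) :
    x t = x ⟨0, left_mem_Icc.2 hT.le⟩ + ∫ r in Iic t, g r ∂timeMeasure T := by
  have hg' := intervalIntegrable_of_timeMeasure hT.le hg
  -- a primitive that is continuous on all of `ℝ`
  set G : ℝ → ℝ := fun r => ∫ v in (0 : ℝ)..projIcc 0 T hT.le r, IccExtend hT.le g v
  have hGc : Continuous G := by
    have := intervalIntegral.continuousOn_primitive_interval
      (f := IccExtend hT.le g) (μ := volume) (a := 0) (b := T)
      (by rw [uIcc_of_le hT.le]; exact (intervalIntegrable_iff_integrableOn_Icc_of_le hT.le).1 hg')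
    rw [uIcc_of_le hT.le] at this
    exact this.comp_continuous (continuous_subtype_val.comp continuous_projIcc) fun r =>
      (projIcc 0 T hT.le r).2
  have hGe : ∀ r ∈ Icc 0 T, G r = ∫ v in (0 : ℝ)..r, IccExtend hT.le g v := fun r hr => by
    simp only [G, projIcc_of_mem hT.le hr]
  obtain ⟨k, hk⟩ := eqOn_const_of_forall_integral_mul_deriv_eq_zero hT
    (c := fun r => IccExtend hT.le x r - G r) ((hx.Icc_extend').sub hGc) (by
    intro ψ hψ
    obtain ⟨hψ1, a, b, ha, hb, hz⟩ := hψ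
    have hψd : Continuous (deriv ψ) := (contDiff_infty_iff_deriv.1 hψ1).2.continuous
    have e0 := h ψ ⟨hψ1, a, b, ha, hb, hz⟩
    rw [integral_timeMeasure hT.le, integral_timeMeasure hT.le] at e0
    have ac1 := hg'.absolutelyContinuousOnInterval_intervalIntegral left_mem_uIcc
    have ac2 : AbsolutelyContinuousOnInterval ψ 0 T :=
      (hψ1.of_le (by exact_mod_cast le_top)).contDiffOn.absolutelyContinuousOnInterval
    have e1 := ac1.integral_mul_deriv_eq_deriv_mul ac2
    rw [hz T fun h => by linarith [h.2], hz 0 fun h => by linarith [h.1]] at e1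
    have e2 : ∫ r in (0 : ℝ)..T, deriv (fun x => ∫ v in (0 : ℝ)..x, IccExtend hT.le g v) r * ψ r
        = ∫ r in (0 : ℝ)..T, IccExtend hT.le (fun t => g t * ψ t) r := by
      apply intervalIntegral.integral_congr_ae
      filter_upwards [hg'.ae_hasDerivAt_integral] with r h1 hr
      rw [((h1 (uIoc_subset_uIcc hr)) 0 left_mem_uIcc).deriv]
      have hrI : r ∈ Icc 0 T := by rw [← uIcc_of_le hT.le]; exact uIoc_subset_uIcc hr
      rw [IccExtend_of_mem hT.le _ hrI, IccExtend_of_mem hT.le _ hrI]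
    rw [e2] at e1
    have e3 : ∫ r in (0 : ℝ)..T, (IccExtend hT.le x r - G r) * deriv ψ r
        = ∫ r in (0 : ℝ)..T, (IccExtend hT.le (fun t => x t * deriv ψ t) r
            - (∫ v in (0 : ℝ)..r, IccExtend hT.le g v) * deriv ψ r) := by
      apply intervalIntegral.integral_congr
      intro r hr
      rw [uIcc_of_le hT.le] at hr
      simp only
      rw [hGe r hr, IccExtend_of_mem hT.le _ hr, IccExtend_of_mem hT.le _ hr]
      ring
    rw [e3, intervalIntegral.integral_sub, e0, e1]
    · ring
    · apply intervalIntegrable_of_timeMeasure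
      exact (hx.mul (hψd.comp continuous_subtype_val)).integrable_of_hasCompactSupport
        (HasCompactSupport.of_compactSpace _)
    · refine (ContinuousOn.intervalIntegrable ?_)
      rw [uIcc_of_le hT.le]
      exact (hGc.continuousOn.congr fun r hr => (hGe r hr).symm).mul hψd.continuousOn)
  have h1 := hk t t.2
  have h2 := hk 0 (left_mem_Icc.2 hT.le)
  rw [← h2] at h1
  rw [setIntegral_timeMeasure hT.le, ← hGe t t.2]
  have hG0 : G 0 = 0 := by rw [hGe 0 (left_mem_Icc.2 hT.le)]; simp
  rw [hG0, IccExtend_val, IccExtend_of_mem hT.le _ (left_mem_Icc.2 hT.le)] at h1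
  linarith

/-! ### Square-summable sequences and Sobolev coefficients -/

/-- The sequence space `ℓ²(ℤ; ℂ)`. -/
abbrev SeqSpace := lp (fun _ : ℤ => ℂ) 2

theorem hasSum_norm_sq (x : SeqSpace) : HasSum (fun n => ‖x n‖ ^ 2) (‖x‖ ^ 2) := by
  have := lp.hasSum_norm (by norm_num) x
  simpa using this

theorem tsum_ofReal_norm_sq (x : SeqSpace) :
    ∑' n, ENNReal.ofReal (‖x n‖ ^ 2) = ENNReal.ofReal (‖x‖ ^ 2) := by
  rw [← (hasSum_norm_sq x).tsum_eq,
    ENNReal.ofReal_tsum_of_nonneg (fun _ => by positivity) (hasSum_norm_sq x).summable]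

theorem summable_of_tsum_ofReal_ne_top {ι : Type*} {c : ι → ℝ} (hc : ∀ n, 0 ≤ c n)
    (h : ∑' n, ENNReal.ofReal (c n) ≠ ⊤) : Summable c := by
  have := ENNReal.summable_toReal h
  simpa [ENNReal.toReal_ofReal, hc] using this

/-- A square-summable family as an element of `ℓ²`. -/
def toSeq (b : ℤ → ℂ) (hb : Summable fun n => ‖b n‖ ^ 2) : SeqSpace :=
  ⟨b, memℓp_gen (by simpa using hb)⟩

@[simp] theorem toSeq_apply (b : ℤ → ℂ) (hb : Summable fun n => ‖b n‖ ^ 2) (n : ℤ) :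
    toSeq b hb n = b n := rfl

theorem continuous_coord (n : ℤ) : Continuous fun x : SeqSpace => x n :=
  (lp.evalCLM ℝ (fun _ : ℤ => ℂ) 2 n).continuous

instance completeSpace_sobolev (σ : ℝ) : CompleteSpace (Sobolev σ) := by
  have : IsClosed (Sobolev σ : Set SeqSpace) := by
    have : (Sobolev σ : Set SeqSpace) = ⋂ n : ℤ, {a | a (-n) = conj (a n)} := by
      ext a
      rw [mem_iInter]
      exact Iff.rfl
    rw [this]
    exact isClosed_iInter fun n => isClosed_eq (continuous_coord _)
      (Complex.continuous_conj.comp (continuous_coord n))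
  exact this.completeSpace_coe

instance completeSpace_homSobolev (s : ℝ) : CompleteSpace (HomSobolev s) := by
  have : IsClosed (HomSobolev s : Set SeqSpace) := by
    have : (HomSobolev s : Set SeqSpace) = {a | a 0 = 0} ∩ ⋂ n : ℤ, {a | a (-n) = conj (a n)} := by
      ext a
      rw [mem_inter_iff, mem_iInter]
      exact Iff.rfl
    rw [this]
    exact (isClosed_eq (continuous_coord 0) continuous_const).inter
      (isClosed_iInter fun n => isClosed_eq (continuous_coord _)
        (Complex.continuous_conj.comp (continuous_coord n)))
  exact this.completeSpace_coe

/-- A curve in `ℓ²` with continuous coordinates dominated by a fixed element of `ℓ²` is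
continuous. -/
theorem continuous_seq_of_dominated {X : Type*} [TopologicalSpace X] {x : X → SeqSpace}
    {b : ℤ → ℝ} (hx : ∀ n, Continuous fun t => x t n) (hb : Summable b)
    (h : ∀ t n, ‖x t n‖ ^ 2 ≤ b n) : Continuous x := by
  rw [continuous_iff_continuousAt]
  intro t₀
  have key : Tendsto (fun t => ∑' n, ‖x t n - x t₀ n‖ ^ 2) (𝓝 t₀) (𝓝 (∑' _ : ℤ, (0 : ℝ))) := by
    refine tendsto_tsum_of_dominated_convergence (bound := fun n => 4 * b n) (hb.mul_left 4)
      (fun n => ?_) (Eventually.of_forall fun t n => ?_)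
    · have : Continuous fun t => ‖x t n - x t₀ n‖ ^ 2 := by have := hx n; fun_prop
      simpa using this.tendsto t₀
    · rw [Real.norm_of_nonneg (by positivity)]
      have h1 := norm_sub_le (x t n) (x t₀ n)
      nlinarith [h t n, h t₀ n, norm_nonneg (x t n - x t₀ n), sq_nonneg (‖x t n‖ - ‖x t₀ n‖)]
  rw [tsum_zero] at key
  have e : ∀ t, ∑' n, ‖x t n - x t₀ n‖ ^ 2 = ‖x t - x t₀‖ ^ 2 := fun t => by
    rw [← (hasSum_norm_sq (x t - x t₀)).tsum_eq]; simp
  simp_rw [e] at key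
  rw [ContinuousAt, tendsto_iff_norm_sub_tendsto_zero]
  have := (Real.continuous_sqrt.tendsto 0).comp key
  simpa [Function.comp_def, Real.sqrt_sq] using this

theorem two_pi_abs_pos {n : ℤ} (hn : n ≠ 0) : 0 < 2 * Real.pi * |(n : ℝ)| := by
  have : (n : ℝ) ≠ 0 := by exact_mod_cast hn
  positivity

theorem sobolevCoeff_neg_index {σ : ℝ} (g : Sobolev σ) (n : ℤ) :
    sobolevCoeff g (-n) = conj (sobolevCoeff g n) := by
  have := g.2 n
  simp only [sobolevCoeff, map_mul, Complex.conj_ofReal, this]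
  simp

theorem norm_sq_eq_sobolevCoeff {σ : ℝ} (g : Sobolev σ) (n : ℤ) :
    ‖(g : SeqSpace) n‖ ^ 2 = (1 + (2 * Real.pi * n) ^ 2) ^ σ * ‖sobolevCoeff g n‖ ^ 2 := by
  have h0 : 0 < 1 + (2 * Real.pi * (n : ℝ)) ^ 2 := by positivity
  rw [sobolevCoeff]
  generalize 1 + (2 * Real.pi * (n : ℝ)) ^ 2 = c at h0
  rw [norm_mul, mul_pow, Complex.norm_real, Real.norm_of_nonneg (by positivity),
    ← mul_assoc, ← Real.rpow_natCast (_ ^ _), ← Real.rpow_mul h0.le, ← Real.rpow_add h0]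
  norm_num

theorem coe_eq_sobolevCoeff {σ : ℝ} (g : Sobolev σ) (n : ℤ) :
    (g : SeqSpace) n = (((1 + (2 * Real.pi * n) ^ 2) ^ (σ / 2) : ℝ) : ℂ) * sobolevCoeff g n := by
  have h0 : 0 < 1 + (2 * Real.pi * (n : ℝ)) ^ 2 := by positivity
  rw [sobolevCoeff, ← mul_assoc, ← Complex.ofReal_mul, ← Real.rpow_add h0]
  ring_nf
  simp

theorem sobolevCoeff_sub {σ : ℝ} (g h : Sobolev σ) (n : ℤ) :
    sobolevCoeff (g - h) n = sobolevCoeff g n - sobolevCoeff h n := by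
  simp [sobolevCoeff, mul_sub]

theorem continuous_sobolevCoeff {σ : ℝ} (n : ℤ) :
    Continuous fun g : Sobolev σ => sobolevCoeff g n :=
  continuous_const.mul ((continuous_coord n).comp continuous_subtype_val)

theorem homCoeff_zero_index {s : ℝ} (h : HomSobolev s) : homCoeff h 0 = 0 := by
  rw [homCoeff, h.2.1, mul_zero]

theorem homCoeff_neg_index {s : ℝ} (g : HomSobolev s) (n : ℤ) :
    homCoeff g (-n) = conj (homCoeff g n) := by
  have := g.2.2 n
  simp only [homCoeff, map_mul, Complex.conj_ofReal, this]
  simp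

theorem continuous_homCoeff {s : ℝ} (n : ℤ) :
    Continuous fun g : HomSobolev s => homCoeff g n :=
  continuous_const.mul ((continuous_coord n).comp continuous_subtype_val)

theorem coe_eq_homCoeff {s : ℝ} (h : HomSobolev s) {n : ℤ} (hn : n ≠ 0) :
    (h : SeqSpace) n = (((2 * Real.pi * |(n : ℝ)|) ^ s : ℝ) : ℂ) * homCoeff h n := by
  have h0 := two_pi_abs_pos hn
  rw [homCoeff, ← mul_assoc, ← Complex.ofReal_mul, ← Real.rpow_add h0]
  simp

theorem rpow_two_mul_eq_sq {s : ℝ} {n : ℤ} (hn : n ≠ 0) :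
    (2 * Real.pi * |(n : ℝ)|) ^ (2 * s) = ((2 * Real.pi * |(n : ℝ)|) ^ s) ^ 2 := by
  rw [mul_comm 2 s, Real.rpow_mul (two_pi_abs_pos hn).le]; norm_cast

theorem weight_mul_norm_sq_homCoeff {s : ℝ} (h : HomSobolev s) (n : ℤ) :
    (2 * Real.pi * |(n : ℝ)|) ^ (2 * s) * ‖homCoeff h n‖ ^ 2 = ‖(h : SeqSpace) n‖ ^ 2 := by
  rcases eq_or_ne n 0 with rfl | hn
  · rw [homCoeff_zero_index, h.2.1]; simp
  · rw [coe_eq_homCoeff h hn, rpow_two_mul_eq_sq hn, norm_mul, Complex.norm_real,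
      Real.norm_of_nonneg (by positivity), mul_pow]

theorem lintegral_ofReal_norm_sq {α E : Type*} [MeasurableSpace α] {μ : Measure α}
    [NormedAddCommGroup E] (f : α → E) :
    ∫⁻ t, ENNReal.ofReal (‖f t‖ ^ 2) ∂μ = eLpNorm f 2 μ ^ 2 := by
  have := eLpNorm_nnreal_pow_eq_lintegral (f := f) (μ := μ) (p := 2) (by norm_num)
  have h2 : (((2 : ℝ≥0) : ℝ)) = ((2 : ℕ) : ℝ) := by norm_num
  rw [h2] at this
  simp only [ENNReal.rpow_natCast] at this
  rw [ENNReal.coe_ofNat] at this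
  rw [this]
  congr 1; ext t
  rw [ENNReal.ofReal_pow (norm_nonneg _), ofReal_norm]

theorem lintegral_ofReal_norm_sq_Lp {α E : Type*} [MeasurableSpace α] {μ : Measure α}
    [NormedAddCommGroup E] (f : Lp E 2 μ) :
    ∫⁻ t, ENNReal.ofReal (‖f t‖ ^ 2) ∂μ = ENNReal.ofReal (‖f‖ ^ 2) := by
  rw [lintegral_ofReal_norm_sq, ENNReal.ofReal_pow (norm_nonneg _), ofReal_norm, Lp.enorm_def]

theorem lintegral_tsum_homCoeff {T s : ℝ} (h : EnergySpace T s) :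
    ∫⁻ t, ∑' n : ℤ, ENNReal.ofReal ((2 * Real.pi * |(n : ℝ)|) ^ (2 * s) * ‖homCoeff (h t) n‖ ^ 2)
      ∂timeMeasure T = ENNReal.ofReal (‖h‖ ^ 2) := by
  rw [← lintegral_ofReal_norm_sq_Lp]
  congr 1; ext t
  simp_rw [weight_mul_norm_sq_homCoeff]
  rw [tsum_ofReal_norm_sq]
  rfl

theorem aestronglyMeasurable_homCoeff {T s : ℝ} (h : EnergySpace T s) (n : ℤ) :
    AEStronglyMeasurable (fun t => homCoeff (h t) n) (timeMeasure T) :=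
  (continuous_homCoeff n).comp_aestronglyMeasurable (Lp.aestronglyMeasurable h)

/-- Curves with continuous Fourier coefficients and finite `L₂(Ḣ_s)` norm define elements of
`L₂([0,T]; Ḣ_s)`; the zero mode plays no role. -/
theorem exists_energySpace_of_coeff {T s : ℝ} {a : ℤ → Icc (0 : ℝ) T → ℂ}
    (ha : ∀ n, Continuous (a n)) (hconj : ∀ n t, a (-n) t = conj (a n t))
    (hfin : ∫⁻ t, ∑' n : ℤ, ENNReal.ofReal ((2 * Real.pi * |(n : ℝ)|) ^ (2 * s) * ‖a n t‖ ^ 2)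
      ∂timeMeasure T ≠ ⊤) :
    ∃ k : EnergySpace T s, ∀ᵐ t ∂timeMeasure T, ∀ n : ℤ, n ≠ 0 → a n t = homCoeff (k t) n := by
  classical
  set b : ℤ → Icc (0 : ℝ) T → ℂ := fun n t =>
    if n = 0 then 0 else (((2 * Real.pi * |(n : ℝ)|) ^ s : ℝ) : ℂ) * a n t
  have hb0 : ∀ t, b 0 t = 0 := fun t => by simp [b]
  have hbc : ∀ n, Continuous (b n) := fun n => by
    have := ha n
    by_cases hn : n = 0
    · simp only [b, hn, if_true]; fun_prop
    · simp only [b, hn, if_false]; fun_prop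
  have hbconj : ∀ n t, b (-n) t = conj (b n t) := fun n t => by
    by_cases hn : n = 0
    · simp [b, hn]
    · simp [b, hn, hconj]
  have hble : ∀ n t, ‖b n t‖ ^ 2 ≤ (2 * Real.pi * |(n : ℝ)|) ^ (2 * s) * ‖a n t‖ ^ 2 := by
    intro n t
    by_cases hn : n = 0
    · simp only [b, hn, if_true]; simp; positivity
    · simp only [b, hn, if_false]
      rw [rpow_two_mul_eq_sq hn, norm_mul, Complex.norm_real,
        Real.norm_of_nonneg (by positivity), mul_pow]
  have hmeas : ∀ n : ℤ, Measurable fun t =>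
      ENNReal.ofReal ((2 * Real.pi * |(n : ℝ)|) ^ (2 * s) * ‖a n t‖ ^ 2) := fun n => by
    have := (ha n).measurable
    fun_prop
  have hae : ∀ᵐ t ∂timeMeasure T, Summable fun n => ‖b n t‖ ^ 2 := by
    filter_upwards [ae_lt_top (Measurable.tsum hmeas) hfin] with t ht
    have h1 := summable_of_tsum_ofReal_ne_top (fun n => by positivity) ht.ne
    exact h1.of_nonneg_of_le (fun n => by positivity) fun n => hble n t
  let κ : Icc (0 : ℝ) T → HomSobolev s := fun t =>
    if h : Summable fun n => ‖b n t‖ ^ 2 then ⟨toSeq (fun n => b n t) h, hb0 t, fun n => hbconj n t⟩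
    else 0
  have hκ : ∀ t, (Summable fun n => ‖b n t‖ ^ 2) → ∀ n, (κ t : SeqSpace) n = b n t := by
    intro t ht n
    simp only [κ, dif_pos ht]
    rfl
  have hκm : AEStronglyMeasurable κ (timeMeasure T) := by
    rw [← Topology.IsEmbedding.subtypeVal.aestronglyMeasurable_comp_iff]
    refine aestronglyMeasurable_of_tendsto_ae (ι := Finset ℤ) atTop
      (f := fun S t => ∑ n ∈ S, lp.single 2 n (b n t)) (fun S => ?_) ?_
    · refine Continuous.aestronglyMeasurable ?_
      refine continuous_finsetSum _ fun n _ => ?_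
      refine continuous_seq_of_dominated (b := fun m => if m = n then
        (⨆ t, ‖b n t‖) ^ 2 else 0) (fun m => ?_) ?_ fun t m => ?_
      · by_cases hm : m = n
        · subst hm; simpa using hbc m
        · simp only [lp.single_apply, Pi.single_eq_of_ne hm]; fun_prop
      · exact summable_of_ne_finset_zero (s := {n}) fun m hm => by
          simp at hm; simp [hm]
      · by_cases hm : m = n
        · subst hm
          simp only [lp.single_apply, Pi.single_eq_same, if_true]
          gcongr
          exact le_ciSup (f := fun t => ‖b m t‖)
            (isCompact_range (hbc m).norm).bddAbove t
        · simp [hm]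
    · filter_upwards [hae] with t ht
      have := lp.hasSum_single (p := 2) (by norm_num) (toSeq (fun n => b n t) ht)
      simp only [κ, dif_pos ht]
      exact this
  have hκL : MemLp κ 2 (timeMeasure T) := by
    refine ⟨hκm, ?_⟩
    have : eLpNorm κ 2 (timeMeasure T) ^ 2 ≠ ⊤ := by
      rw [← lintegral_ofReal_norm_sq]
      refine ne_top_of_le_ne_top hfin (lintegral_mono_ae ?_)
      filter_upwards [hae] with t ht
      change ENNReal.ofReal (‖(κ t : SeqSpace)‖ ^ 2) ≤ _
      rw [← tsum_ofReal_norm_sq]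
      refine ENNReal.tsum_le_tsum fun n => ENNReal.ofReal_le_ofReal ?_
      rw [hκ t ht]
      exact hble n t
    rw [lt_top_iff_ne_top]
    contrapose! this
    simp [this]
  refine ⟨hκL.toLp κ, ?_⟩
  filter_upwards [hκL.coeFn_toLp, hae] with t h1 h2 n hn
  rw [h1, homCoeff, hκ t h2]
  simp only [b, hn, if_false]
  rw [← mul_assoc, ← Complex.ofReal_mul, ← Real.rpow_add (two_pi_abs_pos hn)]
  simp

/-! ### Fourier series of real functions on the circle -/

theorem volume_eq_haar :
    (volume : Measure UnitAddCircle) = (AddCircle.haarAddCircle : Measure UnitAddCircle) := by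
  rw [AddCircle.volume_eq_smul_haarAddCircle]; simp

theorem norm_fourier_apply (n : ℤ) (x : UnitAddCircle) : ‖(fourier n x : ℂ)‖ = 1 := by
  rw [fourier_apply]; exact Circle.norm_coe _

/-- An integrable function on the circle with vanishing Fourier coefficients vanishes. -/
theorem ae_eq_zero_of_fourierCoeff_eq_zero {g : UnitAddCircle → ℂ} (hg : Integrable g volume)
    (h : ∀ n, fourierCoeff g n = 0) : g =ᵐ[volume] 0 := by
  have hint : ∀ φ : C(UnitAddCircle, ℂ), Integrable (fun x => φ x * g x) volume := fun φ =>
    hg.bdd_mul φ.continuous.aestronglyMeasurable (c := ‖φ‖)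
      (Eventually.of_forall fun x => φ.norm_coe_le_norm x)
  -- integration against `g` is a continuous functional that vanishes on the dense span of the
  -- trigonometric monomials
  let L : C(UnitAddCircle, ℂ) →L[ℂ] ℂ := LinearMap.mkContinuous
    { toFun := fun φ => ∫ x, φ x * g x
      map_add' := fun φ ψ => by
        simp only [ContinuousMap.add_apply, add_mul]
        exact integral_add (hint φ) (hint ψ)
      map_smul' := fun c φ => by
        simp only [ContinuousMap.smul_apply, smul_eq_mul, mul_assoc, RingHom.id_apply]
        exact integral_const_mul _ _ }
    (∫ x, ‖g x‖) (fun φ => by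
      refine (norm_integral_le_integral_norm _).trans ?_
      rw [← integral_mul_const]
      refine integral_mono (hint φ).norm (hg.norm.mul_const _) fun x => ?_
      simp only [norm_mul]
      rw [mul_comm]
      gcongr
      exact φ.norm_coe_le_norm x)
  have hL : ∀ φ, L φ = ∫ x, φ x * g x := fun φ => rfl
  have hL0 : ∀ φ, L φ = 0 := by
    have hker : Submodule.span ℂ (range (@fourier 1)) ≤ L.toLinearMap.ker := by
      rw [Submodule.span_le]
      rintro _ ⟨n, rfl⟩
      have := h (-n)
      rw [fourierCoeff, neg_neg, ← volume_eq_haar] at this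
      simpa [hL] using this
    have hcl := Submodule.topologicalClosure_minimal _ hker L.isClosed_ker
    rw [span_fourier_closure_eq_top] at hcl
    exact fun φ => hcl (Submodule.mem_top (x := φ))
  refine ae_eq_zero_of_forall_setIntegral_isClosed_eq_zero hg fun F hF => ?_
  have hδ : ∀ n : ℕ, (0 : ℝ) < 1 / ((n : ℝ) + 1) := fun n => by positivity
  -- indicators of closed sets are bounded pointwise limits of continuous functions
  have lim := thickenedIndicator_tendsto_indicator_closure hδ
    tendsto_one_div_add_atTop_nhds_zero_nat F
  rw [hF.closure_eq, tendsto_pi_nhds] at lim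
  have t1 : Tendsto (fun n : ℕ => ∫ x, (((thickenedIndicator (hδ n) F x : ℝ≥0) : ℝ) : ℂ) * g x)
      atTop (𝓝 (∫ x, F.indicator g x)) := by
    refine tendsto_integral_of_dominated_convergence (fun x => ‖g x‖) (fun n => ?_) hg.norm
      (fun n => Eventually.of_forall fun x => ?_) (Eventually.of_forall fun x => ?_)
    · refine AEStronglyMeasurable.mul ?_ hg.aestronglyMeasurable
      have := (thickenedIndicator (hδ n) F).continuous
      exact Continuous.aestronglyMeasurable (by fun_prop)
    · rw [norm_mul, Complex.norm_real]
      have : (thickenedIndicator (hδ n) F x : ℝ≥0) ≤ 1 := thickenedIndicator_le_one _ _ _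
      rw [Real.norm_of_nonneg (by positivity)]
      exact mul_le_of_le_one_left (norm_nonneg _) (by exact_mod_cast this)
    · have e : F.indicator g x = (((F.indicator (fun _ => (1 : ℝ≥0)) x : ℝ≥0) : ℝ) : ℂ) * g x := by
        by_cases hx : x ∈ F <;> simp [hx]
      rw [e]
      refine Tendsto.mul_const _ ?_
      exact ((Complex.continuous_ofReal.comp NNReal.continuous_coe).tendsto _).comp (lim x)
  have t2 : ∀ n : ℕ, ∫ x, (((thickenedIndicator (hδ n) F x : ℝ≥0) : ℝ) : ℂ) * g x = 0 := fun n =>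
    hL0 ⟨fun x => (((thickenedIndicator (hδ n) F x : ℝ≥0) : ℝ) : ℂ), by
      have := (thickenedIndicator (hδ n) F).continuous
      fun_prop⟩
  simp_rw [t2] at t1
  rw [← integral_indicator hF.measurableSet]
  exact tendsto_nhds_unique t1 tendsto_const_nhds

theorem realCoeff_congr {v w : UnitAddCircle → ℝ} (h : v =ᵐ[volume] w) (n : ℤ) :
    realCoeff v n = realCoeff w n := by
  rw [volume_eq_haar] at h
  exact congrFun (fourierCoeff_congr_ae (by filter_upwards [h] with x hx; rw [hx])) n

theorem realCoeff_eq_integral (v : UnitAddCircle → ℝ) (n : ℤ) :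
    realCoeff v n = ∫ x, fourier (-n) x * (v x : ℂ) := by
  rw [realCoeff, fourierCoeff, ← volume_eq_haar]; rfl

theorem integrable_fourier_mul {v : UnitAddCircle → ℝ} (hv : Integrable v) (n : ℤ) :
    Integrable fun x => fourier n x * (v x : ℂ) :=
  hv.ofReal.bdd_mul (c := 1) (fourier n).continuous.aestronglyMeasurable
    (Eventually.of_forall fun x => (norm_fourier_apply _ x).le)

theorem norm_realCoeff_le {v : UnitAddCircle → ℝ} (n : ℤ) :
    ‖realCoeff v n‖ ≤ ∫ x, |v x| := by
  rw [realCoeff_eq_integral]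
  refine (norm_integral_le_integral_norm _).trans (le_of_eq ?_)
  congr 1; ext x; rw [norm_mul, norm_fourier_apply, one_mul, Complex.norm_real, Real.norm_eq_abs]

theorem realCoeff_sub {v w : UnitAddCircle → ℝ} (hv : Integrable v) (hw : Integrable w) (n : ℤ) :
    realCoeff (fun x => v x - w x) n = realCoeff v n - realCoeff w n := by
  simp only [realCoeff_eq_integral]
  rw [← integral_sub (integrable_fourier_mul hv _) (integrable_fourier_mul hw _)]
  congr 1; ext x; push_cast; ring

theorem realCoeff_neg_index (v : UnitAddCircle → ℝ) (n : ℤ) :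
    realCoeff v (-n) = conj (realCoeff v n) := by
  simp only [realCoeff_eq_integral]
  rw [← integral_conj]
  congr 1; ext x; simp

/-- Parseval's identity for real square-integrable functions. -/
theorem tsum_realCoeff_sq {v : UnitAddCircle → ℝ} (hv : MemLp v 2 volume) :
    ∑' n, ENNReal.ofReal (‖realCoeff v n‖ ^ 2) = ∫⁻ x, ENNReal.ofReal (v x ^ 2) := by
  rw [volume_eq_haar] at hv ⊢
  have hV := hv.ofReal (K := ℂ)
  set V := hV.toLp _
  have h1 : ∀ n, fourierBasis.repr V n = realCoeff v n := fun n => by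
    rw [fourierBasis_repr]
    exact congrFun (fourierCoeff_congr_ae hV.coeFn_toLp) n
  simp_rw [← h1]
  rw [tsum_ofReal_norm_sq, LinearIsometryEquiv.norm_map, ← lintegral_ofReal_norm_sq_Lp]
  refine lintegral_congr_ae ?_
  filter_upwards [hV.coeFn_toLp] with x hx
  rw [hx]; simp

theorem summable_realCoeff_sq {v : UnitAddCircle → ℝ} (hv : MemLp v 2 volume) :
    Summable fun n => ‖realCoeff v n‖ ^ 2 := by
  refine summable_of_tsum_ofReal_ne_top (fun n => by positivity) ?_
  rw [tsum_realCoeff_sq hv]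
  have := lintegral_ofReal_norm_sq (μ := volume) v
  simp only [Real.norm_eq_abs, sq_abs] at this
  rw [this]
  exact ENNReal.pow_ne_top hv.2.ne

/-- The map sending a square-summable sequence to the real part of its Fourier series. -/
def synthesis : SeqSpace →L[ℝ] Lp ℝ 2 (volume : Measure UnitAddCircle) :=
  (Lp.compMeasurePreservingₗᵢ ℝ id
    (⟨measurable_id, by rw [Measure.map_id, volume_eq_haar]⟩ :
      MeasurePreserving id (volume : Measure UnitAddCircle)
        (AddCircle.haarAddCircle))).toContinuousLinearMap ∘L
  (Complex.reCLM.compLpL 2 (AddCircle.haarAddCircle : Measure UnitAddCircle)) ∘L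
  (fourierBasis.repr.symm.toContinuousLinearEquiv.toContinuousLinearMap.restrictScalars ℝ)

theorem realCoeff_synthesis {x : SeqSpace} (hx : ∀ n, x (-n) = conj (x n)) (n : ℤ) :
    realCoeff (synthesis x) n = x n := by
  set V : Lp ℂ 2 (AddCircle.haarAddCircle : Measure UnitAddCircle) := fourierBasis.repr.symm x
    with hV
  have h0 : (synthesis x : UnitAddCircle → ℝ) =ᵐ[volume] fun y => (V y).re := by
    have e1 := Lp.coeFn_compMeasurePreserving
      (Complex.reCLM.compLp V) (⟨measurable_id, by rw [Measure.map_id, volume_eq_haar]⟩ :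
      MeasurePreserving id (volume : Measure UnitAddCircle) (AddCircle.haarAddCircle))
    have e2 := Complex.reCLM.coeFn_compLp V
    have e3 : ∀ᵐ y ∂(volume : Measure UnitAddCircle), (Complex.reCLM.compLp V) y = (V y).re := by
      rw [volume_eq_haar]; exact e2
    exact e1.trans e3
  rw [realCoeff_congr h0, realCoeff_eq_integral]
  have hc : ∀ m, ∫ y, fourier (-m) y * V y = x m := fun m => by
    have := fourierBasis_repr V m
    rw [hV, LinearIsometryEquiv.apply_symm_apply, ← hV] at this
    rw [volume_eq_haar]
    exact this.symm
  have hVi : Integrable V volume := by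
    rw [volume_eq_haar]; exact (Lp.memLp V).integrable (by norm_num)
  have hVf : ∀ m, Integrable (fun y => fourier m y * V y) volume := fun m =>
    hVi.bdd_mul (c := 1) (fourier m).continuous.aestronglyMeasurable
    (Eventually.of_forall fun x => (norm_fourier_apply _ x).le)
  have hVg : Integrable (fun y => conj (fourier n y * V y)) volume :=
    Complex.conjCLE.toContinuousLinearMap.integrable_comp (hVf n)
  calc ∫ y, fourier (-n) y * (((V y).re : ℝ) : ℂ)
      = ∫ y, ((1 / 2 : ℂ) * (fourier (-n) y * V y) + (1 / 2 : ℂ) * conj (fourier n y * V y)) := by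
        congr 1; ext y
        rw [Complex.re_eq_add_conj, map_mul, ← fourier_neg]; ring
    _ = x n := by
        rw [integral_add ((hVf _).const_mul _) (hVg.const_mul _), integral_const_mul,
          integral_const_mul, integral_conj, hc]
        have := hc (-n)
        rw [neg_neg] at this
        rw [this, hx n, Complex.conj_conj]
        ring

/-- An integrable function with square-summable Fourier coefficients is square integrable. -/
theorem memLp_two_of_summable {w : UnitAddCircle → ℝ} (hw : Integrable w volume)
    (h : Summable fun n => ‖realCoeff w n‖ ^ 2) : MemLp w 2 volume := by
  set v := synthesis (toSeq _ h)
  have hv : Integrable v volume := (Lp.memLp v).integrable (by norm_num)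
  have h0 : (fun x => (((w x - v x : ℝ)) : ℂ)) =ᵐ[volume] 0 := by
    refine ae_eq_zero_of_fourierCoeff_eq_zero (hw.sub hv).ofReal fun n => ?_
    change realCoeff (fun x => w x - v x) n = 0
    rw [realCoeff_sub hw hv, realCoeff_synthesis fun n => realCoeff_neg_index w n]
    simp
  refine (memLp_congr_ae ?_).2 (Lp.memLp v)
  filter_upwards [h0] with x hx
  have : w x - v x = 0 := Complex.ofReal_eq_zero.1 hx
  linarith

theorem Lp_two_ext_of_realCoeff {v w : Lp ℝ 2 (volume : Measure UnitAddCircle)}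
    (h : ∀ n, realCoeff v n = realCoeff w n) : v = w := by
  have hv : Integrable v volume := (Lp.memLp v).integrable (by norm_num)
  have hw : Integrable w volume := (Lp.memLp w).integrable (by norm_num)
  have h0 : (fun x => (((v x - w x : ℝ)) : ℂ)) =ᵐ[volume] 0 := by
    refine ae_eq_zero_of_fourierCoeff_eq_zero (hv.sub hw).ofReal fun n => ?_
    change realCoeff (fun x => v x - w x) n = 0
    rw [realCoeff_sub hv hw, h, sub_self]
  refine Lp.ext ?_
  filter_upwards [h0] with x hx
  have : v x - w x = 0 := Complex.ofReal_eq_zero.1 hx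
  linarith

/-! ### Lipschitz maps act boundedly on `H_{1/2}` -/

theorem realCoeff_translate (v : UnitAddCircle → ℝ) (y : UnitAddCircle) (n : ℤ) :
    realCoeff (fun x => v (x + y)) n = fourier n y * realCoeff v n := by
  simp only [realCoeff_eq_integral]
  rw [← integral_const_mul,
    ← integral_add_right_eq_self (fun x => (fourier n y : ℂ) * (fourier (-n) x * (v x : ℂ))) y]
  congr 1; ext x
  simp only [fourier_apply, smul_add, AddCircle.toCircle_add, Circle.coe_mul, neg_smul,
    AddCircle.toCircle_neg]
  have : ((AddCircle.toCircle (n • y) : Circle) : ℂ) ≠ 0 := Circle.coe_ne_zero _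
  simp only [Circle.coe_inv]
  field_simp

/-- Parseval's identity for the increment of `v` by a translation. -/
theorem tsum_translate_sub {v : UnitAddCircle → ℝ} (hv : MemLp v 2 volume) (y : UnitAddCircle) :
    ∑' n : ℤ, ENNReal.ofReal (‖(fourier n y : ℂ) - 1‖ ^ 2 * ‖realCoeff v n‖ ^ 2) =
      ∫⁻ x, ENNReal.ofReal ((v (x + y) - v x) ^ 2) := by
  have hvy : MemLp (fun x => v (x + y)) 2 volume :=
    hv.comp_measurePreserving (measurePreserving_add_right volume y)
  refine Eq.trans ?_ (tsum_realCoeff_sq (hvy.sub hv))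
  congr 1; ext n
  have : realCoeff (fun x => v (x + y) - v x) n = ((fourier n y : ℂ) - 1) * realCoeff v n := by
    have := realCoeff_sub (hvy.integrable (by norm_num)) (hv.integrable (by norm_num)) n
    rw [realCoeff_translate] at this
    rw [sub_mul, one_mul, ← this]
  rw [this, norm_mul, mul_pow]

theorem norm_fourier_sub_one (n : ℤ) (y : ℝ) :
    ‖(fourier n (y : UnitAddCircle) : ℂ) - 1‖ = 2 * |Real.sin (Real.pi * n * y)| := by
  rw [fourier_coe_apply]
  have e : (2 * Real.pi * Complex.I * n * y / (1 : ℝ) : ℂ)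
      = Complex.I * ((2 * Real.pi * n * y : ℝ) : ℂ) := by push_cast; ring
  rw [e, Complex.norm_exp_I_mul_ofReal_sub_one, Real.norm_eq_abs, abs_mul]
  norm_num
  ring_nf

theorem mul_abs_le_norm_fourier_sub_one {n : ℤ} {y : ℝ} (hy : 0 ≤ y)
    (hny : |(n : ℝ)| * y ≤ 1 / 2) :
    4 * (|(n : ℝ)| * y) ≤ ‖(fourier n (y : UnitAddCircle) : ℂ) - 1‖ := by
  rw [norm_fourier_sub_one]
  have e : |Real.sin (Real.pi * n * y)| = |Real.sin (Real.pi * (|(n : ℝ)| * y))| := by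
    rcases abs_choice (n : ℝ) with h | h
    · rw [h, mul_assoc]
    · rw [h, show Real.pi * (-(n : ℝ) * y) = -(Real.pi * n * y) by ring, Real.sin_neg, abs_neg]
  have h := Real.mul_le_sin (x := Real.pi * (|(n : ℝ)| * y)) (by positivity) (by
    have := Real.pi_pos; nlinarith)
  rw [e]
  have h2 := le_abs_self (Real.sin (Real.pi * (|(n : ℝ)| * y)))
  have h3 : 2 / Real.pi * (Real.pi * (|(n : ℝ)| * y)) = 2 * (|(n : ℝ)| * y) := by
    field_simp
  linarith

theorem norm_fourier_sub_one_le (n : ℤ) {y : ℝ} (hy : 0 ≤ y) :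
    ‖(fourier n (y : UnitAddCircle) : ℂ) - 1‖ ≤ 2 * Real.pi * |(n : ℝ)| * y := by
  rw [norm_fourier_sub_one]
  have h := Real.abs_sin_le_abs (x := Real.pi * n * y)
  rw [abs_mul, abs_mul, abs_of_nonneg Real.pi_pos.le, abs_of_nonneg hy] at h
  linarith

/-- The weight `∫₀¹ |e^{2πiny} - 1|² y⁻² dy`, comparable to `|n|`. -/
def gagliardoWeight (n : ℤ) : ℝ≥0∞ :=
  ∫⁻ y in Ioc (0 : ℝ) 1, ENNReal.ofReal (‖(fourier n (y : UnitAddCircle) : ℂ) - 1‖ ^ 2 / y ^ 2)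

/-- Only the increments `y ≤ 1/(2|n|)` are used for the lower bound, where
`|e^{2πiny} - 1| ≥ 4|n|y`. -/
theorem le_gagliardoWeight (n : ℤ) : ENNReal.ofReal (8 * |(n : ℝ)|) ≤ gagliardoWeight n := by
  rcases eq_or_ne n 0 with rfl | hn
  · simp
  have h1 : (1 : ℝ) ≤ |(n : ℝ)| := by exact_mod_cast Int.one_le_abs hn
  set N := |(n : ℝ)|
  have hN : 0 < N := by linarith
  calc ENNReal.ofReal (8 * N)
      = ∫⁻ y in Ioc (0 : ℝ) (1 / (2 * N)), ENNReal.ofReal (16 * N ^ 2) := by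
        rw [setLIntegral_const, Real.volume_Ioc, ← ENNReal.ofReal_mul (by positivity)]
        congr 1; field_simp; ring
    _ ≤ ∫⁻ y in Ioc (0 : ℝ) (1 / (2 * N)),
          ENNReal.ofReal (‖(fourier n (y : UnitAddCircle) : ℂ) - 1‖ ^ 2 / y ^ 2) := by
        refine setLIntegral_mono' measurableSet_Ioc fun y hy => ENNReal.ofReal_le_ofReal ?_
        have hy0 := hy.1
        rw [le_div_iff₀ (by positivity)]
        have hy2 : N * y ≤ 1 / 2 := by
          have := hy.2
          rw [le_div_iff₀ (by positivity)] at this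
          linarith
        have := mul_abs_le_norm_fourier_sub_one hy.1.le hy2
        calc 16 * N ^ 2 * y ^ 2 = (4 * (N * y)) ^ 2 := by ring
          _ ≤ _ := by gcongr
    _ ≤ gagliardoWeight n := by
        refine lintegral_mono_set (Ioc_subset_Ioc_right ?_)
        rw [div_le_one (by positivity)]; linarith

/-- For `y ≤ 1/|n|` the integrand is at most `4π²n²`, beyond it is at most `4/y²`. -/
theorem gagliardoWeight_le (n : ℤ) :
    gagliardoWeight n ≤ ENNReal.ofReal ((4 * Real.pi ^ 2 + 4) * |(n : ℝ)|) := by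
  rcases eq_or_ne n 0 with rfl | hn
  · simp [gagliardoWeight]
  have h1 : (1 : ℝ) ≤ |(n : ℝ)| := by exact_mod_cast Int.one_le_abs hn
  have hle := fun (y : ℝ) (hy : 0 ≤ y) => norm_fourier_sub_one_le n hy
  set N := |(n : ℝ)|
  have hN : 0 < N := by linarith
  have hsub : Ioc (0 : ℝ) 1 ⊆ Ioc 0 (1 / N) ∪ Ioi (1 / N) := fun y hy => by
    rcases le_or_gt y (1 / N) with h | h
    · exact Or.inl ⟨hy.1, h⟩
    · exact Or.inr h
  calc gagliardoWeight n
      ≤ ∫⁻ y in Ioc 0 (1 / N) ∪ Ioi (1 / N),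
          ENNReal.ofReal (‖(fourier n (y : UnitAddCircle) : ℂ) - 1‖ ^ 2 / y ^ 2) :=
        lintegral_mono_set hsub
    _ ≤ (∫⁻ y in Ioc 0 (1 / N),
          ENNReal.ofReal (‖(fourier n (y : UnitAddCircle) : ℂ) - 1‖ ^ 2 / y ^ 2))
        + ∫⁻ y in Ioi (1 / N),
          ENNReal.ofReal (‖(fourier n (y : UnitAddCircle) : ℂ) - 1‖ ^ 2 / y ^ 2) :=
        lintegral_union_le _ _ _
    _ ≤ (∫⁻ y in Ioc 0 (1 / N), ENNReal.ofReal (4 * Real.pi ^ 2 * N ^ 2))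
        + ∫⁻ y in Ioi (1 / N), ENNReal.ofReal (4 * y ^ (-2 : ℝ)) := by
        refine add_le_add (setLIntegral_mono' measurableSet_Ioc fun y hy =>
          ENNReal.ofReal_le_ofReal ?_) (setLIntegral_mono' measurableSet_Ioi fun y hy =>
          ENNReal.ofReal_le_ofReal ?_)
        · have hy0 := hy.1
          rw [div_le_iff₀ (by positivity)]
          calc _ ≤ (2 * Real.pi * N * y) ^ 2 := by gcongr; exact hle y hy.1.le
            _ = _ := by ring
        · have hy0 : 0 < y := lt_trans (by positivity) hy
          rw [Real.rpow_neg hy0.le, ← div_eq_mul_inv]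
          norm_cast
          gcongr
          rw [norm_fourier_sub_one]
          have := Real.abs_sin_le_one (Real.pi * n * y)
          have h0 := abs_nonneg (Real.sin (Real.pi * n * y))
          nlinarith
    _ = ENNReal.ofReal ((4 * Real.pi ^ 2 + 4) * N) := by
        have hp : 0 < 1 / N := by positivity
        rw [setLIntegral_const, Real.volume_Ioc, ← ENNReal.ofReal_mul (by positivity),
          ← ofReal_integral_eq_lintegral_ofReal
            ((integrableOn_Ioi_rpow_of_lt (by norm_num) hp).const_mul 4)
            ((ae_restrict_iff' measurableSet_Ioi).2 (Eventually.of_forall fun y hy => by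
              have hy0 : 0 < y := lt_trans (by positivity) hy
              simp only [Pi.zero_apply]; positivity)),
          integral_const_mul, integral_Ioi_rpow_of_lt (by norm_num) hp,
          ← ENNReal.ofReal_add (by positivity)]
        · congr 1
          norm_num [Real.rpow_neg_one]
          field_simp
        · norm_num [Real.rpow_neg_one]; positivity

/-- The Gagliardo form of the `H_{1/2}` seminorm. -/
theorem lintegral_translate_sub {v : UnitAddCircle → ℝ} (hv : MemLp v 2 volume) :
    ∫⁻ y in Ioc (0 : ℝ) 1, ENNReal.ofReal (1 / y ^ 2) *
        ∫⁻ x, ENNReal.ofReal ((v (x + (y : UnitAddCircle)) - v x) ^ 2) =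
      ∑' n : ℤ, gagliardoWeight n * ENNReal.ofReal (‖realCoeff v n‖ ^ 2) := by
  simp_rw [← tsum_translate_sub hv, ← ENNReal.tsum_mul_left]
  have hm : ∀ n : ℤ, Measurable fun y : ℝ =>
      ENNReal.ofReal (‖(fourier n (y : UnitAddCircle) : ℂ) - 1‖ ^ 2 / y ^ 2) := fun n => by
    have h1 : Continuous fun y : ℝ => (fourier n (y : UnitAddCircle) : ℂ) :=
      (fourier n).continuous.comp (AddCircle.continuous_mk' 1)
    have := h1.measurable
    fun_prop
  have e : ∀ (n : ℤ) (y : ℝ), ENNReal.ofReal (1 / y ^ 2) *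
      ENNReal.ofReal (‖(fourier n (y : UnitAddCircle) : ℂ) - 1‖ ^ 2 * ‖realCoeff v n‖ ^ 2)
      = ENNReal.ofReal (‖(fourier n (y : UnitAddCircle) : ℂ) - 1‖ ^ 2 / y ^ 2)
        * ENNReal.ofReal (‖realCoeff v n‖ ^ 2) := fun n y => by
    rw [← ENNReal.ofReal_mul (by positivity), ← ENNReal.ofReal_mul (by positivity)]
    congr 1; ring
  simp_rw [e]
  rw [lintegral_tsum fun n => ((hm n).mul_const _).aemeasurable]
  congr 1; ext n
  rw [lintegral_mul_const _ (hm n)]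
  rfl

/-- The constant in the `H_{1/2}` bound for the composition with a `1`-Lipschitz function: the
quotient of the upper and lower constants in the comparison of `gagliardoWeight n` with `|n|`. -/
def gagliardoConst : ℝ := (4 * Real.pi ^ 2 + 4) / 8

theorem gagliardoConst_pos : 0 < gagliardoConst := by unfold gagliardoConst; positivity

/-- Composition with a Lipschitz function is bounded for the `H_{1/2}` seminorm, because increments
of `f ∘ v` are controlled by increments of `v`. -/
theorem tsum_abs_mul_realCoeff_comp_le {f : ℝ → ℝ} {K : ℝ≥0} (hf : LipschitzWith K f)
    {v : UnitAddCircle → ℝ} (hv : MemLp v 2 volume) (hfv : MemLp (fun x => f (v x)) 2 volume) :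
    ∑' n : ℤ, ENNReal.ofReal (|(n : ℝ)| * ‖realCoeff (fun x => f (v x)) n‖ ^ 2) ≤
      ENNReal.ofReal (gagliardoConst * K ^ 2) *
        ∑' n : ℤ, ENNReal.ofReal (|(n : ℝ)| * ‖realCoeff v n‖ ^ 2) := by
  have main : ENNReal.ofReal 8 *
      ∑' n : ℤ, ENNReal.ofReal (|(n : ℝ)| * ‖realCoeff (fun x => f (v x)) n‖ ^ 2) ≤
      ENNReal.ofReal ((4 * Real.pi ^ 2 + 4) * K ^ 2) *
        ∑' n : ℤ, ENNReal.ofReal (|(n : ℝ)| * ‖realCoeff v n‖ ^ 2) := by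
    calc _ ≤ ∑' n : ℤ, gagliardoWeight n *
              ENNReal.ofReal (‖realCoeff (fun x => f (v x)) n‖ ^ 2) := by
          rw [← ENNReal.tsum_mul_left]
          refine ENNReal.tsum_le_tsum fun n => ?_
          rw [ENNReal.ofReal_mul (abs_nonneg _), ← mul_assoc, ← ENNReal.ofReal_mul (by norm_num)]
          gcongr
          exact le_gagliardoWeight n
      _ = ∫⁻ y in Ioc (0 : ℝ) 1, ENNReal.ofReal (1 / y ^ 2) *
            ∫⁻ x, ENNReal.ofReal ((f (v (x + (y : UnitAddCircle))) - f (v x)) ^ 2) :=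
          (lintegral_translate_sub hfv).symm
      _ ≤ ∫⁻ y in Ioc (0 : ℝ) 1, ENNReal.ofReal (K ^ 2) * (ENNReal.ofReal (1 / y ^ 2) *
            ∫⁻ x, ENNReal.ofReal ((v (x + (y : UnitAddCircle)) - v x) ^ 2)) := by
          refine lintegral_mono fun y => ?_
          simp only
          rw [mul_left_comm, ← lintegral_const_mul' (ENNReal.ofReal ((K : ℝ) ^ 2)) _
            ENNReal.ofReal_ne_top]
          gcongr with x
          rw [← ENNReal.ofReal_mul (by positivity)]
          refine ENNReal.ofReal_le_ofReal ?_
          have := hf.dist_le_mul (v (x + (y : UnitAddCircle))) (v x)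
          rw [Real.dist_eq, Real.dist_eq] at this
          have := pow_le_pow_left₀ (abs_nonneg _) this 2
          rwa [sq_abs, mul_pow, sq_abs] at this
      _ = ENNReal.ofReal (K ^ 2) *
            ∑' n : ℤ, gagliardoWeight n * ENNReal.ofReal (‖realCoeff v n‖ ^ 2) := by
          rw [lintegral_const_mul' _ _ ENNReal.ofReal_ne_top, lintegral_translate_sub hv]
      _ ≤ _ := by
          rw [← ENNReal.tsum_mul_left, ← ENNReal.tsum_mul_left]
          refine ENNReal.tsum_le_tsum fun n => ?_
          calc _ ≤ ENNReal.ofReal (K ^ 2) * (ENNReal.ofReal ((4 * Real.pi ^ 2 + 4) * |(n : ℝ)|) *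
                ENNReal.ofReal (‖realCoeff v n‖ ^ 2)) := by
                gcongr; exact gagliardoWeight_le n
            _ = _ := by
                rw [← ENNReal.ofReal_mul (by positivity), ← ENNReal.ofReal_mul (by positivity),
                  ← ENNReal.ofReal_mul (by positivity)]
                congr 1; ring
  rw [gagliardoConst, show (4 * Real.pi ^ 2 + 4) / 8 * (K : ℝ) ^ 2
    = (1 / 8) * ((4 * Real.pi ^ 2 + 4) * (K : ℝ) ^ 2) by ring, ENNReal.ofReal_mul (by norm_num),
    mul_assoc]
  refine le_trans (le_of_eq ?_) (mul_le_mul_right main (ENNReal.ofReal (1 / 8)))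
  rw [← mul_assoc, ← ENNReal.ofReal_mul (by norm_num)]
  norm_num

/-! ### Test functions -/

theorem contDiff_deriv_fst {Φ : ℝ × ℝ → ℝ} (hΦ : ContDiff ℝ ((⊤ : ℕ∞) : WithTop ℕ∞) Φ) :
    ContDiff ℝ ((⊤ : ℕ∞) : WithTop ℕ∞) fun z : ℝ × ℝ => deriv (fun r => Φ (r, z.2)) z.1 := by
  have : (fun z : ℝ × ℝ => deriv (fun r => Φ (r, z.2)) z.1) = fun z => fderiv ℝ Φ z (1, 0) := by
    ext z
    have h1 : HasFDerivAt Φ (fderiv ℝ Φ z) z :=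
      (hΦ.differentiable (by simp)).differentiableAt.hasFDerivAt
    have h2 : HasDerivAt (fun r : ℝ => (r, z.2)) ((1 : ℝ), (0 : ℝ)) z.1 :=
      (hasDerivAt_id z.1).prodMk (hasDerivAt_const z.1 z.2)
    exact (h1.comp_hasDerivAt z.1 h2).deriv
  rw [this]
  exact (hΦ.fderiv_right (m := ((⊤ : ℕ∞) : WithTop ℕ∞)) (by simp)).clm_apply contDiff_const

theorem hasDerivAt_snd {Φ : ℝ × ℝ → ℝ} (hΦ : ContDiff ℝ ((⊤ : ℕ∞) : WithTop ℕ∞) Φ) (t x : ℝ) :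
    HasDerivAt (fun r => Φ (t, r)) (deriv (fun r => Φ (t, r)) x) x := by
  have : ContDiff ℝ ((⊤ : ℕ∞) : WithTop ℕ∞) fun r => Φ (t, r) :=
    hΦ.comp (contDiff_const.prodMk contDiff_id)
  exact (this.differentiable (by simp)).differentiableAt.hasDerivAt

theorem contDiff_deriv_snd {Φ : ℝ × ℝ → ℝ} (hΦ : ContDiff ℝ ((⊤ : ℕ∞) : WithTop ℕ∞) Φ) :
    ContDiff ℝ ((⊤ : ℕ∞) : WithTop ℕ∞) fun z : ℝ × ℝ => deriv (fun r => Φ (z.1, r)) z.2 := by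
  have : (fun z : ℝ × ℝ => deriv (fun r => Φ (z.1, r)) z.2) = fun z => fderiv ℝ Φ z (0, 1) := by
    ext z
    have h1 : HasFDerivAt Φ (fderiv ℝ Φ z) z :=
      (hΦ.differentiable (by simp)).differentiableAt.hasFDerivAt
    have h2 : HasDerivAt (fun r : ℝ => (z.1, r)) ((0 : ℝ), (1 : ℝ)) z.2 :=
      (hasDerivAt_const z.2 z.1).prodMk (hasDerivAt_id z.2)
    exact (h1.comp_hasDerivAt z.2 h2).deriv
  rw [this]
  exact (hΦ.fderiv_right (m := ((⊤ : ℕ∞) : WithTop ℕ∞)) (by simp)).clm_apply contDiff_const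

theorem continuous_fourier_coe (n : ℤ) :
    Continuous fun x : ℝ => (fourier n (x : UnitAddCircle) : ℂ) :=
  (fourier n).continuous.comp (AddCircle.continuous_mk' 1)

/-- Fourier coefficients of smooth functions decay faster than any power, uniformly for `t` in
`[0,T]`. -/
theorem exists_fourier_decay (T : ℝ) (m : ℕ) : ∀ Φ : ℝ × ℝ → ℝ,
    ContDiff ℝ ((⊤ : ℕ∞) : WithTop ℕ∞) Φ → (∀ t x, Φ (t, x + 1) = Φ (t, x)) →
    ∃ C, ∀ t ∈ Icc (0 : ℝ) T, ∀ n : ℤ, (2 * Real.pi * |(n : ℝ)|) ^ m *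
      ‖∫ x in (0 : ℝ)..1, (fourier (-n) (x : UnitAddCircle) : ℂ) * (Φ (t, x) : ℂ)‖ ≤ C := by
  induction m with
  | zero =>
    intro Φ hΦ _
    obtain ⟨C, hC⟩ := (isCompact_Icc.prod isCompact_Icc :
      IsCompact (Icc (0 : ℝ) T ×ˢ Icc (0 : ℝ) 1)).exists_bound_of_continuousOn
      hΦ.continuous.continuousOn
    refine ⟨C, fun t ht n => ?_⟩
    rw [pow_zero, one_mul]
    have := intervalIntegral.norm_integral_le_of_norm_le_const (a := (0 : ℝ)) (b := 1) (C := C)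
      (f := fun x => (fourier (-n) (x : UnitAddCircle) : ℂ) * (Φ (t, x) : ℂ)) (fun x hx => by
        rw [norm_mul, norm_fourier_apply, one_mul, Complex.norm_real]
        rw [uIoc_of_le zero_le_one] at hx
        exact hC (t, x) ⟨ht, hx.1.le, hx.2⟩)
    simpa using this
  | succ m ih =>
    intro Φ hΦ hper
    obtain ⟨C, hC⟩ := ih _ (contDiff_deriv_snd hΦ) (fun t x => by
      have : (fun r => Φ (t, r)) = fun r => Φ (t, r + 1) := funext fun r => (hper t r).symm
      simp only
      conv_rhs => rw [this]
      rw [deriv_comp_add_const (fun r => Φ (t, r))])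
    refine ⟨C, fun t ht n => ?_⟩
    refine le_trans (le_of_eq ?_) (hC t ht n)
    rw [pow_succ, mul_assoc]
    congr 1
    have hd : ∀ x : ℝ, HasDerivAt
        (fun x : ℝ => (fourier (-n) (x : UnitAddCircle) : ℂ) * (Φ (t, x) : ℂ))
        (-2 * Real.pi * Complex.I * n * ((fourier (-n) (x : UnitAddCircle) : ℂ) * (Φ (t, x) : ℂ))
          + (fourier (-n) (x : UnitAddCircle) : ℂ) *
            ((deriv (fun r => Φ (t, r)) x : ℝ) : ℂ)) x := by
      intro x
      have h1 := hasDerivAt_fourier_neg 1 n x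
      have h2 := (hasDerivAt_snd hΦ t x).ofReal_comp
      convert! h1.mul h2 using 1
      push_cast
      ring
    have hΦc : Continuous fun x => Φ (t, x) := hΦ.continuous.comp (by fun_prop)
    have hΦc' : Continuous fun x => deriv (fun r => Φ (t, r)) x :=
      (contDiff_deriv_snd hΦ).continuous.comp (by fun_prop : Continuous fun x : ℝ => (t, x))
    have hfc := continuous_fourier_coe (-n)
    have i1 : IntervalIntegrable (fun x : ℝ => -2 * Real.pi * Complex.I * n *
        ((fourier (-n) (x : UnitAddCircle) : ℂ) * (Φ (t, x) : ℂ))) volume 0 1 :=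
      Continuous.intervalIntegrable (by fun_prop) _ _
    have i2 : IntervalIntegrable (fun x : ℝ => (fourier (-n) (x : UnitAddCircle) : ℂ) *
        ((deriv (fun r => Φ (t, r)) x : ℝ) : ℂ)) volume 0 1 :=
      Continuous.intervalIntegrable (by fun_prop) _ _
    have e := intervalIntegral.integral_eq_sub_of_hasDerivAt (a := 0) (b := 1)
      (fun x _ => hd x) (i1.add i2)
    rw [intervalIntegral.integral_add i1 i2, intervalIntegral.integral_const_mul] at e
    have h01 : Φ (t, 1) = Φ (t, 0) := by simpa using hper t 0
    have hf01 : (fourier (-n) ((1 : ℝ) : UnitAddCircle) : ℂ)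
        = fourier (-n) ((0 : ℝ) : UnitAddCircle) := by
      congr 1
      rw [AddCircle.coe_period, AddCircle.coe_zero]
    rw [h01, hf01, sub_self] at e
    have e' := eq_neg_of_add_eq_zero_right e
    rw [e', norm_neg, norm_mul]
    congr 1
    simp [abs_of_pos Real.pi_pos]

theorem realCoeff_eq_intervalIntegral (w : UnitAddCircle → ℝ) (n : ℤ) :
    realCoeff w n = ∫ x in (0 : ℝ)..1, (fourier (-n) (x : UnitAddCircle) : ℂ) * (w x : ℂ) := by
  rw [realCoeff_eq_integral]
  have := UnitAddCircle.intervalIntegral_preimage 0 fun x => (fourier (-n) x : ℂ) * (w x : ℂ)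
  rw [zero_add] at this
  exact this.symm

theorem IsTest.exists_decay {T : ℝ} {φ : ℝ × UnitAddCircle → ℝ} (hφ : IsTest T φ) (m : ℕ) :
    ∃ C, ∀ (t : Icc (0 : ℝ) T) (n : ℤ), (2 * Real.pi * |(n : ℝ)|) ^ m *
      ‖realCoeff (fun y => φ ((t : ℝ), y)) n‖ ≤ C := by
  obtain ⟨C, hC⟩ := exists_fourier_decay T m _ hφ.smooth fun t x => by
    simp
  refine ⟨C, fun t n => ?_⟩
  rw [realCoeff_eq_intervalIntegral]
  exact hC t t.2 n

/-- Continuity on `ℝ × 𝕋` can be checked on the universal cover. -/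
theorem continuous_of_lift {g : ℝ × UnitAddCircle → ℝ}
    (hg : Continuous fun z : ℝ × ℝ => g (z.1, (z.2 : UnitAddCircle))) : Continuous g := by
  have q : IsOpenQuotientMap (Prod.map id ((↑) : ℝ → UnitAddCircle) : ℝ × ℝ → ℝ × UnitAddCircle) :=
    IsOpenQuotientMap.id.prodMap QuotientAddGroup.isOpenQuotientMap_mk
  exact q.isQuotientMap.continuous_iff.2 hg

theorem IsTest.continuous {T : ℝ} {φ : ℝ × UnitAddCircle → ℝ} (hφ : IsTest T φ) : Continuous φ :=
  continuous_of_lift hφ.smooth.continuous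

theorem IsTest.continuous_dt {T : ℝ} {φ : ℝ × UnitAddCircle → ℝ} (hφ : IsTest T φ) :
    Continuous fun z : Icc (0 : ℝ) T × UnitAddCircle => dt φ z.1 z.2 := by
  have : Continuous fun z : ℝ × UnitAddCircle => dt φ z.1 z.2 :=
    continuous_of_lift (contDiff_deriv_fst hφ.smooth).continuous
  exact this.comp
    (by fun_prop : Continuous fun z : Icc (0 : ℝ) T × UnitAddCircle => ((z.1 : ℝ), z.2))

theorem IsTest.continuous_dx {T : ℝ} {φ : ℝ × UnitAddCircle → ℝ} (hφ : IsTest T φ) :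
    Continuous fun z : Icc (0 : ℝ) T × UnitAddCircle => dx φ z.1 z.2 := by
  have : Continuous fun z : ℝ × UnitAddCircle => dx φ z.1 z.2 := by
    refine continuous_of_lift ?_
    refine (contDiff_deriv_snd hφ.smooth).continuous.congr fun z => ?_
    have e := deriv_comp_const_add (fun r : ℝ => φ (z.1, (r : UnitAddCircle))) z.2 0
    simp only [add_zero] at e
    rw [← e]
    simp [dx]
  exact this.comp
    (by fun_prop : Continuous fun z : Icc (0 : ℝ) T × UnitAddCircle => ((z.1 : ℝ), z.2))

theorem IsTest.continuous_realCoeff {T : ℝ} {φ : ℝ × UnitAddCircle → ℝ} (hφ : IsTest T φ) (n : ℤ) :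
    Continuous fun t : Icc (0 : ℝ) T => realCoeff (fun y => φ ((t : ℝ), y)) n := by
  simp_rw [realCoeff_eq_intervalIntegral]
  refine intervalIntegral.continuous_parametric_intervalIntegral_of_continuous' ?_ 0 1
  have h1 := hφ.smooth.continuous
  have h2 := continuous_fourier_coe (-n)
  have h3 : Continuous fun z : Icc (0 : ℝ) T × ℝ => φ ((z.1 : ℝ), (z.2 : UnitAddCircle)) :=
    h1.comp (by fun_prop : Continuous fun z : Icc (0 : ℝ) T × ℝ => ((z.1 : ℝ), z.2))
  have h4 : Continuous fun z : Icc (0 : ℝ) T × ℝ => (fourier (-n) (z.2 : UnitAddCircle) : ℂ) :=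
    h2.comp continuous_snd
  exact h4.mul (Complex.continuous_ofReal.comp h3)

/-- A Fourier multiplier of polynomial growth maps test functions to continuous curves in `ℓ²`. -/
theorem IsTest.exists_weighted_curve {T : ℝ} {φ : ℝ × UnitAddCircle → ℝ} (hφ : IsTest T φ)
    {c : ℤ → ℝ} (k : ℕ) (h0 : c 0 = 0) (hc : ∀ n, n ≠ 0 → |c n| ≤ (2 * Real.pi * |(n : ℝ)|) ^ k) :
    ∃ Ψ : Icc (0 : ℝ) T → SeqSpace, Continuous Ψ ∧
      ∀ t n, Ψ t n = (c n : ℂ) * realCoeff (fun y => φ ((t : ℝ), y)) n := by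
  obtain ⟨C, hC⟩ := hφ.exists_decay (k + 1)
  have hsum : Summable fun n : ℤ => C ^ 2 * (1 / (n : ℝ) ^ 2) :=
    (Real.summable_one_div_int_pow.2 (by norm_num)).mul_left _
  have hle : ∀ (t : Icc (0 : ℝ) T) n, ‖(c n : ℂ) * realCoeff (fun y => φ ((t : ℝ), y)) n‖ ^ 2
      ≤ C ^ 2 * (1 / (n : ℝ) ^ 2) := by
    intro t n
    rcases eq_or_ne n 0 with rfl | hn
    · simp [h0]
    have hx := two_pi_abs_pos hn
    have hn1 : 0 < |(n : ℝ)| := by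
      rw [abs_pos]; exact_mod_cast hn
    have h1 : ‖(c n : ℂ) * realCoeff (fun y => φ ((t : ℝ), y)) n‖ * |(n : ℝ)| ≤ C := by
      refine le_trans ?_ (hC t n)
      rw [norm_mul, Complex.norm_real, Real.norm_eq_abs, pow_succ]
      have h2 : |(n : ℝ)| ≤ 2 * Real.pi * |(n : ℝ)| := by
        have := Real.pi_gt_three
        nlinarith
      calc |c n| * ‖realCoeff (fun y => φ ((t : ℝ), y)) n‖ * |(n : ℝ)|
          = |c n| * |(n : ℝ)| * ‖realCoeff (fun y => φ ((t : ℝ), y)) n‖ := by ring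
        _ ≤ _ := by gcongr; exact hc n hn
    rw [mul_one_div, le_div_iff₀ (by positivity), ← sq_abs (n : ℝ), ← mul_pow]
    gcongr
  refine ⟨fun t => toSeq _ (hsum.of_nonneg_of_le (fun n => by positivity) (hle t)), ?_,
    fun t n => rfl⟩
  exact continuous_seq_of_dominated
    (fun n => continuous_const.mul (hφ.continuous_realCoeff n)) hsum hle

theorem inner_seq_eq (x y : SeqSpace) : inner ℝ x y = ∑' n, (y n * conj (x n)).re := by
  rw [lp.inner_eq_tsum]
  simp only [Complex.inner]

theorem two_le_two_pi_abs {n : ℤ} (hn : n ≠ 0) : 2 ≤ 2 * Real.pi * |(n : ℝ)| := by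
  have h1 : (1 : ℝ) ≤ |(n : ℝ)| := by exact_mod_cast Int.one_le_abs hn
  have := Real.pi_gt_three
  nlinarith

/-- The pairing of `H_{-1}` with `(-∂ₓₓ)^s φ` as an `ℓ²` scalar product with a continuous curve. -/
theorem IsTest.exists_pairing_curve {T s : ℝ} (hs : 0 < s) {φ : ℝ × UnitAddCircle → ℝ}
    (hφ : IsTest T φ) : ∃ Ψ : Icc (0 : ℝ) T → SeqSpace, Continuous Ψ ∧
      ∀ (t : Icc (0 : ℝ) T) (g : Sobolev (-1)),
        fracPairing s (sobolevCoeff g) (realCoeff fun y => φ ((t : ℝ), y))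
        = inner ℝ (Ψ t) (g : SeqSpace) := by
  obtain ⟨Ψ, hΨ, h⟩ := hφ.exists_weighted_curve
    (c := fun n => (2 * Real.pi * |(n : ℝ)|) ^ (2 * s) *
      (1 + (2 * Real.pi * n) ^ 2) ^ ((1 : ℝ) / 2))
    (⌈2 * s⌉₊ + 2) (by simp [Real.zero_rpow (by positivity : 2 * s ≠ 0)]) (fun n hn => by
      have hx := two_le_two_pi_abs hn
      rw [abs_of_nonneg (by positivity)]
      have e : (2 * Real.pi * (n : ℝ)) ^ 2 = (2 * Real.pi * |(n : ℝ)|) ^ 2 := by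
        rw [mul_pow _ |(n : ℝ)|, sq_abs, mul_pow _ (n : ℝ)]
      rw [e]
      generalize 2 * Real.pi * |(n : ℝ)| = x at hx
      rw [pow_add]
      have h1 : x ^ (2 * s) ≤ x ^ ⌈2 * s⌉₊ := by
        rw [← Real.rpow_natCast]
        exact Real.rpow_le_rpow_of_exponent_le (by linarith) (Nat.le_ceil _)
      have h2 : (1 + x ^ 2) ^ ((1 : ℝ) / 2) ≤ x ^ 2 := by
        rw [← Real.sqrt_eq_rpow]
        apply Real.sqrt_le_iff.2
        constructor
        · positivity
        · nlinarith [sq_nonneg (x ^ 2), sq_nonneg x, mul_self_nonneg (x ^ 2 - 4)]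
      gcongr)
  refine ⟨Ψ, hΨ, fun t g => ?_⟩
  rw [inner_seq_eq, fracPairing]
  congr 1; ext n
  rw [h, coe_eq_sobolevCoeff, map_mul, Complex.conj_ofReal]
  have h0 : 0 < 1 + (2 * Real.pi * (n : ℝ)) ^ 2 := by positivity
  push_cast
  generalize 1 + (2 * Real.pi * (n : ℝ)) ^ 2 = c at h0
  have e : (c ^ ((-1 : ℝ) / 2)) * c ^ ((1 : ℝ) / 2) = 1 := by
    rw [← Real.rpow_add h0]; norm_num
  generalize (2 * Real.pi * |(n : ℝ)|) ^ (2 * s) = d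
  generalize conj (realCoeff (fun y => φ ((t : ℝ), y)) n) = z
  have e2 : ((c ^ ((-1 : ℝ) / 2) : ℝ) : ℂ) * sobolevCoeff g n *
      ((d : ℂ) * ((c ^ ((1 : ℝ) / 2) : ℝ) : ℂ) * z)
      = ((c ^ ((-1 : ℝ) / 2) * c ^ ((1 : ℝ) / 2) : ℝ) : ℂ) *
        ((d : ℂ) * (sobolevCoeff g n * z)) := by
    push_cast; ring
  rw [e2, e, Complex.ofReal_one, one_mul, Complex.re_ofReal_mul]

/-- A test function represents an element of `L₂([0,T]; Ḣ_s)`, and the scalar product with it is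
the distributional pairing. -/
theorem IsTest.exists_energySpace {T s : ℝ} (hs : 0 < s) {φ : ℝ × UnitAddCircle → ℝ}
    (hφ : IsTest T φ) : ∃ Θ : EnergySpace T s, ∀ h : EnergySpace T s,
      ∫ t : Icc (0 : ℝ) T, fracPairing s (homCoeff (h t)) (realCoeff fun y => φ ((t : ℝ), y))
        ∂timeMeasure T = inner ℝ Θ h := by
  obtain ⟨Ψ, hΨ, hc⟩ := hφ.exists_weighted_curve
    (c := fun n => (2 * Real.pi * |(n : ℝ)|) ^ s)
    ⌈s⌉₊ (by simp [Real.zero_rpow hs.ne']) (fun n hn => by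
      have hx := two_le_two_pi_abs hn
      rw [abs_of_nonneg (by positivity), ← Real.rpow_natCast]
      exact Real.rpow_le_rpow_of_exponent_le (by linarith) (Nat.le_ceil _))
  have hmem : ∀ t, Ψ t ∈ HomSobolev s := fun t => by
    refine ⟨?_, fun n => ?_⟩
    · rw [hc]; simp [Real.zero_rpow hs.ne']
    · rw [hc, hc, realCoeff_neg_index]; simp
  have hcont : Continuous fun t => (⟨Ψ t, hmem t⟩ : HomSobolev s) := hΨ.subtype_mk _
  obtain ⟨B, hB⟩ := (isCompact_range hcont).isBounded.exists_norm_le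
  have hL : MemLp (fun t => (⟨Ψ t, hmem t⟩ : HomSobolev s)) 2 (timeMeasure T) :=
    MemLp.of_bound hcont.aestronglyMeasurable B (Eventually.of_forall fun t => hB _ ⟨t, rfl⟩)
  refine ⟨hL.toLp _, fun h => ?_⟩
  rw [L2.inner_def]
  refine integral_congr_ae ?_
  filter_upwards [hL.coeFn_toLp] with t ht
  rw [ht]
  change _ = inner ℝ (Ψ t) (h t : SeqSpace)
  rw [inner_seq_eq, fracPairing]
  congr 1; ext n
  rcases eq_or_ne n 0 with rfl | hn
  · rw [homCoeff_zero_index, (h t).2.1]; simp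
  rw [hc, coe_eq_homCoeff _ hn, rpow_two_mul_eq_sq hn, map_mul, Complex.conj_ofReal]
  generalize (2 * Real.pi * |(n : ℝ)|) ^ s = d
  generalize conj (realCoeff (fun y => φ ((t : ℝ), y)) n) = z
  rw [show (d : ℂ) * homCoeff (h t) n * ((d : ℂ) * z)
      = ((d ^ 2 : ℝ) : ℂ) * (homCoeff (h t) n * z) by
    push_cast; ring, Complex.re_ofReal_mul]

/-! ### Continuity of the residual -/

theorem integrable_Lp {α : Type*} [MeasurableSpace α] {μ : Measure α} [IsFiniteMeasure μ]
    {p : ℝ≥0∞} [hp : Fact (1 ≤ p)] (v : Lp ℝ p μ) : Integrable v μ :=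
  (Lp.memLp v).integrable hp.out

/-- `L_p ⊂ L_1` on a finite measure space, quantitatively. -/
theorem exists_integral_abs_sub_le {α : Type*} [MeasurableSpace α] (μ : Measure α)
    [IsFiniteMeasure μ] (p : ℝ≥0∞) [hp : Fact (1 ≤ p)] :
    ∃ C : ℝ, 0 ≤ C ∧ ∀ v w : Lp ℝ p μ, ∫ z, |v z - w z| ∂μ ≤ C * ‖v - w‖ := by
  refine ⟨((μ univ) ^ (1 - 1 / p.toReal)).toReal, ENNReal.toReal_nonneg, fun v w => ?_⟩
  have h := eLpNorm_le_eLpNorm_mul_rpow_measure_univ hp.out (Lp.aestronglyMeasurable (v - w))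
  have he : 0 ≤ 1 - 1 / p.toReal := by
    rcases eq_or_ne p ⊤ with rfl | hpt
    · simp
    · have : 1 ≤ p.toReal := by
        rw [← ENNReal.toReal_one]; exact ENNReal.toReal_mono hpt hp.out
      rw [sub_nonneg, div_le_one (by linarith)]; exact this
  have e1 : ∫ z, |v z - w z| ∂μ = (eLpNorm (v - w : Lp ℝ p μ) 1 μ).toReal := by
    rw [eLpNorm_one_eq_lintegral_enorm,
      ← integral_norm_eq_lintegral_enorm (Lp.aestronglyMeasurable _)]
    refine integral_congr_ae ?_
    filter_upwards [Lp.coeFn_sub v w] with z hz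
    rw [hz]; rfl
  rw [e1, Lp.norm_def, mul_comm, ← ENNReal.toReal_mul]
  refine ENNReal.toReal_mono ?_ (by simpa using h)
  refine ENNReal.mul_ne_top (Lp.eLpNorm_ne_top _) ?_
  exact ENNReal.rpow_ne_top_of_nonneg he (measure_ne_top _ _)

/-- Integration of a Lipschitz nonlinearity against a bounded weight is continuous on `L_p`. -/
theorem continuous_integral_comp_mul {α : Type*} [MeasurableSpace α] {μ : Measure α}
    [IsFiniteMeasure μ] {p : ℝ≥0∞} [hp : Fact (1 ≤ p)] {F : ℝ → ℝ} {K : ℝ≥0}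
    (hF : LipschitzWith K F) {G : α → ℝ} (hG : AEStronglyMeasurable G μ) {B : ℝ}
    (hB : ∀ z, |G z| ≤ B) : Continuous fun v : Lp ℝ p μ => ∫ z, F (v z) * G z ∂μ := by
  obtain ⟨C, hC, h⟩ := exists_integral_abs_sub_le μ p
  have hint : ∀ v : Lp ℝ p μ, Integrable (fun z => F (v z)) μ := fun v => by
    have : Integrable (fun z => |F 0| + K * |v z|) μ :=
      (integrable_const _).add ((integrable_Lp v).abs.const_mul _)
    refine this.mono' (hF.continuous.comp_aestronglyMeasurable (Lp.aestronglyMeasurable v))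
      (Eventually.of_forall fun z => ?_)
    have h1 := hF.dist_le_mul (v z) 0
    rw [Real.dist_eq, Real.dist_eq, sub_zero] at h1
    rw [Real.norm_eq_abs]
    calc |F (v z)| = |F 0 + (F (v z) - F 0)| := by ring_nf
      _ ≤ |F 0| + |F (v z) - F 0| := abs_add_le _ _
      _ ≤ _ := by gcongr
  have hint2 : ∀ v : Lp ℝ p μ, Integrable (fun z => F (v z) * G z) μ := fun v =>
    (hint v).mul_bdd hG (Eventually.of_forall hB)
  have hL : ∀ v w : Lp ℝ p μ,
      dist (∫ z, F (v z) * G z ∂μ) (∫ z, F (w z) * G z ∂μ) ≤ (K * |B| * C) * dist v w := by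
    intro v w
    rw [Real.dist_eq, ← integral_sub (hint2 v) (hint2 w), dist_eq_norm]
    calc ‖∫ z, (F (v z) * G z - F (w z) * G z) ∂μ‖ ≤ ∫ z, (K * |B|) * |v z - w z| ∂μ := by
          refine norm_integral_le_of_norm_le
            (((integrable_Lp v).sub (integrable_Lp w)).abs.const_mul _)
            (Eventually.of_forall fun z => ?_)
          have h1 := hF.dist_le_mul (v z) (w z)
          rw [Real.dist_eq, Real.dist_eq] at h1
          rw [← sub_mul, norm_mul, Real.norm_eq_abs, Real.norm_eq_abs]
          calc |F (v z) - F (w z)| * |G z| ≤ (K * |v z - w z|) * |B| := by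
                exact mul_le_mul h1 ((hB z).trans (le_abs_self _)) (abs_nonneg _) (by positivity)
            _ = _ := by ring
      _ ≤ (K * |B|) * (C * ‖v - w‖) := by
          rw [integral_const_mul]; gcongr; exact h v w
      _ = _ := by ring
  exact (LipschitzWith.of_dist_le_mul (K := ⟨K * |B| * C, by positivity⟩) hL).continuous

/-- For a fixed test function the residual is continuous in the state: the nonlinearity passes to
the limit by strong convergence. -/
theorem continuous_transportResidual {T ε s : ℝ} (hs : 0 < s) {p : ℝ≥0∞} [Fact (1 ≤ p)]
    {f : ℝ → ℝ} {K : ℝ≥0} (hf : LipschitzWith K f) {φ : ℝ × UnitAddCircle → ℝ} (hφ : IsTest T φ) :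
    Continuous fun u : StateSpace T p => transportResidual T ε s p f u φ := by
  have hdt := hφ.continuous_dt
  have hdx := hφ.continuous_dx
  obtain ⟨B1, hB1⟩ := (isCompact_range hdt).isBounded.exists_norm_le
  obtain ⟨B2, hB2⟩ := (isCompact_range hdx).isBounded.exists_norm_le
  have hsnd : Continuous fun u : StateSpace T p => u.1.2 :=
    continuous_snd.comp continuous_subtype_val
  have c1 := (continuous_integral_comp_mul (p := p) (μ := spaceTimeMeasure T) LipschitzWith.id
    hdt.aestronglyMeasurable fun z => hB1 _ ⟨z, rfl⟩).comp hsnd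
  have c2 := (continuous_integral_comp_mul (p := p) (μ := spaceTimeMeasure T) hf
    hdx.aestronglyMeasurable fun z => hB2 _ ⟨z, rfl⟩).comp hsnd
  obtain ⟨Ψ, hΨ, hpair⟩ := hφ.exists_pairing_curve hs
  have c3 : Continuous fun u : StateSpace T p => ∫ t : Icc (0 : ℝ) T,
      fracPairing s (sobolevCoeff (u.1.1 t)) (realCoeff fun y => φ ((t : ℝ), y))
        ∂timeMeasure T := by
    simp_rw [hpair]
    obtain ⟨B, hB⟩ := (isCompact_range hΨ).isBounded.exists_norm_le
    have hc : ∀ u : C(Icc (0 : ℝ) T, Sobolev (-1)),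
        Integrable (fun t => inner ℝ (Ψ t) (u t : SeqSpace)) (timeMeasure T) := fun u =>
      (hΨ.inner (continuous_subtype_val.comp u.continuous)).integrable_of_hasCompactSupport
        (HasCompactSupport.of_compactSpace _)
    have hL : ∀ u v : C(Icc (0 : ℝ) T, Sobolev (-1)),
        dist (∫ t, inner ℝ (Ψ t) (u t : SeqSpace) ∂timeMeasure T)
          (∫ t, inner ℝ (Ψ t) (v t : SeqSpace) ∂timeMeasure T)
        ≤ |B| * (timeMeasure T).real univ * dist u v := by
      intro u v
      rw [Real.dist_eq, ← integral_sub (hc u) (hc v)]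
      have := norm_integral_le_of_norm_le_const (μ := timeMeasure T) (C := |B| * dist u v)
        (f := fun t => inner ℝ (Ψ t) (u t : SeqSpace) - inner ℝ (Ψ t) (v t : SeqSpace))
        (Eventually.of_forall fun t => by
          rw [← inner_sub_right]
          refine (norm_inner_le_norm _ _).trans ?_
          gcongr
          · exact (hB _ ⟨t, rfl⟩).trans (le_abs_self _)
          · exact (dist_eq_norm (u t) (v t)).symm.le.trans (ContinuousMap.dist_apply_le_dist t))
      rw [Real.norm_eq_abs] at this
      linarith
    have hcont := (LipschitzWith.of_dist_le_mul
      (K := ⟨|B| * (timeMeasure T).real univ, by positivity⟩) hL).continuous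
    exact hcont.comp (continuous_fst.comp continuous_subtype_val)
  exact (c1.neg.sub c2).add (continuous_const.mul c3)

/-! ### The evolution of a single Fourier mode -/

/-- The real trigonometric test function `ψ(t) Re (c e^{-2πinx})`. -/
def modeTest (ψ : ℝ → ℝ) (c : ℂ) (n : ℤ) (z : ℝ × UnitAddCircle) : ℝ :=
  ψ z.1 * (c * fourier (-n) z.2).re

theorem isTest_modeTest {T : ℝ} {ψ : ℝ → ℝ} (hψ : IsTimeTest T ψ) (c : ℂ) (n : ℤ) :
    IsTest T (modeTest ψ c n) := by
  obtain ⟨h1, a, b, ha, hb, hz⟩ := hψ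
  refine ⟨?_, a, b, ha, hb, fun t ht x => by simp [modeTest, hz t ht]⟩
  simp only [modeTest, fourier_coe_apply]
  refine (h1.comp contDiff_fst).mul ?_
  have h2 : ContDiff ℝ ((⊤ : ℕ∞) : WithTop ℕ∞) fun z : ℝ × ℝ => (z.2 : ℂ) :=
    Complex.ofRealCLM.contDiff.comp contDiff_snd
  have h3 : ContDiff ℝ ((⊤ : ℕ∞) : WithTop ℕ∞) fun z : ℝ × ℝ =>
      c * Complex.exp (2 * Real.pi * Complex.I * (-n : ℤ) * (z.2 : ℂ) / (1 : ℝ)) :=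
    contDiff_const.mul (((contDiff_const.mul h2).div_const _).cexp)
  exact Complex.reCLM.contDiff.comp h3

theorem dt_modeTest (ψ : ℝ → ℝ) (c : ℂ) (n : ℤ) (t : ℝ) (x : UnitAddCircle) :
    dt (modeTest ψ c n) t x = deriv ψ t * (c * fourier (-n) x).re := by
  simp only [dt, modeTest]
  exact deriv_mul_const_field _

theorem dx_modeTest (ψ : ℝ → ℝ) (c : ℂ) (n : ℤ) (t : ℝ) (x : UnitAddCircle) :
    dx (modeTest ψ c n) t x
      = ψ t * (c * (-2 * Real.pi * Complex.I * n) * fourier (-n) x).re := by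
  simp only [dx, modeTest]
  have e : ∀ r : ℝ, (fourier (-n) (x + (r : UnitAddCircle)) : ℂ)
      = fourier (-n) x * fourier (-n) (r : UnitAddCircle) := fun r => by
    simp only [fourier_apply, smul_add, AddCircle.toCircle_add, Circle.coe_mul]
  simp_rw [e]
  have h1 := hasDerivAt_fourier_neg 1 n 0
  have h2 := (h1.const_mul (c * fourier (-n) x))
  have h3 : HasDerivAt (fun r : ℝ => (c * (fourier (-n) x * fourier (-n) (r : UnitAddCircle))).re)
      (c * fourier (-n) x * (-2 * Real.pi * Complex.I * n / (1 : ℝ) *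
        fourier (-n) ((0 : ℝ) : UnitAddCircle))).re 0 := by
    have := (Complex.reCLM.hasFDerivAt (x := c * fourier (-n) x *
      fourier (-n) ((0 : ℝ) : UnitAddCircle))).comp_hasDerivAt (0 : ℝ) h2
    refine this.congr_of_eventuallyEq (Eventually.of_forall fun r => ?_)
    simp [mul_assoc]
  rw [(h3.const_mul (ψ t)).deriv]
  congr 2
  rw [AddCircle.coe_zero, fourier_eval_zero]
  push_cast
  ring

theorem integrable_realCoeff {T : ℝ} {w : Icc (0 : ℝ) T × UnitAddCircle → ℝ}
    (hw : Integrable w (spaceTimeMeasure T)) (n : ℤ) :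
    Integrable (fun t => realCoeff (fun y => w (t, y)) n) (timeMeasure T) := by
  have h : Integrable (fun z : Icc (0 : ℝ) T × UnitAddCircle =>
      (fourier (-n) z.2 : ℂ) * (w z : ℂ)) (spaceTimeMeasure T) := by
    have hc : Continuous fun z : Icc (0 : ℝ) T × UnitAddCircle => (fourier (-n) z.2 : ℂ) :=
      (fourier (-n)).continuous.comp continuous_snd
    exact hw.ofReal.bdd_mul (c := 1) hc.aestronglyMeasurable
      (Eventually.of_forall fun z => (norm_fourier_apply _ z.2).le)
  have := Integrable.integral_prod_left h
  simpa only [realCoeff_eq_integral] using this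

/-- Fubini for a space-time function against a single mode. -/
theorem integral_mul_mode {T : ℝ} {w : Icc (0 : ℝ) T × UnitAddCircle → ℝ}
    (hw : Integrable w (spaceTimeMeasure T)) {ρ : Icc (0 : ℝ) T → ℝ} (hρ : Continuous ρ)
    (c : ℂ) (n : ℤ) :
    ∫ z, w z * (ρ z.1 * (c * fourier (-n) z.2).re) ∂spaceTimeMeasure T
      = ∫ t, ρ t * (c * realCoeff (fun y => w (t, y)) n).re ∂timeMeasure T := by
  obtain ⟨B, hB⟩ := (isCompact_range hρ).isBounded.exists_norm_le
  have hfc : Continuous fun z : Icc (0 : ℝ) T × UnitAddCircle => (fourier (-n) z.2 : ℂ) :=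
      (fourier (-n)).continuous.comp continuous_snd
  have hc : Continuous fun z : Icc (0 : ℝ) T × UnitAddCircle =>
      ρ z.1 * (c * fourier (-n) z.2).re := by
    have := hρ.comp (continuous_fst : Continuous fun z : Icc (0 : ℝ) T × UnitAddCircle => z.1)
    exact this.mul (Complex.continuous_re.comp (continuous_const.mul hfc))
  have hi : Integrable (fun z => w z * (ρ z.1 * (c * fourier (-n) z.2).re))
      (spaceTimeMeasure T) := by
    obtain ⟨B', hB'⟩ := (isCompact_range hc).isBounded.exists_norm_le
    exact hw.mul_bdd hc.aestronglyMeasurable (Eventually.of_forall fun z => hB' _ ⟨z, rfl⟩)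
  rw [spaceTimeMeasure, integral_prod _ hi]
  refine integral_congr_ae ?_
  filter_upwards [Integrable.prod_right_ae hw] with t ht
  have h1 : ∀ y, w (t, y) * (ρ t * (c * fourier (-n) y).re)
      = ρ t * (c * (fourier (-n) y * (w (t, y) : ℂ))).re := fun y => by
    rw [← mul_assoc c, Complex.re_mul_ofReal]; ring
  simp only [h1]
  rw [integral_const_mul, realCoeff_eq_integral, ← integral_const_mul c]
  congr 1
  exact integral_re ((integrable_fourier_mul ht (-n)).const_mul c)

theorem realCoeff_mode (r : ℝ) (c : ℂ) (n m : ℤ) :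
    realCoeff (fun y => r * (c * fourier (-n) y).re) m
      = (r / 2 : ℂ) * (c * (if m = -n then 1 else 0) + conj c * (if m = n then 1 else 0)) := by
  have hf : ∀ k : ℤ, ∫ y : UnitAddCircle, (fourier (-m) y : ℂ) * (fourier k y : ℂ)
      = if m = k then 1 else 0 := by
    intro k
    have := congrFun (fourierCoeff_fourier (T := 1) k) m
    rw [fourierCoeff, ← volume_eq_haar, Pi.single_apply] at this
    exact this
  have hi : ∀ k : ℤ, Integrable (fun y : UnitAddCircle => (fourier (-m) y : ℂ) * fourier k y) :=
    fun k => ((fourier (-m)).continuous.mul (fourier k).continuous).integrable_of_hasCompactSupport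
      (HasCompactSupport.of_compactSpace _)
  rw [realCoeff_eq_integral]
  calc ∫ y, (fourier (-m) y : ℂ) * ((r * (c * fourier (-n) y).re : ℝ) : ℂ)
      = ∫ y : UnitAddCircle, ((r / 2 : ℂ) * c * ((fourier (-m) y : ℂ) * fourier (-n) y)
          + (r / 2 : ℂ) * conj c * ((fourier (-m) y : ℂ) * fourier n y)) := by
        congr 1; ext y
        rw [Complex.ofReal_mul, Complex.re_eq_add_conj, map_mul, ← fourier_neg, neg_neg]
        ring
    _ = _ := by
        rw [integral_add ((hi _).const_mul _) ((hi _).const_mul _), integral_const_mul,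
          integral_const_mul, hf, hf]
        ring

/-- In the pairing with a real trigonometric function the modes `n` and `-n` contribute equally. -/
theorem fracPairing_mode (s : ℝ) {a : ℤ → ℂ} (ha : ∀ n, a (-n) = conj (a n)) (r : ℝ) (c : ℂ)
    (n : ℤ) :
    fracPairing s a (realCoeff fun y => r * (c * fourier (-n) y).re)
      = r * ((2 * Real.pi * |(n : ℝ)|) ^ (2 * s) * (c * a n).re) := by
  have h1 : HasSum (fun m : ℤ => (2 * Real.pi * |(m : ℝ)|) ^ (2 * s) *
      (a m * conj ((r / 2 : ℂ) * (c * (if m = -n then 1 else 0)))).re)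
      ((2 * Real.pi * |((-n : ℤ) : ℝ)|) ^ (2 * s) *
      (a (-n) * conj ((r / 2 : ℂ) * (c * (if -n = -n then 1 else 0)))).re) :=
    hasSum_single (-n) fun m hm => by simp [hm]
  have h2 : HasSum (fun m : ℤ => (2 * Real.pi * |(m : ℝ)|) ^ (2 * s) *
      (a m * conj ((r / 2 : ℂ) * (conj c * (if m = n then 1 else 0)))).re)
      ((2 * Real.pi * |((n : ℤ) : ℝ)|) ^ (2 * s) *
      (a n * conj ((r / 2 : ℂ) * (conj c * (if n = n then 1 else 0)))).re) :=
    hasSum_single n fun m hm => by simp [hm]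
  have h3 := (h1.add h2).tsum_eq
  rw [fracPairing]
  simp_rw [realCoeff_mode]
  refine Eq.trans ?_ (h3.trans ?_)
  · congr 1; ext m
    rw [mul_add (r / 2 : ℂ), map_add, mul_add, Complex.add_re, mul_add]
  · simp only [if_true, mul_one, ha, Int.cast_neg, abs_neg]
    have e1 : (conj (a n) * conj ((r / 2 : ℂ) * c)).re = r / 2 * (c * a n).re := by
      rw [← map_mul, Complex.conj_re,
        show a n * ((r / 2 : ℂ) * c) = ((r / 2 : ℝ) : ℂ) * (c * a n) by push_cast; ring,
        Complex.re_ofReal_mul]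
    have e2 : (a n * conj ((r / 2 : ℂ) * conj c)).re = r / 2 * (c * a n).re := by
      rw [map_mul, Complex.conj_conj, show conj (r / 2 : ℂ) = ((r / 2 : ℝ) : ℂ) by
        rw [← Complex.conj_ofReal (r / 2)]; push_cast; rfl,
        show a n * (((r / 2 : ℝ) : ℂ) * c) = ((r / 2 : ℝ) : ℂ) * (c * a n) by
        ring, Complex.re_ofReal_mul]
    rw [e1, e2]; ring

/-- `h` represents the distribution `∂_t u + ∂_x f(u) + (ε/2)(-∂ₓₓ)^s u`, as `(-∂ₓₓ)^s h`. -/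
def IsControl (T ε s : ℝ) (p : ℝ≥0∞) (f : ℝ → ℝ) (u : StateSpace T p) (h : EnergySpace T s) :
    Prop :=
  ∀ φ : ℝ × UnitAddCircle → ℝ, IsTest T φ → transportResidual T ε s p f u φ =
    ∫ t : Icc (0 : ℝ) T,
      fracPairing s (homCoeff (h t)) (realCoeff fun y => φ ((t : ℝ), y)) ∂timeMeasure T

/-- The `n`-th Fourier coefficient of the state at time `t`. -/
def modeCoeff {T : ℝ} {p : ℝ≥0∞} (u : StateSpace T p) (n : ℤ) (t : Icc (0 : ℝ) T) : ℂ :=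
  sobolevCoeff (u.1.1 t) n

/-- The `n`-th Fourier coefficient of the flux `f(u)` at time `t`. -/
def fluxCoeff {T : ℝ} {p : ℝ≥0∞} (f : ℝ → ℝ) (u : StateSpace T p) (n : ℤ)
    (t : Icc (0 : ℝ) T) : ℂ :=
  realCoeff (fun y => f (u.1.2 (t, y))) n

/-- The time derivative `-∂ₓ f(u) - (ε/2)(-∂ₓₓ)^s u + (-∂ₓₓ)^s h` in the `n`-th mode. -/
def modeDeriv {T : ℝ} {p : ℝ≥0∞} (ε s : ℝ) (f : ℝ → ℝ) (u : StateSpace T p)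
    (h : EnergySpace T s) (n : ℤ) (t : Icc (0 : ℝ) T) : ℂ :=
  -2 * Real.pi * Complex.I * n * fluxCoeff f u n t
    - (ε / 2 * (2 * Real.pi * |(n : ℝ)|) ^ (2 * s) : ℝ) * modeCoeff u n t
    + ((2 * Real.pi * |(n : ℝ)|) ^ (2 * s) : ℝ) * homCoeff (h t) n

theorem continuous_modeCoeff {T : ℝ} {p : ℝ≥0∞} (u : StateSpace T p) (n : ℤ) :
    Continuous (modeCoeff u n) :=
  (continuous_sobolevCoeff n).comp u.1.1.continuous

theorem integrable_of_continuous_timeMeasure {T : ℝ} {E : Type*} [NormedAddCommGroup E]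
    {a : Icc (0 : ℝ) T → E} (ha : Continuous a) : Integrable a (timeMeasure T) :=
  ha.integrable_of_hasCompactSupport (HasCompactSupport.of_compactSpace _)

section

variable {T : ℝ} {p : ℝ≥0∞} {f : ℝ → ℝ} {C : ℝ}

theorem integrable_flux (hfc : Continuous f) (hC : ∀ x, |f x| ≤ C) (u : StateSpace T p) :
    Integrable (fun z => f (u.1.2 z)) (spaceTimeMeasure T) :=
  Integrable.of_bound (hfc.comp_aestronglyMeasurable (Lp.aestronglyMeasurable _)) C
    (Eventually.of_forall fun _ => hC _)

theorem integrable_fluxCoeff (hfc : Continuous f) (hC : ∀ x, |f x| ≤ C) (u : StateSpace T p)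
    (n : ℤ) : Integrable (fluxCoeff f u n) (timeMeasure T) :=
  integrable_realCoeff (integrable_flux hfc hC u) n

theorem norm_fluxCoeff_le (hC : ∀ x, |f x| ≤ C) (u : StateSpace T p) (n : ℤ)
    (t : Icc (0 : ℝ) T) : ‖fluxCoeff f u n t‖ ≤ C := by
  refine (norm_realCoeff_le n).trans ?_
  have hC0 : 0 ≤ C := (abs_nonneg _).trans (hC 0)
  by_cases hi : Integrable (fun y => |f (u.1.2 (t, y))|) (volume : Measure UnitAddCircle)
  · refine (integral_mono hi (integrable_const C) fun y => hC _).trans ?_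
    simp [Measure.real]
  -- for a non-measurable slice the bound holds because the integral is zero by convention
  · rw [integral_undef hi]; exact hC0

theorem integrable_homCoeff {s : ℝ} (h : EnergySpace T s) (n : ℤ) :
    Integrable (fun t => homCoeff (h t) n) (timeMeasure T) := by
  have h1 : Integrable h (timeMeasure T) := (Lp.memLp h).integrable (by norm_num)
  have h2 : Integrable (fun t => (h t : SeqSpace) n) (timeMeasure T) :=
    ((lp.evalCLM ℝ (fun _ : ℤ => ℂ) 2 n) ∘L (HomSobolev s).subtypeL).integrable_comp h1
  exact h2.const_mul _

theorem integrable_modeDeriv (hfc : Continuous f) (hC : ∀ x, |f x| ≤ C) (ε s : ℝ)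
    (u : StateSpace T p) (h : EnergySpace T s) (n : ℤ) :
    Integrable (modeDeriv ε s f u h n) (timeMeasure T) :=
  (((integrable_fluxCoeff hfc hC u n).const_mul _).sub
    ((integrable_of_continuous_timeMeasure (continuous_modeCoeff u n)).const_mul _)).add
    ((integrable_homCoeff h n).const_mul _)

/-- Every Fourier mode of a state with control `h` is a primitive of `modeDeriv`. Real and
imaginary parts are covered together by means of the complex factor `c`. -/
theorem IsControl.modeCoeff_eq [Fact (1 ≤ p)] (hT : 0 < T) (hfc : Continuous f)
    (hC : ∀ x, |f x| ≤ C) {ε s : ℝ}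
    {u : StateSpace T p} {h : EnergySpace T s} (hu : IsControl T ε s p f u h) (c : ℂ) (n : ℤ)
    (t : Icc (0 : ℝ) T) :
    (c * modeCoeff u n t).re = (c * modeCoeff u n ⟨0, left_mem_Icc.2 hT.le⟩).re
      + ∫ r in Iic t, (c * modeDeriv ε s f u h n r).re ∂timeMeasure T := by
  have hre : ∀ {g : Icc (0 : ℝ) T → ℂ}, Integrable g (timeMeasure T) → ∀ c : ℂ,
      Integrable (fun t => (c * g t).re) (timeMeasure T) := fun hg c => (hg.const_mul c).re
  have iA := integrable_of_continuous_timeMeasure (continuous_modeCoeff u n)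
  have iF := integrable_fluxCoeff hfc hC u n
  have iH := integrable_homCoeff h n
  refine eq_integral_of_weak_derivative hT (x := fun t => (c * modeCoeff u n t).re)
    (Complex.continuous_re.comp (continuous_const.mul (continuous_modeCoeff u n)))
    (hre (integrable_modeDeriv hfc hC ε s u h n) c) (fun ψ hψ => ?_) t
  have hψc : Continuous fun t : Icc (0 : ℝ) T => ψ t :=
    hψ.1.continuous.comp continuous_subtype_val
  have hψd : Continuous fun t : Icc (0 : ℝ) T => deriv ψ t :=
    (contDiff_infty_iff_deriv.1 hψ.1).2.continuous.comp continuous_subtype_val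
  have hmul : ∀ {ρ : Icc (0 : ℝ) T → ℝ} {g : Icc (0 : ℝ) T → ℝ}, Continuous ρ →
      Integrable g (timeMeasure T) → Integrable (fun t => ρ t * g t) (timeMeasure T) := by
    intro ρ g hρ hg
    obtain ⟨B, hB⟩ := (isCompact_range hρ).isBounded.exists_norm_le
    exact hg.bdd_mul hρ.aestronglyMeasurable (Eventually.of_forall fun z => hB _ ⟨z, rfl⟩)
  have key := hu _ (isTest_modeTest hψ c n)
  rw [transportResidual] at key
  simp only [dt_modeTest, dx_modeTest] at key
  rw [integral_mul_mode (integrable_Lp u.1.2) hψd,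
    integral_mul_mode (integrable_flux hfc hC u) hψc] at key
  simp only [modeTest] at key
  simp_rw [fracPairing_mode s (fun n => sobolevCoeff_neg_index _ n),
    fracPairing_mode s (fun n => homCoeff_neg_index _ n)] at key
  have e1 : ∫ t, deriv ψ t * (c * realCoeff (fun y => u.1.2 (t, y)) n).re ∂timeMeasure T
      = ∫ t, (c * modeCoeff u n t).re * deriv ψ t ∂timeMeasure T := by
    refine integral_congr_ae ?_
    filter_upwards [u.2] with t ht
    rw [← ht n, mul_comm]; rfl
  rw [e1] at key
  have i1 := hmul hψc (hre iF (c * (-2 * Real.pi * Complex.I * n)))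
  have i2 := hmul hψc ((hre iA c).const_mul ((2 * Real.pi * |(n : ℝ)|) ^ (2 * s)))
  have i3 := hmul hψc ((hre iH c).const_mul ((2 * Real.pi * |(n : ℝ)|) ^ (2 * s)))
  have e2 : ∫ t, (c * modeDeriv ε s f u h n t).re * ψ t ∂timeMeasure T
      = (∫ t : Icc (0 : ℝ) T, ψ t *
          (c * (-2 * Real.pi * Complex.I * n) * fluxCoeff f u n t).re ∂timeMeasure T)
        - (ε / 2) * (∫ t : Icc (0 : ℝ) T, ψ t * ((2 * Real.pi * |(n : ℝ)|) ^ (2 * s) *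
            (c * modeCoeff u n t).re) ∂timeMeasure T)
        + ∫ t : Icc (0 : ℝ) T, ψ t * ((2 * Real.pi * |(n : ℝ)|) ^ (2 * s) *
            (c * homCoeff (h t) n).re) ∂timeMeasure T := by
    have i4 : Integrable (fun t : Icc (0 : ℝ) T =>
        ψ t * (c * (-2 * Real.pi * Complex.I * n) * fluxCoeff f u n t).re
          - (ε / 2) * (ψ t * ((2 * Real.pi * |(n : ℝ)|) ^ (2 * s) * (c * modeCoeff u n t).re)))
        (timeMeasure T) := i1.sub (i2.const_mul _)
    rw [← integral_const_mul, ← integral_sub i1 (i2.const_mul _), ← integral_add i4 i3]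
    congr 1; ext t
    rw [modeDeriv]
    generalize (2 * Real.pi * |(n : ℝ)|) ^ (2 * s) = d
    have : c * (-2 * Real.pi * Complex.I * n * fluxCoeff f u n t
        - (ε / 2 * d : ℝ) * modeCoeff u n t + (d : ℝ) * homCoeff (h t) n)
        = c * (-2 * Real.pi * Complex.I * n) * fluxCoeff f u n t
          - (ε / 2 * d : ℝ) * (c * modeCoeff u n t) + (d : ℝ) * (c * homCoeff (h t) n) := by ring
    rw [this, Complex.add_re, Complex.sub_re, Complex.re_ofReal_mul, Complex.re_ofReal_mul]
    ring
  rw [e2]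
  simp only [modeCoeff, fluxCoeff] at key ⊢
  linarith

end

/-- The product rule for `e^{-Bt} ‖a(t)‖²` when `a` is a primitive of `G`. -/
theorem exp_mul_norm_sq_eq {T : ℝ} (hT : 0 ≤ T) {a G : Icc (0 : ℝ) T → ℂ} (ha : Continuous a)
    (hG : Integrable G (timeMeasure T))
    (h : ∀ (c : ℂ) t, (c * a t).re = (c * a ⟨0, left_mem_Icc.2 hT⟩).re
      + ∫ r in Iic t, (c * G r).re ∂timeMeasure T) (B : ℝ) (t : Icc (0 : ℝ) T) :
    Real.exp (-B * t) * ‖a t‖ ^ 2 = ‖a ⟨0, left_mem_Icc.2 hT⟩‖ ^ 2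
      + ∫ r in Iic t, Real.exp (-B * r) * (2 * (conj (a r) * G r).re - B * ‖a r‖ ^ 2)
        ∂timeMeasure T := by
  set z : Icc (0 : ℝ) T := ⟨0, left_mem_Icc.2 hT⟩
  have h1 : ∀ t, (a t).re = (a z).re + ∫ r in Iic t, (G r).re ∂timeMeasure T := fun t => by
    simpa using h 1 t
  have h2 : ∀ t, (a t).im = (a z).im + ∫ r in Iic t, (G r).im ∂timeMeasure T := fun t => by
    simpa using h (-Complex.I) t
  have iG1 : Integrable (fun t => (G t).re) (timeMeasure T) := hG.re
  have iG2 : Integrable (fun t => (G t).im) (timeMeasure T) := hG.im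
  have p1 := mul_eq_integral_of_primitive hT iG1 iG1 h1 h1
  have p2 := mul_eq_integral_of_primitive hT iG2 iG2 h2 h2
  have hmul : ∀ {ρ : Icc (0 : ℝ) T → ℝ} {g : Icc (0 : ℝ) T → ℝ}, Continuous ρ →
      Integrable g (timeMeasure T) → Integrable (fun t => ρ t * g t) (timeMeasure T) := by
    intro ρ g hρ hg
    obtain ⟨B, hB⟩ := (isCompact_range hρ).isBounded.exists_norm_le
    exact hg.bdd_mul hρ.aestronglyMeasurable (Eventually.of_forall fun z => hB _ ⟨z, rfl⟩)
  have hare : Continuous fun t => (a t).re := Complex.continuous_re.comp ha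
  have haim : Continuous fun t => (a t).im := Complex.continuous_im.comp ha
  have iD : Integrable (fun r => 2 * (conj (a r) * G r).re) (timeMeasure T) := by
    have := ((hmul hare iG1).add (hmul haim iG2)).const_mul 2
    refine this.congr (Eventually.of_forall fun r => ?_)
    simp [Complex.mul_re]
  have pn : ∀ t, ‖a t‖ ^ 2 = ‖a z‖ ^ 2 + ∫ r in Iic t, 2 * (conj (a r) * G r).re
      ∂timeMeasure T := fun t => by
    have hn : ∀ w : ℂ, ‖w‖ ^ 2 = w.re * w.re + w.im * w.im := fun w => by
      rw [Complex.sq_norm, Complex.normSq_apply]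
    rw [hn, hn, p1 t, p2 t, add_add_add_comm, ← integral_add]
    · congr 2; ext r; simp [Complex.mul_re]; ring
    · have := (hmul hare iG1).const_mul 2
      refine (this.congr (Eventually.of_forall fun r => ?_)).integrableOn
      simp only; ring
    · have := (hmul haim iG2).const_mul 2
      refine (this.congr (Eventually.of_forall fun r => ?_)).integrableOn
      simp only; ring
  have iE : Integrable (fun r : Icc (0 : ℝ) T => Real.exp (-B * r) * -B) (timeMeasure T) :=
    integrable_of_continuous_timeMeasure (by fun_prop)
  have pe : ∀ t : Icc (0 : ℝ) T, Real.exp (-B * t) = Real.exp (-B * z)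
      + ∫ r in Iic t, Real.exp (-B * r) * -B ∂timeMeasure T := fun t => by
    rw [setIntegral_timeMeasure hT]
    have e : ∫ r in (0 : ℝ)..t, IccExtend hT (fun r : Icc (0 : ℝ) T => Real.exp (-B * r) * -B) r
        = ∫ r in (0 : ℝ)..t, Real.exp (-B * r) * -B := by
      apply intervalIntegral.integral_congr
      intro r hr
      rw [uIcc_of_le t.2.1] at hr
      simp only
      rw [IccExtend_of_mem hT _ ⟨hr.1, hr.2.trans t.2.2⟩]
    rw [e, intervalIntegral.integral_eq_sub_of_hasDerivAt
      (f := fun r => Real.exp (-B * r)) (fun r _ => ?_)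
      (Continuous.intervalIntegrable (by fun_prop) _ _)]
    · simp [z]
    · simpa using ((hasDerivAt_id r).const_mul (-B)).exp
  have fin := mul_eq_integral_of_primitive hT iE iD pe pn t
  rw [fin]
  simp only [mul_zero, Real.exp_zero, one_mul, z]
  congr 2; ext r; ring

/-! ### A priori estimates -/

theorem one_le_weight {s : ℝ} (hs : 1 / 2 < s) {n : ℤ} (hn : n ≠ 0) :
    1 ≤ (2 * Real.pi * |(n : ℝ)|) ^ (2 * s) :=
  Real.one_le_rpow (by linarith [two_le_two_pi_abs hn]) (by linarith)

theorem weight_zero {s : ℝ} (hs : 1 / 2 < s) : (2 * Real.pi * |((0 : ℤ) : ℝ)|) ^ (2 * s) = 0 := by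
  rw [Int.cast_zero, abs_zero, mul_zero, Real.zero_rpow (by linarith)]

theorem abs_le_weight {s : ℝ} (hs : 1 / 2 < s) (n : ℤ) :
    |(n : ℝ)| ≤ (2 * Real.pi * |(n : ℝ)|) ^ (2 * s) := by
  rcases eq_or_ne n 0 with rfl | hn
  · simp; positivity
  have h1 := two_le_two_pi_abs hn
  have h2 : 2 * Real.pi * |(n : ℝ)| ≤ (2 * Real.pi * |(n : ℝ)|) ^ (2 * s) :=
    Real.self_le_rpow_of_one_le (by linarith) (by linarith)
  have := Real.pi_gt_three
  nlinarith [abs_nonneg (n : ℝ)]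

/-- Since `2s > 1`, the dissipation controls `|n|` up to a constant. -/
theorem exists_mul_abs_le_weight {s : ℝ} (hs : 1 / 2 < s) {D δ : ℝ} (hD : 0 ≤ D) (hδ : 0 < δ) :
    ∃ B : ℝ, 0 ≤ B ∧ ∀ n : ℤ, D * |(n : ℝ)| ≤ δ * (2 * Real.pi * |(n : ℝ)|) ^ (2 * s) + B := by
  have hlim := tendsto_rpow_atTop (y := 2 * s - 1) (by linarith)
  obtain ⟨x₀, hx₀⟩ := (hlim.eventually_ge_atTop (D / δ)).exists_forall_of_atTop
  refine ⟨D * |x₀|, by positivity, fun n => ?_⟩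
  set x := 2 * Real.pi * |(n : ℝ)| with hx
  have hxn : |(n : ℝ)| ≤ x := by
    have := Real.pi_gt_three
    nlinarith [abs_nonneg (n : ℝ)]
  have hx0 : 0 ≤ x := by positivity
  rcases le_or_gt x x₀ with h | h
  · have h1 : 0 ≤ δ * x ^ (2 * s) := by positivity
    have h2 : D * |(n : ℝ)| ≤ D * |x₀| := by
      exact mul_le_mul_of_nonneg_left ((hxn.trans h).trans (le_abs_self _)) hD
    linarith
  · rcases hx0.eq_or_lt with h0 | h0
    · have : |(n : ℝ)| = 0 := le_antisymm (by linarith) (abs_nonneg _)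
      rw [this, mul_zero]; positivity
    have h1 := hx₀ x h.le
    rw [div_le_iff₀ hδ] at h1
    have h2 : x ^ (2 * s) = x ^ (2 * s - 1) * x := by
      rw [Real.rpow_sub_one h0.ne']; field_simp
    have h3 : D * |(n : ℝ)| ≤ D * x := by gcongr
    have h4 : D * x ≤ (x ^ (2 * s - 1) * δ) * x := by gcongr
    have h5 : 0 ≤ D * |x₀| := by positivity
    rw [h2]; linarith

theorem abs_re_flux_le (a F : ℂ) (n : ℤ) :
    |2 * (conj a * (-2 * Real.pi * Complex.I * n * F)).re|
      ≤ 2 * Real.pi * |(n : ℝ)| * (‖F‖ ^ 2 + ‖a‖ ^ 2) := by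
  have h1 : |(conj a * (-2 * Real.pi * Complex.I * n * F)).re|
      ≤ ‖a‖ * (2 * Real.pi * |(n : ℝ)| * ‖F‖) := by
    refine (Complex.abs_re_le_norm _).trans (le_of_eq ?_)
    simp [abs_of_pos Real.pi_pos]
  rw [abs_mul, abs_two]
  have h2 : 2 * (‖a‖ * ‖F‖) ≤ ‖F‖ ^ 2 + ‖a‖ ^ 2 := by nlinarith [sq_nonneg (‖a‖ - ‖F‖)]
  have h3 : 0 ≤ 2 * Real.pi * |(n : ℝ)| := by positivity
  nlinarith [mul_le_mul_of_nonneg_left h2 h3]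

theorem abs_re_control_le (a h : ℂ) : |(conj a * h).re| ≤ ‖a‖ * ‖h‖ := by
  refine (Complex.abs_re_le_norm _).trans (le_of_eq ?_)
  simp

theorem two_re_modeDeriv {T : ℝ} {p : ℝ≥0∞} (ε s : ℝ) (f : ℝ → ℝ) (u : StateSpace T p)
    (h : EnergySpace T s) (n : ℤ) (t : Icc (0 : ℝ) T) :
    2 * (conj (modeCoeff u n t) * modeDeriv ε s f u h n t).re
      = 2 * (conj (modeCoeff u n t) * (-2 * Real.pi * Complex.I * n * fluxCoeff f u n t)).re
        - ε * (2 * Real.pi * |(n : ℝ)|) ^ (2 * s) * ‖modeCoeff u n t‖ ^ 2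
        + 2 * (2 * Real.pi * |(n : ℝ)|) ^ (2 * s) *
          (conj (modeCoeff u n t) * homCoeff (h t) n).re := by
  rw [modeDeriv]
  generalize (2 * Real.pi * |(n : ℝ)|) ^ (2 * s) = d
  generalize -2 * Real.pi * Complex.I * n * fluxCoeff f u n t = g
  generalize modeCoeff u n t = a
  generalize homCoeff (h t) n = k
  have : conj a * (g - (ε / 2 * d : ℝ) * a + (d : ℝ) * k)
      = conj a * g - ((ε / 2 * d : ℝ) : ℂ) * (conj a * a) + (d : ℂ) * (conj a * k) := by ring
  rw [this, Complex.add_re, Complex.sub_re, Complex.re_ofReal_mul, Complex.re_ofReal_mul,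
    ← Complex.normSq_eq_conj_mul_self, Complex.ofReal_re, Complex.normSq_eq_norm_sq]
  ring

/-- Young's inequality for the energy production of one mode. -/
theorem two_re_modeDeriv_le {T : ℝ} {p : ℝ≥0∞} {ε : ℝ} (hε : 0 < ε) (s : ℝ) (f : ℝ → ℝ)
    (u : StateSpace T p) (h : EnergySpace T s) (n : ℤ) (t : Icc (0 : ℝ) T) :
    2 * (conj (modeCoeff u n t) * modeDeriv ε s f u h n t).re
      ≤ 2 * Real.pi * |(n : ℝ)| * (‖fluxCoeff f u n t‖ ^ 2 + ‖modeCoeff u n t‖ ^ 2)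
        - ε / 2 * (2 * Real.pi * |(n : ℝ)|) ^ (2 * s) * ‖modeCoeff u n t‖ ^ 2
        + 2 / ε * ((2 * Real.pi * |(n : ℝ)|) ^ (2 * s) * ‖homCoeff (h t) n‖ ^ 2) := by
  rw [two_re_modeDeriv]
  have h1 := (le_abs_self _).trans (abs_re_flux_le (modeCoeff u n t) (fluxCoeff f u n t) n)
  have h2 := (le_abs_self _).trans (abs_re_control_le (modeCoeff u n t) (homCoeff (h t) n))
  have hd : 0 ≤ (2 * Real.pi * |(n : ℝ)|) ^ (2 * s) := by positivity
  have h3 : 2 * (‖modeCoeff u n t‖ * ‖homCoeff (h t) n‖)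
      ≤ ε / 2 * ‖modeCoeff u n t‖ ^ 2 + 2 / ε * ‖homCoeff (h t) n‖ ^ 2 := by
    have h0 : 0 ≤ (ε / 2) * (‖modeCoeff u n t‖ - 2 / ε * ‖homCoeff (h t) n‖) ^ 2 := by positivity
    have e : (ε / 2) * (‖modeCoeff u n t‖ - 2 / ε * ‖homCoeff (h t) n‖) ^ 2
        = ε / 2 * ‖modeCoeff u n t‖ ^ 2 - 2 * (‖modeCoeff u n t‖ * ‖homCoeff (h t) n‖)
          + 2 / ε * ‖homCoeff (h t) n‖ ^ 2 := by field_simp; ring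
    linarith
  nlinarith [mul_le_mul_of_nonneg_left h2 hd, mul_le_mul_of_nonneg_left h3 hd]

/-- The energy production of one mode in absolute value, without a sign for the dissipation. -/
theorem abs_two_re_modeDeriv_le {T : ℝ} {p : ℝ≥0∞} {ε : ℝ} (hε : 0 < ε) (s : ℝ) (f : ℝ → ℝ)
    (u : StateSpace T p) (h : EnergySpace T s) (n : ℤ) (t : Icc (0 : ℝ) T) :
    |2 * (conj (modeCoeff u n t) * modeDeriv ε s f u h n t).re|
      ≤ 2 * Real.pi * |(n : ℝ)| * (‖fluxCoeff f u n t‖ ^ 2 + ‖modeCoeff u n t‖ ^ 2)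
        + (ε + 1) * ((2 * Real.pi * |(n : ℝ)|) ^ (2 * s) * ‖modeCoeff u n t‖ ^ 2)
        + (2 * Real.pi * |(n : ℝ)|) ^ (2 * s) * ‖homCoeff (h t) n‖ ^ 2 := by
  rw [two_re_modeDeriv]
  have h1 := abs_re_flux_le (modeCoeff u n t) (fluxCoeff f u n t) n
  have h2 := abs_re_control_le (modeCoeff u n t) (homCoeff (h t) n)
  have hd : 0 ≤ (2 * Real.pi * |(n : ℝ)|) ^ (2 * s) := by positivity
  have h3 : 2 * (‖modeCoeff u n t‖ * ‖homCoeff (h t) n‖)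
      ≤ ‖modeCoeff u n t‖ ^ 2 + ‖homCoeff (h t) n‖ ^ 2 := by
    nlinarith [sq_nonneg (‖modeCoeff u n t‖ - ‖homCoeff (h t) n‖)]
  have h4 : |2 * (2 * Real.pi * |(n : ℝ)|) ^ (2 * s) *
      (conj (modeCoeff u n t) * homCoeff (h t) n).re|
      ≤ (2 * Real.pi * |(n : ℝ)|) ^ (2 * s) *
        (‖modeCoeff u n t‖ ^ 2 + ‖homCoeff (h t) n‖ ^ 2) := by
    rw [abs_mul, abs_of_nonneg (by positivity : 0 ≤ 2 * (2 * Real.pi * |(n : ℝ)|) ^ (2 * s))]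
    nlinarith [mul_le_mul_of_nonneg_left h2 hd, mul_le_mul_of_nonneg_left h3 hd]
  have h5 : |ε * (2 * Real.pi * |(n : ℝ)|) ^ (2 * s) * ‖modeCoeff u n t‖ ^ 2|
      = ε * (2 * Real.pi * |(n : ℝ)|) ^ (2 * s) * ‖modeCoeff u n t‖ ^ 2 :=
    abs_of_nonneg (by positivity)
  refine (abs_add_le _ _).trans ((add_le_add (abs_sub _ _) le_rfl).trans ?_)
  rw [h5]
  linarith

/-- The space-time density of the `L₂([0,T]; Ḣ_s)` norm of the state. -/
def energyDensity {T : ℝ} {p : ℝ≥0∞} (s : ℝ) (u : StateSpace T p) (t : Icc (0 : ℝ) T) : ℝ≥0∞ :=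
  ∑' n : ℤ, ENNReal.ofReal ((2 * Real.pi * |(n : ℝ)|) ^ (2 * s) * ‖modeCoeff u n t‖ ^ 2)

theorem measurable_energyDensity {T : ℝ} {p : ℝ≥0∞} (s : ℝ) (u : StateSpace T p) :
    Measurable (energyDensity s u) :=
  Measurable.tsum fun n => by
    have := (continuous_modeCoeff u n).measurable
    fun_prop

theorem lintegral_energyDensity_ne_top {T s : ℝ} (hs : 1 / 2 < s) {p : ℝ≥0∞} {u : StateSpace T p}
    (hu : MemEnergy T s p u) : ∫⁻ t, energyDensity s u t ∂timeMeasure T ≠ ⊤ := by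
  obtain ⟨k, hk⟩ := hu
  have : ∫⁻ t, energyDensity s u t ∂timeMeasure T = ENNReal.ofReal (‖k‖ ^ 2) := by
    rw [← lintegral_tsum_homCoeff]
    refine lintegral_congr_ae ?_
    filter_upwards [hk] with t ht
    refine tsum_congr fun n => ?_
    rcases eq_or_ne n 0 with rfl | hn
    · rw [weight_zero hs]; simp
    · rw [modeCoeff, ht n hn]
  rw [this]
  exact ENNReal.ofReal_ne_top

theorem summable_modeCoeff_sq {T s : ℝ} (hs : 1 / 2 < s) {p : ℝ≥0∞} {u : StateSpace T p}
    {t : Icc (0 : ℝ) T} (ht : energyDensity s u t ≠ ⊤) :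
    Summable fun n => ‖modeCoeff u n t‖ ^ 2 := by
  have h1 := summable_of_tsum_ofReal_ne_top (fun n => by positivity) ht
  refine (h1.add (hasSum_ite_eq (0 : ℤ) (‖modeCoeff u 0 t‖ ^ 2)).summable).of_nonneg_of_le
    (fun n => by positivity) fun n => ?_
  rcases eq_or_ne n 0 with rfl | hn
  · simp only [if_true]
    rw [weight_zero hs, zero_mul, zero_add]
  · simp only [hn, if_false, add_zero]
    exact le_mul_of_one_le_left (by positivity) (one_le_weight hs hn)

section

variable {T : ℝ} {p : ℝ≥0∞} {f : ℝ → ℝ} {C : ℝ} {K : ℝ≥0}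

/-- A state of finite energy is square integrable in space at almost every time. -/
theorem memLp_two_slice [Fact (1 ≤ p)] {s : ℝ} (hs : 1 / 2 < s) {u : StateSpace T p}
    (hu : ∫⁻ t, energyDensity s u t ∂timeMeasure T ≠ ⊤) :
    ∀ᵐ t ∂timeMeasure T, MemLp (fun y => u.1.2 (t, y)) 2 (volume : Measure UnitAddCircle) := by
  have h1 : ∀ᵐ t ∂timeMeasure T, Integrable (fun y => u.1.2 (t, y)) volume :=
    Integrable.prod_right_ae (integrable_Lp u.1.2)
  filter_upwards [h1, u.2, ae_lt_top (measurable_energyDensity s u) hu] with t h1 h2 h3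
  refine memLp_two_of_summable h1 ?_
  have := summable_modeCoeff_sq hs h3.ne
  simpa only [modeCoeff, h2] using this

/-- The `H_{1/2}` bound for the flux. -/
theorem tsum_fluxCoeff_le [Fact (1 ≤ p)] (hf : LipschitzWith K f)
    (hC : ∀ x, |f x| ≤ C) {s : ℝ} (hs : 1 / 2 < s)
    {u : StateSpace T p} (hu : ∫⁻ t, energyDensity s u t ∂timeMeasure T ≠ ⊤) :
    ∀ᵐ t ∂timeMeasure T, ∑' n : ℤ, ENNReal.ofReal (|(n : ℝ)| * ‖fluxCoeff f u n t‖ ^ 2) ≤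
      ENNReal.ofReal (gagliardoConst * K ^ 2) *
        ∑' n : ℤ, ENNReal.ofReal (|(n : ℝ)| * ‖modeCoeff u n t‖ ^ 2) := by
  filter_upwards [memLp_two_slice hs hu, u.2] with t h1 h2
  have h3 : MemLp (fun y => f (u.1.2 (t, y))) 2 (volume : Measure UnitAddCircle) :=
    MemLp.of_bound (hf.continuous.comp_aestronglyMeasurable h1.1) C
      (Eventually.of_forall fun y => hC _)
  have := tsum_abs_mul_realCoeff_comp_le hf h1 h3
  simp only [modeCoeff, h2]
  exact this

theorem integrable_norm_sq_fluxCoeff (hfc : Continuous f) (hC : ∀ x, |f x| ≤ C)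
    (u : StateSpace T p) (n : ℤ) :
    Integrable (fun t => ‖fluxCoeff f u n t‖ ^ 2) (timeMeasure T) :=
  Integrable.of_bound ((integrable_fluxCoeff hfc hC u n).aestronglyMeasurable.norm.pow 2) (C ^ 2)
    (Eventually.of_forall fun t => by
      rw [Real.norm_of_nonneg (by positivity)]
      gcongr
      exact norm_fluxCoeff_le hC u n t)

theorem integrable_norm_sq_homCoeff {s : ℝ} (h : EnergySpace T s) (n : ℤ) :
    Integrable (fun t => (2 * Real.pi * |(n : ℝ)|) ^ (2 * s) * ‖homCoeff (h t) n‖ ^ 2)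
      (timeMeasure T) := by
  simp_rw [weight_mul_norm_sq_homCoeff]
  have h2 : MemLp (fun t => (h t : SeqSpace) n) 2 (timeMeasure T) :=
    ((lp.evalCLM ℝ (fun _ : ℤ => ℂ) 2 n) ∘L (HomSobolev s).subtypeL).comp_memLp' (Lp.memLp h)
  exact h2.integrable_norm_pow (by norm_num)

/-- The energy inequality of a single mode, with the exponential weight `e^{-Bt}`. It is stated
with nonnegative terms on both sides, so that it can be summed over the modes in `[0,∞]`. -/
theorem IsControl.mode_energy [Fact (1 ≤ p)] (hT : 0 < T) (hfc : Continuous f)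
    (hC : ∀ x, |f x| ≤ C) {ε s : ℝ}
    (hε : 0 < ε) {u : StateSpace T p} {h : EnergySpace T s} (hu : IsControl T ε s p f u h)
    {B : ℝ} (hB : 0 ≤ B) (n : ℤ) (t : Icc (0 : ℝ) T) :
    ENNReal.ofReal (Real.exp (-B * t) * ‖modeCoeff u n t‖ ^ 2)
      + ∫⁻ r in Iic t, ENNReal.ofReal (Real.exp (-B * r) *
          ((ε / 2 * (2 * Real.pi * |(n : ℝ)|) ^ (2 * s) + B) * ‖modeCoeff u n r‖ ^ 2))
          ∂timeMeasure T
      ≤ ENNReal.ofReal (‖modeCoeff u n ⟨0, left_mem_Icc.2 hT.le⟩‖ ^ 2)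
        + (∫⁻ r in Iic t, ENNReal.ofReal (Real.exp (-B * r) *
          (2 * Real.pi * |(n : ℝ)| * (‖fluxCoeff f u n r‖ ^ 2 + ‖modeCoeff u n r‖ ^ 2)))
          ∂timeMeasure T)
        + ∫⁻ r in Iic t, ENNReal.ofReal (Real.exp (-B * r) *
          (2 / ε * ((2 * Real.pi * |(n : ℝ)|) ^ (2 * s) * ‖homCoeff (h r) n‖ ^ 2)))
          ∂timeMeasure T := by
  have hac := continuous_modeCoeff u n
  have hec : Continuous fun r : Icc (0 : ℝ) T => Real.exp (-B * r) := by fun_prop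
  have hmul : ∀ {g : Icc (0 : ℝ) T → ℝ}, Integrable g (timeMeasure T) →
      Integrable (fun t : Icc (0 : ℝ) T => Real.exp (-B * t) * g t) (timeMeasure T) := by
    intro g hg
    obtain ⟨B, hB⟩ := (isCompact_range hec).isBounded.exists_norm_le
    exact hg.bdd_mul hec.aestronglyMeasurable (Eventually.of_forall fun z => hB _ ⟨z, rfl⟩)
  have iG := integrable_modeDeriv hfc hC ε s u h n
  have iA : Integrable (fun r => ‖modeCoeff u n r‖ ^ 2) (timeMeasure T) :=
    integrable_of_continuous_timeMeasure (by fun_prop)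
  have iF := integrable_norm_sq_fluxCoeff hfc hC u n
  have iH := integrable_norm_sq_homCoeff h n
  have iR : Integrable (fun r => (conj (modeCoeff u n r) * modeDeriv ε s f u h n r).re)
      (timeMeasure T) := by
    have hcc : Continuous fun r => conj (modeCoeff u n r) := Complex.continuous_conj.comp hac
    obtain ⟨B', hB'⟩ := (isCompact_range hcc).isBounded.exists_norm_le
    exact (iG.bdd_mul hcc.aestronglyMeasurable (Eventually.of_forall fun z => hB' _ ⟨z, rfl⟩)).re
  have i1 := hmul (iA.const_mul (ε / 2 * (2 * Real.pi * |(n : ℝ)|) ^ (2 * s) + B))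
  have i2 := hmul ((iF.add iA).const_mul (2 * Real.pi * |(n : ℝ)|))
  have i3 := hmul (iH.const_mul (2 / ε))
  have i4 := hmul ((iR.const_mul 2).sub (iA.const_mul B))
  simp only [Pi.add_apply] at i2
  simp only [Pi.sub_apply] at i4
  have ident := exp_mul_norm_sq_eq hT.le hac iG (fun c t => hu.modeCoeff_eq hT hfc hC c n t) B t
  have hB0 : 0 ≤ ε / 2 * (2 * Real.pi * |(n : ℝ)|) ^ (2 * s) + B := by positivity
  rw [← ofReal_integral_eq_lintegral_ofReal i1.integrableOn
      (Eventually.of_forall fun r => by simp only [Pi.zero_apply]; positivity),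
    ← ofReal_integral_eq_lintegral_ofReal i2.integrableOn
      (Eventually.of_forall fun r => by simp only [Pi.zero_apply]; positivity),
    ← ofReal_integral_eq_lintegral_ofReal i3.integrableOn
      (Eventually.of_forall fun r => by simp only [Pi.zero_apply]; positivity),
    ← ENNReal.ofReal_add (by positivity) (integral_nonneg fun r => by positivity),
    ← ENNReal.ofReal_add (by positivity) (integral_nonneg fun r => by positivity),
    ← ENNReal.ofReal_add (add_nonneg (by positivity) (integral_nonneg fun r => by positivity))
      (integral_nonneg fun r => by positivity)]
  refine ENNReal.ofReal_le_ofReal ?_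
  rw [ident, add_assoc, add_assoc, ← integral_add i4.integrableOn i1.integrableOn,
    ← integral_add i2.integrableOn i3.integrableOn]
  refine add_le_add le_rfl (integral_mono (i4.add i1).integrableOn (i2.add i3).integrableOn
    fun r => ?_)
  have := two_re_modeDeriv_le hε s f u h n r
  beta_reduce
  rw [← mul_add, ← mul_add]
  refine mul_le_mul_of_nonneg_left ?_ (Real.exp_pos _).le
  linarith

/-- The weighted energy inequality: the transport term is bounded in `H_{1/2}` and absorbed by the
dissipation and the exponential weight. One half of the dissipation `ε/2` left by Young's inequality
is spent on the transport term, the other half remains on the left-hand side. -/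
theorem exists_energy_estimate [Fact (1 ≤ p)] (hT : 0 < T) (hf : LipschitzWith K f)
    (hC : ∀ x, |f x| ≤ C) {ε s : ℝ} (hε : 0 < ε) (hs : 1 / 2 < s) :
    ∃ B : ℝ, 0 ≤ B ∧ ∀ (u : StateSpace T p) (h : EnergySpace T s), IsControl T ε s p f u h →
      ∫⁻ t, energyDensity s u t ∂timeMeasure T ≠ ⊤ → ∀ t : Icc (0 : ℝ) T,
      (∑' n, ENNReal.ofReal (Real.exp (-B * t) * ‖modeCoeff u n t‖ ^ 2))
        + ∫⁻ r in Iic t, ENNReal.ofReal (Real.exp (-B * r) * (ε / 4)) * energyDensity s u r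
            ∂timeMeasure T
      ≤ (∑' n, ENNReal.ofReal (‖modeCoeff u n ⟨0, left_mem_Icc.2 hT.le⟩‖ ^ 2))
        + ENNReal.ofReal (2 / ε * ‖h‖ ^ 2) := by
  have hG := gagliardoConst_pos
  set D := 2 * Real.pi * (gagliardoConst * K ^ 2 + 1) with hD
  have hD0 : 0 ≤ D := by positivity
  obtain ⟨B, hB, hBn⟩ := exists_mul_abs_le_weight hs hD0 (show 0 < ε / 4 by positivity)
  refine ⟨B, hB, fun u h hu hfin t => ?_⟩
  have hac := fun n => (continuous_modeCoeff u n)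
  have hFm : ∀ n, AEMeasurable (fluxCoeff f u n) (timeMeasure T) := fun n =>
    (integrable_fluxCoeff hf.continuous hC u n).aemeasurable
  have hHm : ∀ n, AEMeasurable (fun r => homCoeff (h r) n) (timeMeasure T) := fun n =>
    (aestronglyMeasurable_homCoeff h n).aemeasurable
  -- mode by mode: `P` is the dissipation that is kept, `Q` what absorbs the transport term `N`, and
  -- `R` is the work of the control
  set P : ℤ → Icc (0 : ℝ) T → ℝ≥0∞ := fun n r => ENNReal.ofReal (Real.exp (-B * r) *
    (ε / 4 * (2 * Real.pi * |(n : ℝ)|) ^ (2 * s) * ‖modeCoeff u n r‖ ^ 2))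
  set Q : ℤ → Icc (0 : ℝ) T → ℝ≥0∞ := fun n r => ENNReal.ofReal (Real.exp (-B * r) *
    ((ε / 4 * (2 * Real.pi * |(n : ℝ)|) ^ (2 * s) + B) * ‖modeCoeff u n r‖ ^ 2))
  set N : ℤ → Icc (0 : ℝ) T → ℝ≥0∞ := fun n r => ENNReal.ofReal (Real.exp (-B * r) *
    (2 * Real.pi * |(n : ℝ)| * (‖fluxCoeff f u n r‖ ^ 2 + ‖modeCoeff u n r‖ ^ 2)))
  set R : ℤ → Icc (0 : ℝ) T → ℝ≥0∞ := fun n r => ENNReal.ofReal (Real.exp (-B * r) *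
    (2 / ε * ((2 * Real.pi * |(n : ℝ)|) ^ (2 * s) * ‖homCoeff (h r) n‖ ^ 2)))
  have mP : ∀ n, Measurable (P n) := fun n => by
    have := (hac n).measurable
    simp only [P]; fun_prop
  have mQ : ∀ n, Measurable (Q n) := fun n => by
    have := (hac n).measurable
    simp only [Q]; fun_prop
  have mN : ∀ n, AEMeasurable (N n) (timeMeasure T) := fun n => by
    have := (hac n).measurable
    have := hFm n
    simp only [N]; fun_prop
  have mR : ∀ n, AEMeasurable (R n) (timeMeasure T) := fun n => by
    have := hHm n
    simp only [R]; fun_prop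
  have hmode : ∀ n, ENNReal.ofReal (Real.exp (-B * t) * ‖modeCoeff u n t‖ ^ 2)
      + (∫⁻ r in Iic t, P n r ∂timeMeasure T) + ∫⁻ r in Iic t, Q n r ∂timeMeasure T
      ≤ ENNReal.ofReal (‖modeCoeff u n ⟨0, left_mem_Icc.2 hT.le⟩‖ ^ 2)
        + (∫⁻ r in Iic t, N n r ∂timeMeasure T) + ∫⁻ r in Iic t, R n r ∂timeMeasure T := by
    intro n
    refine le_trans (le_of_eq ?_) (hu.mode_energy hT hf.continuous hC hε hB n t)
    rw [add_assoc, ← lintegral_add_left (mP n)]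
    congr 2; ext r
    simp only [P, Q]
    rw [← ENNReal.ofReal_add (by positivity) (by positivity)]
    congr 1; ring
  have hsum := ENNReal.tsum_le_tsum hmode
  simp only [ENNReal.tsum_add] at hsum
  rw [← lintegral_tsum fun n => (mP n).aemeasurable, ← lintegral_tsum fun n => (mQ n).aemeasurable,
    ← lintegral_tsum fun n => (mN n).restrict, ← lintegral_tsum fun n => (mR n).restrict] at hsum
  have hsumP : ∀ r, ∑' n, P n r
      = ENNReal.ofReal (Real.exp (-B * r) * (ε / 4)) * energyDensity s u r := fun r => by
    rw [energyDensity, ← ENNReal.tsum_mul_left]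
    refine tsum_congr fun n => ?_
    rw [← ENNReal.ofReal_mul (by positivity)]
    simp only [P]; congr 1; ring
  have hNQ : ∫⁻ r in Iic t, ∑' n, N n r ∂timeMeasure T
      ≤ ∫⁻ r in Iic t, ∑' n, Q n r ∂timeMeasure T := by
    refine lintegral_mono_ae (ae_restrict_of_ae ?_)
    filter_upwards [tsum_fluxCoeff_le hf hC hs hfin] with r hr
    calc ∑' n, N n r = ENNReal.ofReal (Real.exp (-B * r) * (2 * Real.pi)) *
          ((∑' n : ℤ, ENNReal.ofReal (|(n : ℝ)| * ‖fluxCoeff f u n r‖ ^ 2))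
            + ∑' n : ℤ, ENNReal.ofReal (|(n : ℝ)| * ‖modeCoeff u n r‖ ^ 2)) := by
          rw [← ENNReal.tsum_add, ← ENNReal.tsum_mul_left]
          refine tsum_congr fun n => ?_
          rw [← ENNReal.ofReal_add (by positivity) (by positivity),
            ← ENNReal.ofReal_mul (by positivity)]
          simp only [N]; congr 1; ring
      _ ≤ ENNReal.ofReal (Real.exp (-B * r) * (2 * Real.pi)) *
          (ENNReal.ofReal (gagliardoConst * K ^ 2 + 1) *
            ∑' n : ℤ, ENNReal.ofReal (|(n : ℝ)| * ‖modeCoeff u n r‖ ^ 2)) := by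
          rw [ENNReal.ofReal_add (by positivity) zero_le_one, ENNReal.ofReal_one, add_mul, one_mul]
          gcongr
      _ = ∑' n : ℤ, ENNReal.ofReal (Real.exp (-B * r) *
            (D * |(n : ℝ)| * ‖modeCoeff u n r‖ ^ 2)) := by
          rw [← mul_assoc, ← ENNReal.ofReal_mul (by positivity), ← ENNReal.tsum_mul_left]
          refine tsum_congr fun n => ?_
          rw [← ENNReal.ofReal_mul (by positivity)]
          congr 1; rw [hD]; ring
      _ ≤ ∑' n, Q n r := by
          refine ENNReal.tsum_le_tsum fun n => ENNReal.ofReal_le_ofReal ?_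
          gcongr
          exact hBn n
  have hQfin : ∫⁻ r in Iic t, ∑' n, Q n r ∂timeMeasure T ≠ ⊤ := by
    have hle : ∀ r, ∑' n, Q n r ≤ ENNReal.ofReal (ε / 4 + B) * energyDensity s u r
        + ENNReal.ofReal (B * ‖modeCoeff u 0 r‖ ^ 2) := by
      intro r
      calc ∑' n, Q n r ≤ ∑' n : ℤ, (ENNReal.ofReal ((ε / 4 + B) *
            ((2 * Real.pi * |(n : ℝ)|) ^ (2 * s) * ‖modeCoeff u n r‖ ^ 2))
            + if n = 0 then ENNReal.ofReal (B * ‖modeCoeff u 0 r‖ ^ 2) else 0) := by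
            refine ENNReal.tsum_le_tsum fun n => ?_
            have hexp : Real.exp (-B * r) ≤ 1 := by
              rw [Real.exp_le_one_iff]; nlinarith [r.2.1]
            rcases eq_or_ne n 0 with rfl | hn
            · simp only [if_true, Q]
              rw [weight_zero hs, mul_zero, zero_add, zero_mul, mul_zero, ENNReal.ofReal_zero,
                zero_add]
              exact ENNReal.ofReal_le_ofReal (mul_le_of_le_one_left (by positivity) hexp)
            · simp only [hn, if_false, add_zero, Q]
              refine ENNReal.ofReal_le_ofReal
                ((mul_le_of_le_one_left (by positivity) hexp).trans ?_)
              rw [← mul_assoc]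
              gcongr
              rw [add_mul]
              gcongr
              exact le_mul_of_one_le_right hB (one_le_weight hs hn)
        _ = _ := by
            rw [ENNReal.tsum_add, tsum_ite_eq, energyDensity, ← ENNReal.tsum_mul_left]
            congr 1
            refine tsum_congr fun n => ?_
            rw [← ENNReal.ofReal_mul (by positivity)]
    refine ne_top_of_le_ne_top ?_ ((setLIntegral_le_lintegral _ _).trans (lintegral_mono hle))
    rw [lintegral_add_left ((measurable_energyDensity s u).const_mul _),
      lintegral_const_mul _ (measurable_energyDensity s u)]
    refine ENNReal.add_ne_top.2 ⟨ENNReal.mul_ne_top ENNReal.ofReal_ne_top hfin, ?_⟩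
    have : Integrable (fun r => B * ‖modeCoeff u 0 r‖ ^ 2) (timeMeasure T) :=
      integrable_of_continuous_timeMeasure (by have := hac 0; fun_prop)
    exact this.lintegral_lt_top.ne
  have hRle : ∫⁻ r in Iic t, ∑' n, R n r ∂timeMeasure T ≤ ENNReal.ofReal (2 / ε * ‖h‖ ^ 2) := by
    rw [ENNReal.ofReal_mul (by positivity), ← lintegral_tsum_homCoeff,
      ← lintegral_const_mul' _ _ ENNReal.ofReal_ne_top]
    refine (setLIntegral_le_lintegral _ _).trans (lintegral_mono fun r => ?_)
    rw [← ENNReal.tsum_mul_left]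
    refine ENNReal.tsum_le_tsum fun n => ?_
    rw [← ENNReal.ofReal_mul (by positivity)]
    refine ENNReal.ofReal_le_ofReal (mul_le_of_le_one_left (by positivity) ?_)
    rw [Real.exp_le_one_iff]; nlinarith [r.2.1]
  simp only [hsumP] at hsum
  -- the integral of `∑ Q` can be cancelled because it is finite, the energy being finite
  refine ENNReal.le_of_add_le_add_right hQfin (hsum.trans ?_)
  calc _ ≤ (∑' n, ENNReal.ofReal (‖modeCoeff u n ⟨0, left_mem_Icc.2 hT.le⟩‖ ^ 2))
        + (∫⁻ r in Iic t, ∑' n, Q n r ∂timeMeasure T) + ENNReal.ofReal (2 / ε * ‖h‖ ^ 2) := by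
        gcongr
    _ = _ := by ring

/-- The unweighted consequences of the energy inequality. -/
theorem exists_apriori_bound [Fact (1 ≤ p)] (hT : 0 < T) (hf : LipschitzWith K f)
    (hC : ∀ x, |f x| ≤ C) {ε s : ℝ} (hε : 0 < ε) (hs : 1 / 2 < s) (A H : ℝ) :
    ∃ M : ℝ, 0 ≤ M ∧ ∀ (u : StateSpace T p) (h : EnergySpace T s), IsControl T ε s p f u h →
      ∫⁻ t, energyDensity s u t ∂timeMeasure T ≠ ⊤ →
      ∑' n, ENNReal.ofReal (‖modeCoeff u n ⟨0, left_mem_Icc.2 hT.le⟩‖ ^ 2) ≤ ENNReal.ofReal A →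
      ‖h‖ ^ 2 ≤ H →
      (∀ t, ∑' n, ENNReal.ofReal (‖modeCoeff u n t‖ ^ 2) ≤ ENNReal.ofReal M) ∧
      ∫⁻ t, energyDensity s u t ∂timeMeasure T ≤ ENNReal.ofReal M := by
  obtain ⟨B, hB, hest⟩ := exists_energy_estimate (p := p) hT hf hC hε hs
  set M₀ := |A| + 2 / ε * |H|
  have hM₀ : 0 ≤ M₀ := by positivity
  set E := Real.exp (B * T)
  have hE : 0 < E := Real.exp_pos _
  refine ⟨E * M₀ + E * (4 / ε) * M₀, by positivity, fun u h hu hfin hA hH => ?_⟩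
  have h1 : ∀ t : Icc (0 : ℝ) T, (∑' n, ENNReal.ofReal (Real.exp (-B * t) * ‖modeCoeff u n t‖ ^ 2))
        + ∫⁻ r in Iic t, ENNReal.ofReal (Real.exp (-B * r) * (ε / 4)) * energyDensity s u r
            ∂timeMeasure T ≤ ENNReal.ofReal M₀ := fun t => by
    refine (hest u h hu hfin t).trans ((add_le_add hA le_rfl).trans ?_)
    rw [ENNReal.ofReal_add (by positivity) (by positivity)]
    refine add_le_add (ENNReal.ofReal_le_ofReal (le_abs_self _)) (ENNReal.ofReal_le_ofReal ?_)
    gcongr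
    exact hH.trans (le_abs_self _)
  have hexp : ∀ r : Icc (0 : ℝ) T, 1 ≤ E * Real.exp (-B * r) := fun r => by
    rw [← Real.exp_add, Real.one_le_exp_iff]; nlinarith [r.2.2]
  constructor
  · intro t
    calc ∑' n, ENNReal.ofReal (‖modeCoeff u n t‖ ^ 2)
        ≤ ∑' n, ENNReal.ofReal E * ENNReal.ofReal (Real.exp (-B * t) * ‖modeCoeff u n t‖ ^ 2) := by
          refine ENNReal.tsum_le_tsum fun n => ?_
          rw [← ENNReal.ofReal_mul hE.le, ← mul_assoc]
          exact ENNReal.ofReal_le_ofReal (le_mul_of_one_le_left (by positivity) (hexp t))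
      _ ≤ ENNReal.ofReal E * ENNReal.ofReal M₀ := by
          rw [ENNReal.tsum_mul_left]
          gcongr
          exact le_self_add.trans (h1 t)
      _ ≤ _ := by
          rw [← ENNReal.ofReal_mul hE.le]
          exact ENNReal.ofReal_le_ofReal (le_add_of_nonneg_right (by positivity))
  · have h2 := le_add_self.trans (h1 ⟨T, right_mem_Icc.2 hT.le⟩)
    have hu : Iic (⟨T, right_mem_Icc.2 hT.le⟩ : Icc (0 : ℝ) T) = univ := by
      ext r; exact ⟨fun _ => mem_univ _, fun _ => r.2.2⟩
    rw [hu, setLIntegral_univ] at h2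
    calc ∫⁻ t, energyDensity s u t ∂timeMeasure T
        ≤ ∫⁻ r, ENNReal.ofReal (E * (4 / ε)) * (ENNReal.ofReal (Real.exp (-B * r) * (ε / 4))
            * energyDensity s u r) ∂timeMeasure T := by
          refine lintegral_mono fun r => ?_
          rw [← mul_assoc, ← ENNReal.ofReal_mul (by positivity)]
          refine le_mul_of_one_le_left (zero_le) ?_
          rw [← ENNReal.ofReal_one]
          refine ENNReal.ofReal_le_ofReal ?_
          have := hexp r
          have e : E * (4 / ε) * (Real.exp (-B * r) * (ε / 4)) = E * Real.exp (-B * r) := by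
            field_simp
          rwa [e]
      _ ≤ ENNReal.ofReal (E * (4 / ε)) * ENNReal.ofReal M₀ := by
          rw [lintegral_const_mul' _ _ ENNReal.ofReal_ne_top]
          gcongr
      _ ≤ _ := by
          rw [← ENNReal.ofReal_mul (by positivity)]
          exact ENNReal.ofReal_le_ofReal (le_add_of_nonneg_left (by positivity))

/-- A controlled state of finite energy has Fourier modes whose suprema in time are
square-summable, by integrating the absolute energy production of each mode. -/
theorem IsControl.exists_summable_bound [Fact (1 ≤ p)] (hT : 0 < T) (hf : LipschitzWith K f)
    (hC : ∀ x, |f x| ≤ C) {ε s : ℝ} (hε : 0 < ε) (hs : 1 / 2 < s) {u : StateSpace T p}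
    {h : EnergySpace T s} (hu : IsControl T ε s p f u h)
    (hfin : ∫⁻ t, energyDensity s u t ∂timeMeasure T ≠ ⊤)
    (h0 : Summable fun n => ‖modeCoeff u n ⟨0, left_mem_Icc.2 hT.le⟩‖ ^ 2) :
    ∃ b : ℤ → ℝ, Summable b ∧ ∀ t n, ‖modeCoeff u n t‖ ^ 2 ≤ b n := by
  set S : ℤ → Icc (0 : ℝ) T → ℝ := fun n r =>
    2 * Real.pi * |(n : ℝ)| * (‖fluxCoeff f u n r‖ ^ 2 + ‖modeCoeff u n r‖ ^ 2)
        + (ε + 1) * ((2 * Real.pi * |(n : ℝ)|) ^ (2 * s) * ‖modeCoeff u n r‖ ^ 2)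
        + (2 * Real.pi * |(n : ℝ)|) ^ (2 * s) * ‖homCoeff (h r) n‖ ^ 2
  have iA : ∀ n, Integrable (fun r => ‖modeCoeff u n r‖ ^ 2) (timeMeasure T) := fun n =>
    integrable_of_continuous_timeMeasure (by have := continuous_modeCoeff u n; fun_prop)
  have iS : ∀ n, Integrable (S n) (timeMeasure T) := fun n =>
    ((((integrable_norm_sq_fluxCoeff hf.continuous hC u n).add (iA n)).const_mul _).add
      (((iA n).const_mul _).const_mul _)).add (integrable_norm_sq_homCoeff h n)
  have S0 : ∀ n r, 0 ≤ S n r := fun n r => by simp only [S]; positivity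
  have hG := gagliardoConst_pos
  have htop : ∑' n, ∫⁻ r, ENNReal.ofReal (S n r) ∂timeMeasure T ≠ ⊤ := by
    rw [← lintegral_tsum fun n => (iS n).aemeasurable.ennreal_ofReal]
    have hle : ∀ᵐ r ∂timeMeasure T, ∑' n, ENNReal.ofReal (S n r)
        ≤ ENNReal.ofReal (2 * Real.pi * (gagliardoConst * K ^ 2 + 1) + (ε + 1)) *
            energyDensity s u r + ∑' n : ℤ,
          ENNReal.ofReal ((2 * Real.pi * |(n : ℝ)|) ^ (2 * s) * ‖homCoeff (h r) n‖ ^ 2) := by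
      filter_upwards [tsum_fluxCoeff_le hf hC hs hfin] with r hr
      have e : ∑' n, ENNReal.ofReal (S n r) = ENNReal.ofReal (2 * Real.pi) *
          ((∑' n : ℤ, ENNReal.ofReal (|(n : ℝ)| * ‖fluxCoeff f u n r‖ ^ 2))
            + ∑' n : ℤ, ENNReal.ofReal (|(n : ℝ)| * ‖modeCoeff u n r‖ ^ 2))
          + ENNReal.ofReal (ε + 1) * energyDensity s u r
          + ∑' n : ℤ, ENNReal.ofReal ((2 * Real.pi * |(n : ℝ)|) ^ (2 * s) *
              ‖homCoeff (h r) n‖ ^ 2) := by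
        rw [energyDensity, ← ENNReal.tsum_add, ← ENNReal.tsum_mul_left, ← ENNReal.tsum_mul_left,
          ← ENNReal.tsum_add, ← ENNReal.tsum_add]
        refine tsum_congr fun n => ?_
        rw [← ENNReal.ofReal_add (by positivity) (by positivity),
          ← ENNReal.ofReal_mul (by positivity), ← ENNReal.ofReal_mul (by positivity),
          ← ENNReal.ofReal_add (by positivity) (by positivity),
          ← ENNReal.ofReal_add (by positivity) (by positivity)]
        simp only [S]; congr 1; ring
      rw [e]
      refine add_le_add ?_ le_rfl
      rw [ENNReal.ofReal_add (p := 2 * Real.pi * (gagliardoConst * K ^ 2 + 1)) (q := ε + 1)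
        (by positivity) (by positivity), add_mul,
        ENNReal.ofReal_mul (p := 2 * Real.pi) (by positivity), mul_assoc]
      gcongr
      rw [ENNReal.ofReal_add (by positivity) zero_le_one, ENNReal.ofReal_one, add_mul, one_mul]
      have hn : ∑' n : ℤ, ENNReal.ofReal (|(n : ℝ)| * ‖modeCoeff u n r‖ ^ 2)
          ≤ energyDensity s u r := by
        refine ENNReal.tsum_le_tsum fun n => ENNReal.ofReal_le_ofReal ?_
        gcongr
        exact abs_le_weight hs n
      refine add_le_add (hr.trans ?_) hn
      gcongr
    refine ne_top_of_le_ne_top ?_ (lintegral_mono_ae hle)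
    rw [lintegral_add_left ((measurable_energyDensity s u).const_mul _),
      lintegral_const_mul _ (measurable_energyDensity s u), lintegral_tsum_homCoeff]
    exact ENNReal.add_ne_top.2 ⟨ENNReal.mul_ne_top ENNReal.ofReal_ne_top hfin,
      ENNReal.ofReal_ne_top⟩
  refine ⟨fun n => ‖modeCoeff u n ⟨0, left_mem_Icc.2 hT.le⟩‖ ^ 2
    + (∫⁻ r, ENNReal.ofReal (S n r) ∂timeMeasure T).toReal,
    h0.add (ENNReal.summable_toReal htop), fun t n => ?_⟩
  have ident := exp_mul_norm_sq_eq hT.le (continuous_modeCoeff u n)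
    (integrable_modeDeriv hf.continuous hC ε s u h n)
    (fun c t => hu.modeCoeff_eq hT hf.continuous hC c n t) 0 t
  simp only [neg_zero, zero_mul, Real.exp_zero, one_mul, sub_zero] at ident
  rw [ident]
  refine add_le_add le_rfl ?_
  rw [← ofReal_integral_eq_lintegral_ofReal (iS n) (Eventually.of_forall (S0 n)),
    ENNReal.toReal_ofReal (integral_nonneg (S0 n))]
  refine (le_abs_self _).trans ?_
  refine (norm_integral_le_of_norm_le (iS n).integrableOn
    (Eventually.of_forall fun r =>
    (Real.norm_eq_abs _).le.trans (abs_two_re_modeDeriv_le hε s f u h n r))).trans ?_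
  exact setIntegral_le_integral (iS n) (Eventually.of_forall (S0 n))

end

/-! ### Closedness of the sublevel sets -/

/-- A bounded sequence in a Hilbert space converges weakly along any ultrafilter, by the
Banach–Alaoglu theorem. -/
theorem exists_weak_limit {E : Type*} [NormedAddCommGroup E] [InnerProductSpace ℝ E]
    [CompleteSpace E] {h : ℕ → E} {R : ℝ} (hR : ∀ j, ‖h j‖ ≤ R) (U : Ultrafilter ℕ) :
    ∃ k : E, ∀ θ : E, Tendsto (fun j => inner ℝ θ (h j)) U (𝓝 (inner ℝ θ k)) := by
  let x : ℕ → WeakDual ℝ E := fun j => StrongDual.toWeakDual (InnerProductSpace.toDual ℝ E (h j))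
  have hc := WeakDual.isCompact_closedBall (0 : StrongDual ℝ E) R
  have hle : (U.map x : Filter (WeakDual ℝ E))
      ≤ 𝓟 (WeakDual.toStrongDual ⁻¹' Metric.closedBall (0 : StrongDual ℝ E) R) := by
    rw [le_principal_iff, Ultrafilter.coe_map, mem_map]
    refine Filter.univ_mem' fun j => ?_
    change InnerProductSpace.toDual ℝ E (h j) ∈ Metric.closedBall (0 : StrongDual ℝ E) R
    rw [mem_closedBall_zero_iff, LinearIsometryEquiv.norm_map]
    exact hR j
  obtain ⟨l, -, hl⟩ := hc.ultrafilter_le_nhds _ hle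
  refine ⟨(InnerProductSpace.toDual ℝ E).symm (WeakDual.toStrongDual l), fun θ => ?_⟩
  have h1 : Tendsto x U (𝓝 l) := hl
  have h2 := ((WeakDual.eval_continuous θ).tendsto l).comp h1
  have e1 : ∀ j, inner ℝ θ (h j) = x j θ := fun j => by
    rw [real_inner_comm]; rfl
  have e2 : inner ℝ θ ((InnerProductSpace.toDual ℝ E).symm (WeakDual.toStrongDual l)) = l θ := by
    rw [real_inner_comm, InnerProductSpace.toDual_symm_apply]; rfl
  simp_rw [e1, e2]
  exact h2

/-- Weak lower semicontinuity of the norm, in the form needed when only upper bounds of the norms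
converge. -/
theorem norm_sq_le_of_weak_limit {E : Type*} [NormedAddCommGroup E] [InnerProductSpace ℝ E]
    {h : ℕ → E} {k : E} {U : Filter ℕ} [U.NeBot]
    (hk : Tendsto (fun j => inner ℝ k (h j)) U (𝓝 (inner ℝ k k))) {m : ℕ → ℝ} {m₀ : ℝ}
    (hm : Tendsto m U (𝓝 m₀)) (hle : ∀ j, ‖h j‖ ^ 2 ≤ m j) : ‖k‖ ^ 2 ≤ m₀ := by
  have h1 : ∀ j, 2 * inner ℝ k (h j) ≤ ‖k‖ ^ 2 + m j := fun j => by
    have := real_inner_le_norm k (h j)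
    nlinarith [hle j, sq_nonneg (‖k‖ - ‖h j‖)]
  have := le_of_tendsto_of_tendsto' (hk.const_mul 2) (tendsto_const_nhds.add hm) h1
  rw [real_inner_self_eq_norm_sq] at this
  linarith

section

variable {T : ℝ} {p : ℝ≥0∞} {f : ℝ → ℝ} {C : ℝ} {K : ℝ≥0}
  {u₀ : Lp ℝ 2 (volume : Measure UnitAddCircle)}

theorem MemL2Curve.modeCoeff_zero (hT : 0 ≤ T) {u : StateSpace T p} (hu : MemL2Curve T p u₀ u)
    (n : ℤ) : modeCoeff u n ⟨0, left_mem_Icc.2 hT⟩ = realCoeff u₀ n := by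
  obtain ⟨v, h1, h2⟩ := hu
  rw [modeCoeff, h1, h2 _ rfl]

/-- A bound on the cost yields controls that nearly obey it. The slack `δ` avoids an appeal to the
uniqueness of the control. -/
theorem exists_control_of_cost_le {ε s : ℝ} (hε : 0 < ε) {u : StateSpace T p} {M : ℝ≥0}
    (hu : costFunctional T ε s p f u₀ u ≤ M) :
    MemEnergy T s p u ∧ MemL2Curve T p u₀ u ∧
      ∀ δ : ℝ, 0 < δ → ∃ h : EnergySpace T s, IsControl T ε s p f u h ∧
        ‖h‖ ^ 2 ≤ 2 * ε * M + δ := by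
  rw [costFunctional] at hu
  split_ifs at hu with hc
  · refine ⟨hc.1, hc.2, fun δ hδ => ?_⟩
    have h1 : dualNormSq T s (transportResidual T ε s p f u) ≤ ENNReal.ofReal (2 * ε * M) := by
      have h2 := mul_le_mul_right hu (ENNReal.ofReal (2 * ε))
      rw [← mul_assoc, ← ENNReal.ofReal_mul (by positivity)] at h2
      have e : 2 * ε * (ε⁻¹ / 2) = 1 := by field_simp
      rw [e, ENNReal.ofReal_one, one_mul, ← ENNReal.ofReal_coe_nnreal,
        ← ENNReal.ofReal_mul (by positivity)] at h2
      exact h2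
    have h3 : dualNormSq T s (transportResidual T ε s p f u) < ENNReal.ofReal (2 * ε * M + δ) := by
      refine h1.trans_lt ((ENNReal.ofReal_lt_ofReal_iff (by positivity)).2 (by linarith))
    rw [dualNormSq] at h3
    simp only [iInf_lt_iff] at h3
    obtain ⟨h, hh, hlt⟩ := h3
    exact ⟨h, hh, ((ENNReal.ofReal_lt_ofReal_iff (by positivity)).1 hlt).le⟩
  · exact absurd hu (by simp)

theorem cost_le_of_control {ε s : ℝ} (hε : 0 < ε) {u : StateSpace T p} {M : ℝ≥0}
    (h1 : MemEnergy T s p u) (h2 : MemL2Curve T p u₀ u) {h : EnergySpace T s}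
    (hh : IsControl T ε s p f u h) (hn : ‖h‖ ^ 2 ≤ 2 * ε * M) :
    costFunctional T ε s p f u₀ u ≤ M := by
  rw [costFunctional, if_pos ⟨h1, h2⟩]
  have h3 : dualNormSq T s (transportResidual T ε s p f u) ≤ ENNReal.ofReal (2 * ε * M) :=
    (iInf₂_le h hh).trans (ENNReal.ofReal_le_ofReal hn)
  refine (mul_le_mul_right h3 _).trans ?_
  rw [← ENNReal.ofReal_mul (by positivity), ← ENNReal.ofReal_coe_nnreal]
  refine ENNReal.ofReal_le_ofReal (le_of_eq ?_)
  field_simp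

/-- Uniform bounds on a sublevel set of the cost. -/
theorem exists_sublevel_bound [Fact (1 ≤ p)] (hT : 0 < T) (hf : LipschitzWith K f)
    (hC : ∀ x, |f x| ≤ C) {ε s : ℝ} (hε : 0 < ε) (hs : 1 / 2 < s)
    (u₀ : Lp ℝ 2 (volume : Measure UnitAddCircle)) (M : ℝ≥0) :
    ∃ R : ℝ, 0 ≤ R ∧ ∀ u : StateSpace T p, costFunctional T ε s p f u₀ u ≤ M →
      (∀ t, ∑' n, ENNReal.ofReal (‖modeCoeff u n t‖ ^ 2) ≤ ENNReal.ofReal R) ∧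
      ∫⁻ t, energyDensity s u t ∂timeMeasure T ≤ ENNReal.ofReal R := by
  obtain ⟨R, hR, hb⟩ := exists_apriori_bound (p := p) hT hf hC hε hs
    (∑' n, ‖realCoeff u₀ n‖ ^ 2) (2 * ε * M + 1)
  refine ⟨R, hR, fun u hu => ?_⟩
  obtain ⟨h1, h2, h3⟩ := exists_control_of_cost_le hε hu
  obtain ⟨h, hh, hn⟩ := h3 1 one_pos
  refine hb u h hh (lintegral_energyDensity_ne_top hs h1) ?_ hn
  simp_rw [h2.modeCoeff_zero hT.le]
  rw [ENNReal.ofReal_tsum_of_nonneg (fun n => by positivity)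
    (summable_realCoeff_sq (Lp.memLp u₀))]

theorem continuous_modeCoeff_state [Fact (1 ≤ p)] (n : ℤ) (t : Icc (0 : ℝ) T) :
    Continuous fun u : StateSpace T p => modeCoeff u n t :=
  (continuous_sobolevCoeff n).comp ((continuous_eval_const t).comp
    (continuous_fst.comp continuous_subtype_val))

/-- The energy is lower semicontinuous under convergence of the Fourier modes. -/
theorem lintegral_energyDensity_le_of_tendsto {s : ℝ} {u : ℕ → StateSpace T p}
    {v : StateSpace T p}
    (hu : ∀ n t, Tendsto (fun j => modeCoeff (u j) n t) atTop (𝓝 (modeCoeff v n t))) {R : ℝ≥0∞}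
    (hR : ∀ j, ∫⁻ t, energyDensity s (u j) t ∂timeMeasure T ≤ R) :
    ∫⁻ t, energyDensity s v t ∂timeMeasure T ≤ R := by
  have h1 : ∀ t, energyDensity s v t ≤ liminf (fun j => energyDensity s (u j) t) atTop := by
    intro t
    have hlim : ∀ n : ℤ, liminf (fun j => ENNReal.ofReal ((2 * Real.pi * |(n : ℝ)|) ^ (2 * s) *
          ‖modeCoeff (u j) n t‖ ^ 2)) atTop
        = ENNReal.ofReal ((2 * Real.pi * |(n : ℝ)|) ^ (2 * s) * ‖modeCoeff v n t‖ ^ 2) := fun n =>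
      (ENNReal.tendsto_ofReal (((hu n t).norm.pow 2).const_mul _)).liminf_eq
    -- Fatou's lemma for the sum over the modes
    simp only [energyDensity, ← lintegral_count]
    simp_rw [← hlim]
    exact lintegral_liminf_le fun j => measurable_of_countable _
  calc _ ≤ ∫⁻ t, liminf (fun j => energyDensity s (u j) t) atTop ∂timeMeasure T :=
        lintegral_mono h1
    _ ≤ liminf (fun j => ∫⁻ t, energyDensity s (u j) t ∂timeMeasure T) atTop :=
        lintegral_liminf_le fun j => measurable_energyDensity s (u j)
    _ ≤ R := liminf_le_of_le (by isBoundedDefault) fun b hb => by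
        obtain ⟨j, hj⟩ := hb.exists
        exact hj.trans (hR j)

theorem memEnergy_of_lintegral_ne_top {s : ℝ} {u : StateSpace T p}
    (hu : ∫⁻ t, energyDensity s u t ∂timeMeasure T ≠ ⊤) : MemEnergy T s p u :=
  exists_energySpace_of_coeff (continuous_modeCoeff u)
    (fun n t => sobolevCoeff_neg_index (u.1.1 t) n) hu

/-- A controlled state of finite energy with initial datum `u₀` is a continuous curve in `L₂`. -/
theorem IsControl.memL2Curve [Fact (1 ≤ p)] (hT : 0 < T) (hf : LipschitzWith K f)
    (hC : ∀ x, |f x| ≤ C) {ε s : ℝ} (hε : 0 < ε) (hs : 1 / 2 < s) {u : StateSpace T p}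
    {h : EnergySpace T s} (hu : IsControl T ε s p f u h)
    (hfin : ∫⁻ t, energyDensity s u t ∂timeMeasure T ≠ ⊤)
    (h0 : ∀ n, modeCoeff u n ⟨0, left_mem_Icc.2 hT.le⟩ = realCoeff u₀ n) :
    MemL2Curve T p u₀ u := by
  obtain ⟨b, hb, hle⟩ := hu.exists_summable_bound hT hf hC hε hs hfin (by
    simp_rw [h0]; exact summable_realCoeff_sq (Lp.memLp u₀))
  let x : Icc (0 : ℝ) T → SeqSpace := fun t =>
    toSeq (fun n => modeCoeff u n t) (hb.of_nonneg_of_le (fun n => by positivity) (hle t))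
  have hx : Continuous x := continuous_seq_of_dominated (continuous_modeCoeff u) hb hle
  have hxc : ∀ t n, realCoeff (synthesis (x t)) n = modeCoeff u n t := fun t n =>
    realCoeff_synthesis (fun n => sobolevCoeff_neg_index (u.1.1 t) n) n
  refine ⟨⟨fun t => synthesis (x t), synthesis.continuous.comp hx⟩, fun t n => (hxc t n).symm,
    fun t ht => ?_⟩
  have ht' : t = ⟨0, left_mem_Icc.2 hT.le⟩ := Subtype.ext ht
  refine Lp_two_ext_of_realCoeff fun n => ?_
  rw [← h0, ← ht']
  exact hxc t n

theorem isClosed_sublevel [Fact (1 ≤ p)] (hT : 0 < T) (hf : LipschitzWith K f)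
    (hC : ∀ x, |f x| ≤ C) {ε s : ℝ} (hε : 0 < ε) (hs : 1 / 2 < s)
    (u₀ : Lp ℝ 2 (volume : Measure UnitAddCircle)) (M : ℝ≥0) :
    IsClosed {u : StateSpace T p | costFunctional T ε s p f u₀ u ≤ M} := by
  refine IsSeqClosed.isClosed fun u v hu huv => ?_
  obtain ⟨R, hR, hb⟩ := exists_sublevel_bound (p := p) hT hf hC hε hs u₀ M
  have hctl : ∀ j, ∃ h : EnergySpace T s, IsControl T ε s p f (u j) h ∧
      ‖h‖ ^ 2 ≤ 2 * ε * M + 1 / ((j : ℝ) + 1) := fun j =>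
    (exists_control_of_cost_le hε (hu j)).2.2 _ (by positivity)
  choose h hh hn using hctl
  have hmode : ∀ n t, Tendsto (fun j => modeCoeff (u j) n t) atTop (𝓝 (modeCoeff v n t)) :=
    fun n t => ((continuous_modeCoeff_state n t).tendsto v).comp huv
  have hfin : ∫⁻ t, energyDensity s v t ∂timeMeasure T ≠ ⊤ :=
    ne_top_of_le_ne_top ENNReal.ofReal_ne_top
      (lintegral_energyDensity_le_of_tendsto hmode fun j => (hb _ (hu j)).2)
  -- weak limits of the controls are taken along an ultrafilter, which spares the extraction of
  -- subsequences and any separability of the space of controls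
  let U := hyperfilter ℕ
  have hU : (U : Filter ℕ) ≤ atTop := by
    rw [← Nat.cofinite_eq_atTop]; exact hyperfilter_le_cofinite
  have hbd : ∀ j, ‖h j‖ ≤ 2 * ε * M + 2 := fun j => by
    have h1 : 1 / ((j : ℝ) + 1) ≤ 1 := by
      rw [div_le_one (by positivity)]; linarith [(Nat.cast_nonneg j : (0 : ℝ) ≤ j)]
    nlinarith [hn j, sq_nonneg (‖h j‖ - 1), norm_nonneg (h j)]
  obtain ⟨k, hk⟩ := exists_weak_limit (E := EnergySpace T s) hbd U
  have hkn : ‖k‖ ^ 2 ≤ 2 * ε * M := by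
    refine norm_sq_le_of_weak_limit (hk k) (m := fun j : ℕ => 2 * ε * M + 1 / ((j : ℝ) + 1)) ?_ hn
    have := (tendsto_one_div_add_atTop_nhds_zero_nat (𝕜 := ℝ)).const_add (2 * ε * M)
    rw [add_zero] at this
    exact this.mono_left hU
  have hctl : IsControl T ε s p f v k := by
    intro φ hφ
    obtain ⟨Θ, hΘ⟩ := hφ.exists_energySpace (s := s) (by linarith)
    rw [hΘ]
    have l1 : Tendsto (fun j => transportResidual T ε s p f (u j) φ) U
        (𝓝 (transportResidual T ε s p f v φ)) :=
      (((continuous_transportResidual (by linarith) hf hφ).tendsto v).comp huv).mono_left hU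
    refine tendsto_nhds_unique l1 ((hk Θ).congr fun j => ?_)
    rw [hh j φ hφ, hΘ]
  have h0 : ∀ n, modeCoeff v n ⟨0, left_mem_Icc.2 hT.le⟩ = realCoeff u₀ n := fun n => by
    refine tendsto_nhds_unique (hmode n _) (tendsto_const_nhds.congr fun j => ?_)
    exact ((exists_control_of_cost_le hε (hu j)).2.1.modeCoeff_zero hT.le n).symm
  exact cost_le_of_control hε (memEnergy_of_lintegral_ne_top hfin)
    (hctl.memL2Curve hT hf hC hε hs hfin h0) hctl hkn

end

/-! ### Completeness of the state space -/

theorem norm_sobolevCoeff_le {σ : ℝ} (g : Sobolev σ) (n : ℤ) :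
    ‖sobolevCoeff g n‖ ≤ (1 + (2 * Real.pi * n) ^ 2) ^ (-σ / 2) * ‖g‖ := by
  rw [sobolevCoeff, norm_mul, Complex.norm_real, Real.norm_of_nonneg (by positivity)]
  exact mul_le_mul_of_nonneg_left (lp.norm_apply_le_norm (by norm_num) (g : SeqSpace) n)
    (by positivity)

theorem integral_norm_realCoeff_sub_le {T : ℝ} {p : ℝ≥0∞} [Fact (1 ≤ p)]
    (v w : Lp ℝ p (spaceTimeMeasure T)) (n : ℤ) :
    ∫ t, ‖realCoeff (fun y => v (t, y)) n - realCoeff (fun y => w (t, y)) n‖ ∂timeMeasure T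
      ≤ ∫ z, |v z - w z| ∂spaceTimeMeasure T := by
  have hv : Integrable v ((timeMeasure T).prod (volume : Measure UnitAddCircle)) := integrable_Lp v
  have hw : Integrable w ((timeMeasure T).prod (volume : Measure UnitAddCircle)) := integrable_Lp w
  have e : ∫ z, |v z - w z| ∂spaceTimeMeasure T
      = ∫ t, ∫ y, |v (t, y) - w (t, y)| ∂(volume : Measure UnitAddCircle) ∂timeMeasure T :=
    integral_prod (fun z => |v z - w z|) (hv.sub hw).abs
  rw [e]
  refine integral_mono_ae ((integrable_realCoeff hv n).sub (integrable_realCoeff hw n)).norm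
    (hv.sub hw).abs.integral_prod_left ?_
  filter_upwards [hv.prod_right_ae, hw.prod_right_ae] with t h1 h2
  rw [← realCoeff_sub h1 h2]
  exact norm_realCoeff_le n

/-- The compatibility between the two components of a state is preserved under limits. -/
theorem isClosed_setOf_compatible (T : ℝ) (p : ℝ≥0∞) [Fact (1 ≤ p)] :
    IsClosed {u : C(Icc (0 : ℝ) T, Sobolev (-1)) × Lp ℝ p (spaceTimeMeasure T) |
      ∀ᵐ t ∂timeMeasure T, ∀ n : ℤ,
        sobolevCoeff (u.1 t) n = realCoeff (fun y => u.2 (t, y)) n} := by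
  refine IsSeqClosed.isClosed fun u v hu huv => ?_
  rw [mem_ofPred_eq, ae_all_iff]
  intro n
  obtain ⟨C, hC0, hC⟩ := exists_integral_abs_sub_le (spaceTimeMeasure T) p
  have hc : ∀ x : C(Icc (0 : ℝ) T, Sobolev (-1)),
      Integrable (fun t => sobolevCoeff (x t) n) (timeMeasure T) := fun x =>
    integrable_of_continuous_timeMeasure ((continuous_sobolevCoeff n).comp x.continuous)
  have hr : ∀ w : Lp ℝ p (spaceTimeMeasure T),
      Integrable (fun t => realCoeff (fun y => w (t, y)) n) (timeMeasure T) := fun w =>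
    integrable_realCoeff (integrable_Lp w) n
  set c : ℝ := (1 + (2 * Real.pi * n) ^ 2) ^ (-(-1 : ℝ) / 2)
  -- the `n`-th coefficients of both components of `u j` agree, and both depend continuously on the
  -- state in `L₁([0,T])`
  have key : ∀ j, ∫ t, ‖sobolevCoeff (v.1 t) n - realCoeff (fun y => v.2 (t, y)) n‖
      ∂timeMeasure T ≤ c * dist (u j) v * (timeMeasure T).real univ + C * dist (u j) v := by
    intro j
    have h1 : ∫ t, ‖sobolevCoeff (v.1 t) n - sobolevCoeff ((u j).1 t) n‖ ∂timeMeasure T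
        ≤ c * dist (u j) v * (timeMeasure T).real univ := by
      rw [mul_comm _ ((timeMeasure T).real univ), ← smul_eq_mul, ← integral_const]
      refine integral_mono ((hc _).sub (hc _)).norm (integrable_const _) fun t => ?_
      simp only
      rw [← sobolevCoeff_sub]
      refine (norm_sobolevCoeff_le _ n).trans (mul_le_mul_of_nonneg_left ?_ (by positivity))
      rw [← dist_eq_norm, dist_comm]
      exact ((u j).1.dist_apply_le_dist t).trans (le_max_left _ _)
    have h2 : ∫ t, ‖realCoeff (fun y => (u j).2 (t, y)) n - realCoeff (fun y => v.2 (t, y)) n‖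
        ∂timeMeasure T ≤ C * dist (u j) v := by
      refine (integral_norm_realCoeff_sub_le _ _ n).trans ((hC _ _).trans
        (mul_le_mul_of_nonneg_left ?_ hC0))
      rw [← dist_eq_norm]
      exact le_max_right _ _
    refine le_trans ?_ (add_le_add h1 h2)
    have i1 : Integrable (fun t => ‖sobolevCoeff (v.1 t) n - sobolevCoeff ((u j).1 t) n‖)
        (timeMeasure T) := ((hc _).sub (hc _)).norm
    have i2 : Integrable (fun t => ‖realCoeff (fun y => (u j).2 (t, y)) n -
        realCoeff (fun y => v.2 (t, y)) n‖) (timeMeasure T) := ((hr _).sub (hr _)).norm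
    rw [← integral_add i1 i2]
    refine integral_mono_ae ((hc _).sub (hr _)).norm (i1.add i2) ?_
    filter_upwards [hu j] with t ht
    rw [ht n]
    exact norm_sub_le_norm_sub_add_norm_sub _ _ _
  have h0 : Tendsto (fun j => c * dist (u j) v * (timeMeasure T).real univ + C * dist (u j) v)
      atTop (𝓝 0) := by
    have := tendsto_iff_dist_tendsto_zero.1 huv
    have h := ((this.const_mul c).mul_const ((timeMeasure T).real univ)).add (this.const_mul C)
    simpa using h
  have h1 := ge_of_tendsto' h0 key
  have h2 := (integral_eq_zero_iff_of_nonneg (fun t => norm_nonneg _)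
    ((hc v.1).sub (hr v.2)).norm).1
    (le_antisymm h1 (integral_nonneg fun t => norm_nonneg _))
  filter_upwards [h2] with t ht
  exact sub_eq_zero.1 (norm_eq_zero.1 ht)

instance completeSpace_stateSpace (T : ℝ) (p : ℝ≥0∞) [Fact (1 ≤ p)] :
    CompleteSpace (StateSpace T p) :=
  (isClosed_setOf_compatible T p).completeSpace_coe

/-! ### Equicontinuity of the Fourier modes -/

/-- The Arzelà–Ascoli theorem for a family with common bound and modulus of continuity. -/
theorem isCompact_setOf_modulus {X : Type*} [PseudoMetricSpace X] [CompactSpace X] (ρ : ℝ)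
    (L : ℝ → ℝ) :
    IsCompact {a : C(X, ℂ) | (∀ t, ‖a t‖ ≤ ρ) ∧
      ∀ η, 0 < η → ∀ r t, ‖a t - a r‖ ≤ L η * dist r t + η} := by
  have hcont : ∀ (ι : Type _) (F : ι → X → ℂ),
      (∀ i η, 0 < η → ∀ r t, ‖F i t - F i r‖ ≤ L η * dist r t + η) → Equicontinuous F := by
    intro ι F hF
    refine UniformEquicontinuous.equicontinuous (Metric.uniformEquicontinuous_iff.2 fun e he => ?_)
    refine ⟨e / 2 / (|L (e / 2)| + 1), by positivity, fun r t hrt i => ?_⟩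
    rw [lt_div_iff₀ (by positivity)] at hrt
    rw [dist_comm, dist_eq_norm]
    have h1 := hF i (e / 2) (by positivity) r t
    have h2 := mul_le_mul_of_nonneg_right (le_abs_self (L (e / 2))) (dist_nonneg (x := r) (y := t))
    nlinarith [dist_nonneg (x := r) (y := t)]
  refine ArzelaAscoli.isCompact_of_equicontinuous _ ?_ (hcont _ _ fun i => i.2.2)
  have himg : ContinuousMap.toFun '' {a : C(X, ℂ) | (∀ t, ‖a t‖ ≤ ρ) ∧
      ∀ η, 0 < η → ∀ r t, ‖a t - a r‖ ≤ L η * dist r t + η}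
      = (univ.pi fun _ => Metric.closedBall (0 : ℂ) ρ) ∩
        {a | ∀ η, 0 < η → ∀ r t, ‖a t - a r‖ ≤ L η * dist r t + η} := by
    ext a
    constructor
    · rintro ⟨b, hb, rfl⟩
      exact ⟨fun t _ => mem_closedBall_zero_iff.2 (hb.1 t), hb.2⟩
    · rintro ⟨h1, h2⟩
      have hc : Continuous a := (hcont PUnit (fun _ => a) fun _ => h2).continuous PUnit.unit
      exact ⟨⟨a, hc⟩, ⟨fun t => mem_closedBall_zero_iff.1 (h1 t trivial), h2⟩, rfl⟩
  rw [himg]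
  refine (isCompact_univ_pi fun _ => isCompact_closedBall _ _).inter_right ?_
  simp only [ofPred_forall]
  exact isClosed_iInter fun η => isClosed_iInter fun _ => isClosed_iInter fun r =>
    isClosed_iInter fun t => isClosed_le ((continuous_apply t).sub (continuous_apply r)).norm
      continuous_const

theorem timeMeasure_Ioc_le {T : ℝ} (r t : Icc (0 : ℝ) T) :
    (timeMeasure T).real (Ioc r t) ≤ dist r t := by
  rw [measureReal_def, timeMeasure, comap_subtype_coe_apply measurableSet_Icc]
  refine ENNReal.toReal_le_of_le_ofReal dist_nonneg ?_
  calc volume (Subtype.val '' Ioc r t) ≤ volume (Ioc (r : ℝ) t) :=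
        measure_mono (image_subset_iff.2 fun x hx => ⟨hx.1, hx.2⟩)
    _ = ENNReal.ofReal (t - r) := Real.volume_Ioc
    _ ≤ ENNReal.ofReal (dist r t) := by
        refine ENNReal.ofReal_le_ofReal ?_
        rw [dist_comm]
        exact le_abs_self _

section

variable {T : ℝ} {p : ℝ≥0∞} {f : ℝ → ℝ} {C : ℝ} {K : ℝ≥0}
  {u₀ : Lp ℝ 2 (volume : Measure UnitAddCircle)}

theorem integral_norm_sq_homCoeff_le {s : ℝ} (h : EnergySpace T s) (n : ℤ) :
    ∫ t, (2 * Real.pi * |(n : ℝ)|) ^ (2 * s) * ‖homCoeff (h t) n‖ ^ 2 ∂timeMeasure T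
      ≤ ‖h‖ ^ 2 := by
  rw [← ENNReal.ofReal_le_ofReal_iff (by positivity), ofReal_integral_eq_lintegral_ofReal
    (integrable_norm_sq_homCoeff h n) (Eventually.of_forall fun t => by
      simp only [Pi.zero_apply]; positivity), ← lintegral_tsum_homCoeff]
  exact lintegral_mono fun t => ENNReal.le_tsum n

/-- The control enters linearly and is only square integrable in time; splitting
`|ĥₙ| ≤ 1/η + η |ĥₙ|²` leaves a small multiple of its norm instead of a square root in time. -/
theorem norm_modeDeriv_le {ε s : ℝ} (hε : 0 < ε) (hC : ∀ x, |f x| ≤ C) (u : StateSpace T p)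
    (h : EnergySpace T s) (n : ℤ) (t : Icc (0 : ℝ) T) {R η : ℝ} (hR : ‖modeCoeff u n t‖ ≤ R)
    (hη : 0 < η) :
    ‖modeDeriv ε s f u h n t‖ ≤ (2 * Real.pi * |(n : ℝ)| * C
        + ε / 2 * (2 * Real.pi * |(n : ℝ)|) ^ (2 * s) * R
        + (2 * Real.pi * |(n : ℝ)|) ^ (2 * s) / η)
      + η * ((2 * Real.pi * |(n : ℝ)|) ^ (2 * s) * ‖homCoeff (h t) n‖ ^ 2) := by
  set w := (2 * Real.pi * |(n : ℝ)|) ^ (2 * s) with hw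
  have hw0 : 0 ≤ w := by positivity
  have e1 : ‖-2 * Real.pi * Complex.I * n * fluxCoeff f u n t‖ ≤ 2 * Real.pi * |(n : ℝ)| * C := by
    have : ‖(-2 * Real.pi * Complex.I * n : ℂ)‖ = 2 * Real.pi * |(n : ℝ)| := by
      simp [abs_of_pos Real.pi_pos]
    rw [norm_mul, this]
    exact mul_le_mul_of_nonneg_left (norm_fluxCoeff_le hC u n t) (by positivity)
  have e2 : ‖((ε / 2 * w : ℝ) : ℂ) * modeCoeff u n t‖ ≤ ε / 2 * w * R := by
    rw [norm_mul, Complex.norm_real, Real.norm_of_nonneg (by positivity)]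
    exact mul_le_mul_of_nonneg_left hR (by positivity)
  have e3 : ‖(w : ℂ) * homCoeff (h t) n‖ ≤ w / η + η * (w * ‖homCoeff (h t) n‖ ^ 2) := by
    rw [norm_mul, Complex.norm_real, Real.norm_of_nonneg hw0]
    set x := ‖homCoeff (h t) n‖
    have hx : x ≤ 1 / η + η * x ^ 2 := by
      rw [← sub_nonneg]
      have : 1 / η + η * x ^ 2 - x = ((η * x - 1 / 2) ^ 2 + 3 / 4) / η := by field_simp; ring
      rw [this]; positivity
    calc w * x ≤ w * (1 / η + η * x ^ 2) := mul_le_mul_of_nonneg_left hx hw0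
      _ = _ := by ring
  rw [modeDeriv, ← hw]
  calc _ ≤ 2 * Real.pi * |(n : ℝ)| * C + ε / 2 * w * R
        + (w / η + η * (w * ‖homCoeff (h t) n‖ ^ 2)) :=
        (norm_add_le _ _).trans (add_le_add ((norm_sub_le _ _).trans (add_le_add e1 e2)) e3)
    _ = _ := by ring

/-- The modulus of continuity of a single mode, uniform over controls of bounded norm. -/
theorem IsControl.norm_modeCoeff_sub_le [Fact (1 ≤ p)] (hT : 0 < T) (hfc : Continuous f)
    (hC : ∀ x, |f x| ≤ C) {ε s : ℝ} (hε : 0 < ε) {u : StateSpace T p} {h : EnergySpace T s}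
    (hu : IsControl T ε s p f u h) {n : ℤ} {R η : ℝ} (hR : ∀ t, ‖modeCoeff u n t‖ ≤ R)
    (hη : 0 < η) (r t : Icc (0 : ℝ) T) :
    ‖modeCoeff u n t - modeCoeff u n r‖ ≤ (2 * Real.pi * |(n : ℝ)| * C
        + ε / 2 * (2 * Real.pi * |(n : ℝ)|) ^ (2 * s) * R
        + (2 * Real.pi * |(n : ℝ)|) ^ (2 * s) / η) * dist r t + η * ‖h‖ ^ 2 := by
  wlog hrt : r ≤ t generalizing r t
  · rw [norm_sub_rev, dist_comm]
    exact this t r (le_of_not_ge hrt)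
  set A := 2 * Real.pi * |(n : ℝ)| * C + ε / 2 * (2 * Real.pi * |(n : ℝ)|) ^ (2 * s) * R
        + (2 * Real.pi * |(n : ℝ)|) ^ (2 * s) / η
  have hA0 : 0 ≤ A := by
    have hC0 : 0 ≤ C := (abs_nonneg _).trans (hC 0)
    have hR0 : 0 ≤ R := (norm_nonneg _).trans (hR t)
    positivity
  set G := modeDeriv ε s f u h n
  have iG : Integrable G (timeMeasure T) := integrable_modeDeriv hfc hC ε s u h n
  have iH := integrable_norm_sq_homCoeff h n
  have iAH : Integrable (fun x => A + η * ((2 * Real.pi * |(n : ℝ)|) ^ (2 * s) *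
      ‖homCoeff (h x) n‖ ^ 2)) (timeMeasure T) := (integrable_const A).add (iH.const_mul η)
  have hint : ∫ x in Ioc r t, ‖G x‖ ∂timeMeasure T ≤ A * dist r t + η * ‖h‖ ^ 2 := by
    calc _ ≤ ∫ x in Ioc r t, (A + η * ((2 * Real.pi * |(n : ℝ)|) ^ (2 * s) *
            ‖homCoeff (h x) n‖ ^ 2)) ∂timeMeasure T :=
          integral_mono iG.norm.integrableOn iAH.integrableOn
            fun x => norm_modeDeriv_le hε hC u h n x (hR x) hη
      _ = (timeMeasure T).real (Ioc r t) * A + η * ∫ x in Ioc r t,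
            (2 * Real.pi * |(n : ℝ)|) ^ (2 * s) * ‖homCoeff (h x) n‖ ^ 2 ∂timeMeasure T := by
          rw [integral_add (integrable_const A) (iH.const_mul η).integrableOn, setIntegral_const,
            smul_eq_mul, integral_const_mul]
      _ ≤ dist r t * A + η * ‖h‖ ^ 2 := by
          refine add_le_add (mul_le_mul_of_nonneg_right (timeMeasure_Ioc_le r t) hA0)
            (mul_le_mul_of_nonneg_left ?_ hη.le)
          exact (setIntegral_le_integral iH (Eventually.of_forall fun x => by
            simp only [Pi.zero_apply]; positivity)).trans (integral_norm_sq_homCoeff_le h n)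
      _ = _ := by ring
  refine le_trans ?_ hint
  set z := modeCoeff u n t - modeCoeff u n r with hz
  have icG : Integrable (fun x => (conj z * G x).re) (timeMeasure T) := (iG.const_mul _).re
  -- the increment `z` is tested against itself: `Re (conj z * z) = ‖z‖²`
  have e1 : ‖z‖ ^ 2 = ∫ x in Ioc r t, (conj z * G x).re ∂timeMeasure T := by
    have e2 : ‖z‖ ^ 2 = (conj z * modeCoeff u n t).re - (conj z * modeCoeff u n r).re := by
      rw [← Complex.sub_re, ← mul_sub, ← hz, ← Complex.normSq_eq_conj_mul_self, Complex.ofReal_re,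
        Complex.normSq_eq_norm_sq]
    rw [e2, hu.modeCoeff_eq hT hfc hC (conj z) n t, hu.modeCoeff_eq hT hfc hC (conj z) n r,
      ← Iic_union_Ioc_eq_Iic hrt, setIntegral_union (Iic_disjoint_Ioc le_rfl) measurableSet_Ioc
        icG.integrableOn icG.integrableOn]
    ring
  have e3 : ‖z‖ ^ 2 ≤ ‖z‖ * ∫ x in Ioc r t, ‖G x‖ ∂timeMeasure T := by
    rw [e1, ← integral_const_mul]
    refine integral_mono icG.integrableOn (iG.norm.const_mul _).integrableOn fun x => ?_
    calc (conj z * G x).re ≤ ‖conj z * G x‖ := Complex.re_le_norm _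
      _ = ‖z‖ * ‖G x‖ := by rw [norm_mul, Complex.norm_conj]
  rcases (norm_nonneg z).eq_or_lt with h0 | h0
  · rw [← h0]; exact integral_nonneg fun x => norm_nonneg _
  · rw [sq] at e3
    exact le_of_mul_le_mul_left e3 h0

/-- A Fourier mode of a state as a continuous function of time. -/
def modeMap (u : StateSpace T p) (n : ℤ) : C(Icc (0 : ℝ) T, ℂ) :=
  ⟨modeCoeff u n, continuous_modeCoeff u n⟩

/-- On a sublevel set of the cost each Fourier mode ranges in a compact set of curves. -/
theorem exists_isCompact_modeMap [Fact (1 ≤ p)] (hT : 0 < T) (hf : LipschitzWith K f)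
    (hC : ∀ x, |f x| ≤ C) {ε s : ℝ} (hε : 0 < ε) (hs : 1 / 2 < s)
    (u₀ : Lp ℝ 2 (volume : Measure UnitAddCircle)) (M : ℝ≥0) (n : ℤ) :
    ∃ A : Set C(Icc (0 : ℝ) T, ℂ), IsCompact A ∧
      ∀ u : StateSpace T p, costFunctional T ε s p f u₀ u ≤ M → modeMap u n ∈ A := by
  obtain ⟨R, hR, hb⟩ := exists_sublevel_bound (p := p) hT hf hC hε hs u₀ M
  set H : ℝ := 2 * ε * M + 1
  have hH0 : 0 < H := by positivity
  refine ⟨_, isCompact_setOf_modulus (R + 1) fun η => 2 * Real.pi * |(n : ℝ)| * C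
        + ε / 2 * (2 * Real.pi * |(n : ℝ)|) ^ (2 * s) * (R + 1)
        + (2 * Real.pi * |(n : ℝ)|) ^ (2 * s) / (η / H), fun u hu => ?_⟩
  obtain ⟨-, -, h3⟩ := exists_control_of_cost_le hε hu
  obtain ⟨h, hh, hn⟩ := h3 1 one_pos
  have hbd : ∀ t, ‖modeCoeff u n t‖ ≤ R + 1 := fun t => by
    have h1 := (ENNReal.le_tsum n).trans ((hb u hu).1 t)
    rw [ENNReal.ofReal_le_ofReal_iff hR] at h1
    nlinarith [sq_nonneg (‖modeCoeff u n t‖ - 1), norm_nonneg (modeCoeff u n t)]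
  refine ⟨hbd, fun η hη r t => ?_⟩
  refine (hh.norm_modeCoeff_sub_le hT hf.continuous hC hε hbd (η := η / H) (by positivity)
    r t).trans (add_le_add le_rfl ?_)
  rw [div_mul_eq_mul_div, div_le_iff₀ hH0]
  exact mul_le_mul_of_nonneg_left hn hη.le

end

/-! ### Compactness of the sublevel sets -/

/-- Splitting of a series into finitely many low modes and a tail with a small factor. -/
theorem tsum_le_sum_add_mul_tsum {ι : Type*} (S : Finset ι) {c d e : ι → ℝ≥0∞} {κ : ℝ≥0∞}
    (h1 : ∀ n ∈ S, c n ≤ d n) (h2 : ∀ n ∉ S, c n ≤ κ * e n) :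
    ∑' n, c n ≤ ∑ n ∈ S, d n + κ * ∑' n, e n := by
  classical
  calc ∑' n, c n ≤ ∑' n, ((if n ∈ S then d n else 0) + κ * e n) := by
        refine ENNReal.tsum_le_tsum fun n => ?_
        split_ifs with hn
        · exact (h1 n hn).trans le_self_add
        · rw [zero_add]; exact h2 n hn
    _ = _ := by
        rw [ENNReal.tsum_add, ENNReal.tsum_mul_left, tsum_eq_sum (s := S) fun n hn => if_neg hn]
        congr 1
        exact Finset.sum_congr rfl fun n hn => if_pos hn

theorem norm_sub_sq_le (a b : ℂ) : ‖a - b‖ ^ 2 ≤ 2 * ‖a‖ ^ 2 + 2 * ‖b‖ ^ 2 := by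
  have := norm_sub_le a b
  nlinarith [norm_nonneg (a - b), sq_nonneg (‖a‖ - ‖b‖)]

theorem lt_abs_of_notMem_Icc {N : ℕ} {n : ℤ} (hn : n ∉ Finset.Icc (-(N : ℤ)) N) :
    (N : ℝ) < |(n : ℝ)| := by
  have : (N : ℤ) < |n| := by
    by_contra hc
    exact hn (Finset.mem_Icc.2 (abs_le.1 (not_lt.1 hc)))
  exact_mod_cast this

section

variable {T : ℝ} {p : ℝ≥0∞} {f : ℝ → ℝ} {C : ℝ} {K : ℝ≥0}
  {u₀ : Lp ℝ 2 (volume : Measure UnitAddCircle)}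

/-- The squared distance between the Fourier modes `|n| ≤ N` of two states, in the supremum norm in
time. -/
def lowDist (N : ℕ) (u v : StateSpace T p) : ℝ :=
  ∑ n ∈ Finset.Icc (-(N : ℤ)) N, ‖modeMap u n - modeMap v n‖ ^ 2

theorem lowDist_nonneg (N : ℕ) (u v : StateSpace T p) : 0 ≤ lowDist N u v :=
  Finset.sum_nonneg fun n _ => by positivity

theorem ofReal_lowDist (N : ℕ) (u v : StateSpace T p) :
    ENNReal.ofReal (lowDist N u v)
      = ∑ n ∈ Finset.Icc (-(N : ℤ)) N, ENNReal.ofReal (‖modeMap u n - modeMap v n‖ ^ 2) :=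
  ENNReal.ofReal_sum_of_nonneg fun n _ => by positivity

theorem norm_modeCoeff_sub_le_norm (u v : StateSpace T p) (n : ℤ) (t : Icc (0 : ℝ) T) :
    ‖modeCoeff u n t - modeCoeff v n t‖ ≤ ‖modeMap u n - modeMap v n‖ :=
  (modeMap u n - modeMap v n).norm_coe_le_norm t

/-- Bounds in `L₂` control the high modes in `H_{-1}`. -/
theorem dist_fst_sq_le {R : ℝ} (hR : 0 ≤ R) {u v : StateSpace T p}
    (hu : ∀ t, ∑' n, ENNReal.ofReal (‖modeCoeff u n t‖ ^ 2) ≤ ENNReal.ofReal R)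
    (hv : ∀ t, ∑' n, ENNReal.ofReal (‖modeCoeff v n t‖ ^ 2) ≤ ENNReal.ofReal R)
    {N : ℕ} (hN : 0 < N) :
    dist u.1.1 v.1.1 ^ 2 ≤ lowDist N u v + 4 * R / N := by
  have hNR : (1 : ℝ) ≤ N := by exact_mod_cast hN
  have hD := lowDist_nonneg N u v
  have hpos : 0 ≤ lowDist N u v + 4 * R / N := by positivity
  rw [← Real.le_sqrt dist_nonneg hpos, ContinuousMap.dist_le (Real.sqrt_nonneg _)]
  intro t
  rw [Real.le_sqrt dist_nonneg hpos, dist_eq_norm, ← ENNReal.ofReal_le_ofReal_iff hpos]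
  have e1 : ENNReal.ofReal (‖u.1.1 t - v.1.1 t‖ ^ 2)
      = ∑' n, ENNReal.ofReal (‖((u.1.1 t - v.1.1 t : Sobolev (-1)) : SeqSpace) n‖ ^ 2) :=
    (tsum_ofReal_norm_sq _).symm
  rw [e1]
  have hw : ∀ n : ℤ, ‖((u.1.1 t - v.1.1 t : Sobolev (-1)) : SeqSpace) n‖ ^ 2
      = (1 + (2 * Real.pi * n) ^ 2)⁻¹ * ‖modeCoeff u n t - modeCoeff v n t‖ ^ 2 := fun n => by
    rw [norm_sq_eq_sobolevCoeff, sobolevCoeff_sub, Real.rpow_neg_one]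
    rfl
  refine (tsum_le_sum_add_mul_tsum (Finset.Icc (-(N : ℤ)) N)
    (d := fun n => ENNReal.ofReal (‖modeMap u n - modeMap v n‖ ^ 2))
    (e := fun n => ENNReal.ofReal 2 * ENNReal.ofReal (‖modeCoeff u n t‖ ^ 2)
      + ENNReal.ofReal 2 * ENNReal.ofReal (‖modeCoeff v n t‖ ^ 2))
    (κ := ENNReal.ofReal (1 / N)) (fun n _ => ENNReal.ofReal_le_ofReal ?_) fun n hn => ?_).trans ?_
  · rw [hw]
    have h1 : (1 + (2 * Real.pi * (n : ℝ)) ^ 2)⁻¹ ≤ 1 :=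
      inv_le_one_of_one_le₀ (by nlinarith [sq_nonneg (2 * Real.pi * (n : ℝ))])
    calc _ ≤ 1 * ‖modeCoeff u n t - modeCoeff v n t‖ ^ 2 := by gcongr
      _ ≤ _ := by rw [one_mul]; gcongr; exact norm_modeCoeff_sub_le_norm u v n t
  · rw [hw, ← ENNReal.ofReal_mul (by norm_num), ← ENNReal.ofReal_mul (by norm_num),
      ← ENNReal.ofReal_add (by positivity) (by positivity), ← ENNReal.ofReal_mul (by positivity)]
    refine ENNReal.ofReal_le_ofReal (mul_le_mul ?_ (norm_sub_sq_le _ _) (by positivity)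
      (by positivity))
    rw [← one_div]
    refine one_div_le_one_div_of_le (by positivity) ?_
    have h1 := lt_abs_of_notMem_Icc hn
    have h2 : (N : ℝ) ≤ (n : ℝ) ^ 2 := by rw [← sq_abs]; nlinarith
    have h3 : 1 ≤ (2 * Real.pi) ^ 2 := by nlinarith [Real.pi_gt_three]
    nlinarith [sq_nonneg (n : ℝ)]
  · rw [ENNReal.tsum_add, ENNReal.tsum_mul_left, ENNReal.tsum_mul_left, ← ofReal_lowDist,
      ENNReal.ofReal_add hD (by positivity)]
    refine add_le_add le_rfl ?_
    calc _ ≤ ENNReal.ofReal (1 / N) * (ENNReal.ofReal 2 * ENNReal.ofReal R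
          + ENNReal.ofReal 2 * ENNReal.ofReal R) := by gcongr <;> [exact hu t; exact hv t]
      _ = ENNReal.ofReal (4 * R / N) := by
          rw [← ENNReal.ofReal_mul (by norm_num), ← ENNReal.ofReal_add (by positivity)
            (by positivity), ← ENNReal.ofReal_mul (by positivity)]
          congr 1; ring

/-- Energy bounds control the high modes in `L₂` of space-time. -/
theorem lintegral_sub_sq_le [Fact (1 ≤ p)] {s : ℝ} (hs : 1 / 2 < s) {R : ℝ} (hR : 0 ≤ R)
    {u v : StateSpace T p}
    (hu : ∫⁻ t, energyDensity s u t ∂timeMeasure T ≤ ENNReal.ofReal R)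
    (hv : ∫⁻ t, energyDensity s v t ∂timeMeasure T ≤ ENNReal.ofReal R)
    {N : ℕ} (hN : 0 < N) :
    ∫⁻ z, ENNReal.ofReal ((u.1.2 z - v.1.2 z) ^ 2) ∂spaceTimeMeasure T
      ≤ ENNReal.ofReal ((timeMeasure T).real univ * lowDist N u v + 4 * R / N) := by
  have hD := lowDist_nonneg N u v
  have hmeas : AEMeasurable (fun z => ENNReal.ofReal ((u.1.2 z - v.1.2 z) ^ 2))
      ((timeMeasure T).prod (volume : Measure UnitAddCircle)) :=
    (((Lp.aestronglyMeasurable u.1.2).aemeasurable.sub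
      (Lp.aestronglyMeasurable v.1.2).aemeasurable).pow_const 2).ennreal_ofReal
  have e1 : ∫⁻ z, ENNReal.ofReal ((u.1.2 z - v.1.2 z) ^ 2) ∂spaceTimeMeasure T
      = ∫⁻ t, ∫⁻ y, ENNReal.ofReal ((u.1.2 (t, y) - v.1.2 (t, y)) ^ 2)
        ∂(volume : Measure UnitAddCircle) ∂timeMeasure T := lintegral_prod _ hmeas
  have e2 : ∀ᵐ t ∂timeMeasure T, ∫⁻ y, ENNReal.ofReal ((u.1.2 (t, y) - v.1.2 (t, y)) ^ 2)
        ∂(volume : Measure UnitAddCircle)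
      = ∑' n, ENNReal.ofReal (‖modeCoeff u n t - modeCoeff v n t‖ ^ 2) := by
    filter_upwards [memLp_two_slice hs (ne_top_of_le_ne_top ENNReal.ofReal_ne_top hu),
      memLp_two_slice hs (ne_top_of_le_ne_top ENNReal.ofReal_ne_top hv), u.2, v.2]
      with t h1 h2 h3 h4
    have h5 := tsum_realCoeff_sq (h1.sub h2)
    refine Eq.trans h5.symm (tsum_congr fun n => ?_)
    rw [modeCoeff, modeCoeff, h3 n, h4 n,
      ← realCoeff_sub (h1.integrable (by norm_num)) (h2.integrable (by norm_num))]
    rfl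
  rw [e1, lintegral_congr_ae e2]
  calc ∫⁻ t, ∑' n, ENNReal.ofReal (‖modeCoeff u n t - modeCoeff v n t‖ ^ 2) ∂timeMeasure T
      ≤ ∫⁻ t, (ENNReal.ofReal (lowDist N u v) + ENNReal.ofReal (1 / N) *
          (ENNReal.ofReal 2 * energyDensity s u t + ENNReal.ofReal 2 * energyDensity s v t))
          ∂timeMeasure T := by
        refine lintegral_mono fun t => ?_
        refine (tsum_le_sum_add_mul_tsum (Finset.Icc (-(N : ℤ)) N)
          (d := fun n => ENNReal.ofReal (‖modeMap u n - modeMap v n‖ ^ 2))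
          (e := fun n => ENNReal.ofReal 2 * ENNReal.ofReal ((2 * Real.pi * |(n : ℝ)|) ^ (2 * s) *
              ‖modeCoeff u n t‖ ^ 2)
            + ENNReal.ofReal 2 * ENNReal.ofReal ((2 * Real.pi * |(n : ℝ)|) ^ (2 * s) *
              ‖modeCoeff v n t‖ ^ 2))
          (κ := ENNReal.ofReal (1 / N)) (fun n _ => ENNReal.ofReal_le_ofReal ?_)
            fun n hn => ?_).trans (le_of_eq ?_)
        · gcongr; exact norm_modeCoeff_sub_le_norm u v n t
        · rw [← ENNReal.ofReal_mul (by norm_num), ← ENNReal.ofReal_mul (by norm_num),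
            ← ENNReal.ofReal_add (by positivity) (by positivity),
            ← ENNReal.ofReal_mul (by positivity)]
          refine ENNReal.ofReal_le_ofReal ?_
          have hNR : (0 : ℝ) < N := by exact_mod_cast hN
          have h1 := (lt_abs_of_notMem_Icc hn).le.trans (abs_le_weight hs n)
          rw [one_div, ← div_eq_inv_mul, le_div_iff₀ hNR]
          calc ‖modeCoeff u n t - modeCoeff v n t‖ ^ 2 * N
              ≤ (2 * ‖modeCoeff u n t‖ ^ 2 + 2 * ‖modeCoeff v n t‖ ^ 2) *
                (2 * Real.pi * |(n : ℝ)|) ^ (2 * s) :=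
                mul_le_mul (norm_sub_sq_le _ _) h1 hNR.le (by positivity)
            _ = _ := by ring
        · rw [ENNReal.tsum_add, ENNReal.tsum_mul_left, ENNReal.tsum_mul_left, ← ofReal_lowDist]
          rfl
    _ = ENNReal.ofReal (lowDist N u v) * timeMeasure T univ + ENNReal.ofReal (1 / N) *
          (ENNReal.ofReal 2 * ∫⁻ t, energyDensity s u t ∂timeMeasure T
            + ENNReal.ofReal 2 * ∫⁻ t, energyDensity s v t ∂timeMeasure T) := by
        rw [lintegral_add_left measurable_const, lintegral_const, lintegral_const_mul' _ _
          ENNReal.ofReal_ne_top, lintegral_add_left ((measurable_energyDensity s u).const_mul _),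
          lintegral_const_mul' _ _ ENNReal.ofReal_ne_top,
          lintegral_const_mul' _ _ ENNReal.ofReal_ne_top]
    _ ≤ ENNReal.ofReal (lowDist N u v) * timeMeasure T univ + ENNReal.ofReal (1 / N) *
          (ENNReal.ofReal 2 * ENNReal.ofReal R + ENNReal.ofReal 2 * ENNReal.ofReal R) := by
        gcongr
    _ = _ := by
        rw [← ofReal_measureReal (μ := timeMeasure T) (s := univ), ← ENNReal.ofReal_mul hD,
          ← ENNReal.ofReal_mul (by norm_num), ← ENNReal.ofReal_add (by positivity)
          (by positivity), ← ENNReal.ofReal_mul (by positivity), ← ENNReal.ofReal_add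
          (by positivity) (by positivity)]
        congr 1; ring

/-- `L_2 ⊂ L_p` on a finite measure space for `p ≤ 2`, quantitatively. -/
theorem exists_dist_sq_le_of_lintegral_sq {α : Type*} [MeasurableSpace α] (μ : Measure α)
    [IsFiniteMeasure μ] {p : ℝ≥0∞} [Fact (1 ≤ p)] (hp : p ≤ 2) :
    ∃ Q : ℝ, 0 ≤ Q ∧ ∀ (v w : Lp ℝ p μ) (A : ℝ), 0 ≤ A →
      ∫⁻ z, ENNReal.ofReal ((v z - w z) ^ 2) ∂μ ≤ ENNReal.ofReal A → dist v w ^ 2 ≤ Q * A := by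
  set q := μ univ ^ (1 / p.toReal - 1 / (2 : ℝ≥0∞).toReal)
  have hp0 : 0 < p.toReal :=
    ENNReal.toReal_pos (zero_lt_one.trans_le Fact.out).ne' (ne_top_of_le_ne_top (by simp) hp)
  have hp2 : p.toReal ≤ (2 : ℝ≥0∞).toReal := ENNReal.toReal_mono (by simp) hp
  have hqt : q ≠ ⊤ := ENNReal.rpow_ne_top_of_nonneg
    (sub_nonneg.2 (one_div_le_one_div_of_le hp0 hp2)) (measure_ne_top μ _)
  refine ⟨q.toReal ^ 2, by positivity, fun v w A hA h => ?_⟩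
  have h1 : edist v w ≤ eLpNorm (⇑v - ⇑w) 2 μ * q := by
    rw [Lp.edist_def]
    exact eLpNorm_le_eLpNorm_mul_rpow_measure_univ hp
      ((Lp.aestronglyMeasurable v).sub (Lp.aestronglyMeasurable w))
  have h2 : eLpNorm (⇑v - ⇑w) 2 μ ^ 2 ≤ ENNReal.ofReal A := by
    rw [← lintegral_ofReal_norm_sq]
    refine le_trans (le_of_eq (lintegral_congr fun z => ?_)) h
    rw [Pi.sub_apply, Real.norm_eq_abs, sq_abs]
  rw [← ENNReal.ofReal_le_ofReal_iff (by positivity), ENNReal.ofReal_pow dist_nonneg, ← edist_dist,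
    ENNReal.ofReal_mul (by positivity), ENNReal.ofReal_pow ENNReal.toReal_nonneg,
    ENNReal.ofReal_toReal hqt]
  calc edist v w ^ 2 ≤ (eLpNorm (⇑v - ⇑w) 2 μ * q) ^ 2 := by gcongr
    _ = q ^ 2 * eLpNorm (⇑v - ⇑w) 2 μ ^ 2 := by rw [mul_pow, mul_comm]
    _ ≤ _ := by gcongr

/-- On a sublevel set of the cost the distance is controlled by finitely many Fourier modes, up
to a uniformly small error. -/
theorem exists_dist_sq_le [Fact (1 ≤ p)] (hp : p ≤ 2) (hT : 0 < T) (hf : LipschitzWith K f)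
    (hC : ∀ x, |f x| ≤ C) {ε s : ℝ} (hε : 0 < ε) (hs : 1 / 2 < s)
    (u₀ : Lp ℝ 2 (volume : Measure UnitAddCircle)) (M : ℝ≥0) :
    ∃ Q : ℝ, 0 ≤ Q ∧ ∀ u v : StateSpace T p, costFunctional T ε s p f u₀ u ≤ M →
      costFunctional T ε s p f u₀ v ≤ M → ∀ N : ℕ, 0 < N →
      dist u v ^ 2 ≤ Q * (lowDist N u v + 1 / N) := by
  obtain ⟨R, hR, hb⟩ := exists_sublevel_bound (p := p) hT hf hC hε hs u₀ M
  obtain ⟨Q, hQ, hq⟩ := exists_dist_sq_le_of_lintegral_sq (spaceTimeMeasure T) hp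
  set m := (timeMeasure T).real univ
  have hm : 0 ≤ m := measureReal_nonneg
  refine ⟨(1 + 4 * R) + Q * (m + 4 * R), by positivity, fun u v hu hv N hN => ?_⟩
  have hD := lowDist_nonneg N u v
  have h1 := dist_fst_sq_le hR (hb u hu).1 (hb v hv).1 hN
  have h2 := hq u.1.2 v.1.2 _ (by positivity)
    (lintegral_sub_sq_le hs hR (hb u hu).2 (hb v hv).2 hN)
  have hN0 : (0 : ℝ) ≤ 1 / N := by positivity
  have e1 : lowDist N u v + 4 * R / N ≤ (1 + 4 * R) * (lowDist N u v + 1 / N) := by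
    have : 4 * R / N = 4 * R * (1 / N) := by ring
    rw [this]
    nlinarith [mul_nonneg hR hD]
  have e2 : m * lowDist N u v + 4 * R / N ≤ (m + 4 * R) * (lowDist N u v + 1 / N) := by
    have : 4 * R / N = 4 * R * (1 / N) := by ring
    rw [this]
    nlinarith [mul_nonneg hR hD, mul_nonneg hm hN0]
  have e3 : dist u v ^ 2 ≤ dist u.1.1 v.1.1 ^ 2 + dist u.1.2 v.1.2 ^ 2 := by
    have : dist u v = max (dist u.1.1 v.1.1) (dist u.1.2 v.1.2) := rfl
    rw [this]
    rcases max_choice (dist u.1.1 v.1.1) (dist u.1.2 v.1.2) with h | h <;> rw [h] <;>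
      nlinarith [sq_nonneg (dist u.1.1 v.1.1), sq_nonneg (dist u.1.2 v.1.2)]
  calc dist u v ^ 2 ≤ _ := e3
    _ ≤ (1 + 4 * R) * (lowDist N u v + 1 / N) + Q * ((m + 4 * R) * (lowDist N u v + 1 / N)) :=
        add_le_add (h1.trans e1) (h2.trans (mul_le_mul_of_nonneg_left e2 hQ))
    _ = _ := by ring

theorem isCompact_sublevel [Fact (1 ≤ p)] (hp : p ≤ 2) (hT : 0 < T) (hf : LipschitzWith K f)
    (hC : ∀ x, |f x| ≤ C) {ε s : ℝ} (hε : 0 < ε) (hs : 1 / 2 < s)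
    (u₀ : Lp ℝ 2 (volume : Measure UnitAddCircle)) (M : ℝ≥0) :
    IsCompact {u : StateSpace T p | costFunctional T ε s p f u₀ u ≤ M} := by
  refine IsSeqCompact.isCompact fun u hu => ?_
  choose A hA hAu using exists_isCompact_modeMap (p := p) hT hf hC hε hs u₀ M
  -- Tychonoff's theorem for the countable product over the modes is the diagonal argument
  obtain ⟨a, -, φ, hφ, hlim⟩ := (isCompact_univ_pi hA).tendsto_subseq
    (x := fun j n => modeMap (u j) n) fun j n _ => hAu n _ (hu j)
  rw [tendsto_pi_nhds] at hlim
  obtain ⟨Q, hQ, hq⟩ := exists_dist_sq_le (p := p) hp hT hf hC hε hs u₀ M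
  have hlow : ∀ N : ℕ, Tendsto (fun q : ℕ × ℕ => lowDist N (u (φ q.1)) (u (φ q.2))) atTop
      (𝓝 0) := by
    intro N
    have : Tendsto (fun q : ℕ × ℕ => lowDist N (u (φ q.1)) (u (φ q.2))) atTop
        (𝓝 (∑ n ∈ Finset.Icc (-(N : ℤ)) N, ‖a n - a n‖ ^ 2)) := by
      rw [← prod_atTop_atTop_eq]
      exact tendsto_finsetSum _ fun n _ => ((((hlim n).comp tendsto_fst).sub
        ((hlim n).comp tendsto_snd)).norm.pow 2)
    simpa using this
  have hcauchy : CauchySeq (u ∘ φ) := by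
    refine Metric.cauchySeq_iff.2 fun e he => ?_
    obtain ⟨N, hN⟩ := exists_nat_gt (2 * Q / e ^ 2)
    have hN0 : (0 : ℝ) < N := lt_of_le_of_lt (by positivity) hN
    have hsmall : Q * (1 / N) < e ^ 2 / 2 := by
      rw [div_lt_iff₀ (by positivity)] at hN
      rw [mul_one_div, div_lt_iff₀ hN0]
      linarith
    obtain ⟨J, hJ⟩ := eventually_atTop.1 ((hlow N).eventually_lt_const
      (show 0 < e ^ 2 / (2 * (Q + 1)) by positivity))
    refine ⟨max J.1 J.2, fun j hj k hk => ?_⟩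
    have h1 := hJ (j, k) ⟨(le_max_left _ _).trans hj, (le_max_right _ _).trans hk⟩
    have h2 := hq _ _ (hu (φ j)) (hu (φ k)) N (by exact_mod_cast hN0)
    have h3 : Q * lowDist N (u (φ j)) (u (φ k)) ≤ e ^ 2 / 2 := by
      rw [lt_div_iff₀ (by positivity)] at h1
      nlinarith [lowDist_nonneg N (u (φ j)) (u (φ k))]
    refine lt_of_pow_lt_pow_left₀ 2 he.le (h2.trans_lt ?_)
    rw [mul_add]
    linarith
  obtain ⟨v, hv⟩ := cauchySeq_tendsto_of_complete hcauchy
  exact ⟨v, (isClosed_sublevel hT hf hC hε hs u₀ M).mem_of_tendsto hv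
    (Eventually.of_forall fun j => hu _), φ, hφ, hv⟩

end

end FracCost

end

theorem proposition2p2
    (T : ℝ) (_hT : 0 < T)
    (p : ℝ≥0∞) [Fact (1 ≤ p)] (_hp : p < 2)
    (s : ℝ) (_hs : 1 / 2 < s)
    (ε : ℝ) (_hε : 0 < ε)
    (f : ℝ → ℝ) (_hfb : ∃ C : ℝ, ∀ x : ℝ, |f x| ≤ C) (_hfl : ∃ K : ℝ≥0, LipschitzWith K f)
    (u₀ : Lp ℝ 2 (volume : Measure UnitAddCircle)) :
    LowerSemicontinuous (FracCost.costFunctional T ε s p f u₀) ∧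
    ∀ M : ℝ≥0, ∃ K : Set (FracCost.StateSpace T p), IsCompact K ∧
      {u : FracCost.StateSpace T p | FracCost.costFunctional T ε s p f u₀ u ≤ M} ⊆ K := by
  obtain ⟨C, hC⟩ := _hfb
  obtain ⟨K, hf⟩ := _hfl
  refine ⟨lowerSemicontinuous_iff_isClosed_preimage.2 fun y => ?_, fun M =>
    ⟨_, FracCost.isCompact_sublevel _hp.le _hT hf hC _hε _hs u₀ M, subset_rfl⟩⟩
  induction y with
  | top => simp
  | coe M => exact FracCost.isClosed_sublevel _hT hf hC _hε _hs u₀ M
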